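/- Let $k\ge 0$ be an integer and write $[m]=\{1,\dots,m\}$. **The partition algebra.** Let $\Pi_{2k}$ be the set of set partitions of $[k]\cup[k']=\{1,\dots,k,1',\dots,k'\}$, drawn as diagrams with top row $1,\dots,k$ and bottom row $1',\dots,k'$. For $\alpha,\beta\in\Pi_{2k}$ stack $\alpha$ on top of $\beta$, identifying the bottom row of $\alpha$ with the top row of $\beta$. Let $m(\alpha,\beta)$ be the number of connected components lying entirely in the middle row, and let $\alpha\circ\beta\in\Pi_{2k}$ be the partition of the top and bottom rows into connected components. The partition algebra $\mathcal A_{2k}$ is the free $\mathbb C[z]$-module on $\Pi_{2k}$ with product $\alpha\beta=z^{m(\alpha,\beta)}\,\alpha\circ\beta$, regarded as a $\mathbb C$-algebra. In it, for $i\in[k-1]$ and $j\in[k]$, every unmentioned $a$ forming a block $\{a,a'\}$: $s_i$ has blocks $\{i,(i+1)'\},\{i+1,i'\}$; $e_{2j-1}$ has blocks $\{j\},\{j'\}$; $e_{2i}$ has the block $\{i,i+1,i',(i+1)'\}$. Put $L_1=0$, $L_2=e_1$, $\sigma_2=1$, $\sigma_3=s_1$, and recursively, for $1\le i\le k-1$,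 \begin{align*} L_{2i+1}&=s_iL_{2i-1}s_i-L_{2i}e_{2i}-e_{2i}L_{2i}+(z-L_{2i-1})e_{2i}+\sigma_{2i},\\ L_{2i+2}&=s_iL_{2i}s_i-s_iL_{2i}e_{2i}-e_{2i}L_{2i}s_i+e_{2i}L_{2i}e_{2i+1}e_{2i}+\sigma_{2i+1}, \end{align*} and, for $2\le i\le k-1$, \begin{align*} \sigma_{2i}={}&s_{i-1}s_i\sigma_{2i-2}s_is_{i-1}+e_{2i-2}L_{2i-2}s_ie_{2i-2}s_i+s_ie_{2i-2}L_{2i-2}s_ie_{2i-2}\\ &-e_{2i-2}L_{2i-2}s_{i-1}e_{2i}e_{2i-1}e_{2i-2}-s_ie_{2i-2}e_{2i-1}e_{2i}s_{i-1}L_{2i-2}e_{2i-2}s_i,\\ \sigma_{2i+1}={}&s_{i-1}s_i\sigma_{2i-1}s_is_{i-1}+s_ie_{2i-2}L_{2i-2}s_ie_{2i-2}s_i+e_{2i-2}L_{2i-2}s_ie_{2i-2}\\ &-s_ie_{2i-2}L_{2i-2}s_{i-1}e_{2i}e_{2i-1}e_{2i-2}-e_{2i-2}e_{2i-1}e_{2i}s_{i-1}L_{2i-2}e_{2i-2}s_i.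 \end{align*} Set $t_{2i}=\sigma_{2i}-e_{2i}$ and $t_{2i+1}=\sigma_{2i+1}-e_{2i}$ for $i\in[k-1]$, and, for $r\in[2k]$, $X_r=z-1-L_r$ if $r$ is odd and $X_r=L_r-1$ if $r$ is even. **The affine partition algebra.** $\mathcal A_{2k}^{\mathrm{aff}}$ is the unital associative $\mathbb C$-algebra with generators $\tau_i$ ($2\le i\le 2k-1$), $e_j$ ($1\le j\le 2k-1$), $x_r$ ($1\le r\le 2k$), $z_l$ ($l\ge 0$) and the following relations, imposed for all values of the indices for which every generator that occurs has its index in the stated range. 1. $\tau_{2i}^2=\tau_{2i+1}^2=1-e_{2i}$. 2. $\tau_{2i+1}\tau_{2j}=\tau_{2j}\tau_{2i+1}$ for $j\ne i+1$; $\tau_{2i+1}\tau_{2j+1}=\tau_{2j+1}\tau_{2i+1}$ and $\tau_{2i}\tau_{2j}=\tau_{2j}\tau_{2i}$ for $j\ne i\pm1$; $\bar s_i\bar s_{i+1}\bar s_i=\bar s_{i+1}\bar s_i\bar s_{i+1}$, where $\bar s_j=\tau_{2j}\tau_{2j+1}+e_{2j}$. 3. $e_{2i-1}^2=z_0e_{2i-1}$;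 $e_{2i}^2=e_{2i}$; $\tau_{2i+1}e_{2i}=e_{2i}\tau_{2i+1}=\tau_{2i}e_{2i}=e_{2i}\tau_{2i}=0$; $\tau_{2i}e_{2i-1}e_{2i+1}=\tau_{2i+1}e_{2i-1}e_{2i+1}$; $e_{2i+1}e_{2i-1}\tau_{2i}=e_{2i+1}e_{2i-1}\tau_{2i+1}$. 4. $e_ie_j=e_je_i$ if $|i-j|\ge2$; $\tau_{2i-1}e_{2j-1}=e_{2j-1}\tau_{2i-1}$ if $j\ne i-1,i$; $\tau_{2i-1}e_{2j}=e_{2j}\tau_{2i-1}$ if $j\ne i$; $\tau_{2i}e_{2j-1}=e_{2j-1}\tau_{2i}$ if $j\ne i,i+1$; $\tau_{2i}e_{2j}=e_{2j}\tau_{2i}$ if $j\ne i-1$. 5. $e_ie_{i+1}e_i=e_i$; $e_{i+1}e_ie_{i+1}=e_{i+1}$; $\tau_{2i}e_{2i-1}\tau_{2i}=\tau_{2i+1}e_{2i+1}\tau_{2i+1}$; $\tau_{2i}e_{2i-2}\tau_{2i}=\tau_{2i-1}e_{2i}\tau_{2i-1}$. 6. $x_ix_j=x_jx_i$; $\tau_ix_j=x_j\tau_i$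 for $j\ne i-1,i,i+1$; $e_ix_j=x_je_i$ for $j\ne i,i+1$. 7. $\tau_{2i-2}\tau_{2i}\tau_{2i-2}=\tau_{2i}\tau_{2i-2}\tau_{2i}(1-e_{2i-2})$; $\tau_{2i+1}\tau_{2i-1}\tau_{2i+1}=\tau_{2i-1}\tau_{2i+1}\tau_{2i-1}(1-e_{2i})$; $\tau_{2i-1}\tau_{2i}\tau_{2i-1}=\tau_{2i}-e_{2i-2}\tau_{2i}-\tau_{2i}e_{2i-2}$; $\tau_{2i}\tau_{2i-1}\tau_{2i}=\tau_{2i-1}-e_{2i}\tau_{2i-1}-\tau_{2i-1}e_{2i}$. 8. $x_{2i+1}=\tau_{2i}x_{2i-1}\tau_{2i}+e_{2i}e_{2i-1}\tau_{2i}+\tau_{2i}e_{2i-1}e_{2i}-\tau_{2i}$; $x_{2i+2}=\tau_{2i+1}x_{2i}\tau_{2i+1}+e_{2i}e_{2i+1}\tau_{2i+1}e_{2i+1}e_{2i}+\tau_{2i+1}$; $x_{2i}=\tau_{2i}x_{2i}\tau_{2i}+e_{2i}e_{2i-1}\tau_{2i}+\tau_{2i}e_{2i-1}e_{2i}$; $x_{2i+1}=\tau_{2i+1}x_{2i+1}\tau_{2i+1}+e_{2i}e_{2i+1}\tau_{2i+1}+\tau_{2i+1}e_{2i+1}e_{2i}$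 (the last two for $i\in[k-1]$). 9. $e_i(x_i-x_{i+1})=0=(x_i-x_{i+1})e_i$. 10. $e_1x_1^le_1=z_le_1$ for $l\ge0$; every $z_l$ is central. **Statement.** (a) There is a unique $\mathbb C$-algebra homomorphism $\iota:\mathcal A_{2k}\to\mathcal A_{2k}^{\mathrm{aff}}$ with $\iota(z)=z_0$, $\iota(s_i)=\tau_{2i}\tau_{2i+1}+e_{2i}$ for $i\in[k-1]$, and $\iota(e_j)=e_j$ for $j\in[2k-1]$. (b) There is a unique $\mathbb C$-algebra homomorphism $\mathsf{pr}:\mathcal A_{2k}^{\mathrm{aff}}\to\mathcal A_{2k}$ with $\mathsf{pr}(\tau_i)=t_i$ for $2\le i\le 2k-1$, $\mathsf{pr}(e_j)=e_j$ for $j\in[2k-1]$, $\mathsf{pr}(x_r)=X_r$ for $r\in[2k]$, and $\mathsf{pr}(z_l)=z(z-1)^l$ for $l\ge0$. (c) $\mathsf{pr}\circ\iota=\mathrm{id}_{\mathcal A_{2k}}$, $\iota$ is injective and $\mathsf{pr}$ is surjective. So $\mathcal A_{2k}$ is both a subalgebra (via $\iota$) and a quotient (via $\mathsf{pr}$) of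 $\mathcal A_{2k}^{\mathrm{aff}}$. -/

import Mathlib

noncomputable section

namespace AffinePartition

/-! ### Partition diagrams -/

/-- A set partition of the `2k` vertices `[k] ∪ [k']`, as an equivalence relation.
`Sum.inl` is the top row, `Sum.inr` the bottom row; the `1`-based vertex `a + 1` of a row is the
element `a : Fin k`. -/
abbrev Diagram (k : ℕ) : Type := Setoid (Fin k ⊕ Fin k)

/-- Place a diagram's two rows at the rows `r` and `s` of a picture with `n` rows. -/
def rowPair {k n : ℕ} (r s : Fin n) : Fin k ⊕ Fin k → Fin n × Fin k :=
  Sum.elim (fun a => (r, a)) (fun a => (s, a))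

/-- `α` stacked on top of `β`: three rows `0, 1, 2`, with the bottom row of `α` identified with
the top row of `β` (row `1`). The classes are the connected components of the stacked picture. -/
def stack {k : ℕ} (α β : Diagram k) : Setoid (Fin 3 × Fin k) :=
  Setoid.map α (rowPair 0 1) ⊔ Setoid.map β (rowPair 1 2)

/-- The product `α ∘ β`: the connected components of the stacked picture, read off on the top
and the bottom row. -/
abbrev comp {k : ℕ} (α β : Diagram k) : Diagram k :=
  Setoid.comap (rowPair 0 2) (stack α β)

/-- The number of classes of `r` that contain no point of the form `f a`. -/
def avoid {A Z : Type} (f : A → Z) (r : Setoid Z) : ℕ :=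
  Nat.card {c : Quotient r // ∀ a : A, c ≠ Quotient.mk r (f a)}

/-- `m(α, β)`: the number of connected components of the stacked picture that lie entirely in the
middle row, that is, contain no vertex of the top or bottom row. -/
def middle {k : ℕ} (α β : Diagram k) : ℕ :=
  avoid (rowPair 0 2) (stack α β)

/-- The diagram with blocks `{i, i'}`. -/
abbrev idDiagram (k : ℕ) : Diagram k := Setoid.ker (Sum.elim id id)

/-! ### Helper facts: associativity and unit laws -/

theorem rowPair_injective {k n : ℕ} {r s : Fin n} (h : r ≠ s) :
    Function.Injective (rowPair (k := k) r s) := by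
  rintro (a | a) (b | b) hab <;> simp [rowPair] at hab <;> simp_all

theorem map_le {A Z : Type} {s : Setoid A} {f : A → Z} {t : Setoid Z} :
    Setoid.map s f ≤ t ↔ s ≤ Setoid.comap f t := by
  constructor
  · intro h a b hab
    exact h (Relation.EqvGen.rel _ _ ⟨a, b, hab, rfl, rfl⟩)
  · intro h
    refine Setoid.eqvGen_le ?_
    rintro _ _ ⟨a, b, hab, rfl, rfl⟩
    exact h hab

theorem map_map {A B Z : Type} (s : Setoid A) (f : A → B) (g : B → Z) :
    Setoid.map (Setoid.map s f) g = Setoid.map s (g ∘ f) := by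
  refine eq_of_forall_ge_iff fun t => ?_
  rw [map_le, map_le, map_le]; rfl

theorem map_sup {A Z : Type} (s t : Setoid A) (f : A → Z) :
    Setoid.map (s ⊔ t) f = Setoid.map s f ⊔ Setoid.map t f := by
  refine eq_of_forall_ge_iff fun u => ?_
  rw [map_le, sup_le_iff, sup_le_iff, map_le, map_le]

/-- The relation obtained from `r` by also gluing along `q` through `f`. -/
theorem glue_aux {A Z : Type} (f : A → Z) (r : Setoid Z) (s : Setoid A) {z w : Z}
    (h : (r ⊔ Setoid.map s f) z w) :
    r z w ∨ ∃ a b, r z (f a) ∧ (Setoid.comap f r ⊔ s) a b ∧ r (f b) w := by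
  have key : ∀ a b, r (f a) (f b) → (Setoid.comap f r ⊔ s) a b := fun a b hab =>
    (le_sup_left : Setoid.comap f r ≤ _) hab
  let T : Setoid Z :=
    { r := fun z w => r z w ∨ ∃ a b, r z (f a) ∧ (Setoid.comap f r ⊔ s) a b ∧ r (f b) w
      iseqv :=
        { refl := fun z => Or.inl (r.refl' z)
          symm := by
            rintro z w (h | ⟨a, b, h1, h2, h3⟩)
            · exact Or.inl (r.symm' h)
            · exact Or.inr ⟨b, a, r.symm' h3, Setoid.symm' _ h2, r.symm' h1⟩
          trans := by
            rintro x y z (h | ⟨a, b, h1, h2, h3⟩) (h' | ⟨a', b', h1', h2', h3'⟩)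
            · exact Or.inl (r.trans' h h')
            · exact Or.inr ⟨a', b', r.trans' h h1', h2', h3'⟩
            · exact Or.inr ⟨a, b, h1, h2, r.trans' h3 h'⟩
            · exact Or.inr ⟨a, b', h1, Setoid.trans' _ h2
                (Setoid.trans' _ (key _ _ (r.trans' h3 h1')) h2'), h3'⟩ } }
  have hT : r ⊔ Setoid.map s f ≤ T := by
    refine sup_le (fun {z w} h => Or.inl h) (map_le.2 fun {a b} h => ?_)
    exact Or.inr ⟨a, b, r.refl' _, (le_sup_right : s ≤ Setoid.comap f r ⊔ s) h, r.refl' _⟩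
  exact hT h

theorem comap_glue {A Z : Type} (f : A → Z) (r : Setoid Z) (s : Setoid A) :
    Setoid.comap f (r ⊔ Setoid.map s f) = Setoid.comap f r ⊔ s := by
  apply le_antisymm
  · intro a b hab
    have key : ∀ a b, r (f a) (f b) → (Setoid.comap f r ⊔ s) a b := fun a b hab =>
      (le_sup_left : Setoid.comap f r ≤ _) hab
    rcases glue_aux f r s hab with h | ⟨c, d, h1, h2, h3⟩
    · exact key _ _ h
    · exact Setoid.trans' _ (key _ _ h1) (Setoid.trans' _ h2 (key _ _ h3))
  · refine sup_le (fun {a b} h => ?_) (map_le.1 le_sup_right)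
    exact (le_sup_left : r ≤ r ⊔ Setoid.map s f) h

theorem avoid_glue {A Z : Type} (f : A → Z) (r : Setoid Z) (s : Setoid A) :
    avoid f (r ⊔ Setoid.map s f) = avoid f r := by
  symm
  let φ : Quotient r → Quotient (r ⊔ Setoid.map s f) :=
    Quotient.map' id (fun a b h => (le_sup_left : r ≤ r ⊔ Setoid.map s f) h)
  have hφ : ∀ z, φ (Quotient.mk r z) = Quotient.mk _ z := fun z => rfl
  refine Nat.card_congr (Equiv.ofBijective
    (fun c : {c : Quotient r // ∀ a : A, c ≠ Quotient.mk r (f a)} =>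
      (⟨φ c.1, ?_⟩ : {c : Quotient (r ⊔ Setoid.map s f) // ∀ a : A, c ≠ Quotient.mk _ (f a)}))
    ⟨?_, ?_⟩)
  · obtain ⟨c, hc⟩ := c
    induction c using Quotient.inductionOn with | _ z =>
    intro a h
    rcases glue_aux f r s (Quotient.exact h) with h | ⟨c, d, h1, -, -⟩
    · exact hc a (Quotient.sound h)
    · exact hc c (Quotient.sound h1)
  · rintro ⟨c, hc⟩ ⟨d, hd⟩ h
    induction c using Quotient.inductionOn with | _ z =>
    induction d using Quotient.inductionOn with | _ w =>
    have h' := Quotient.exact (Subtype.ext_iff.1 h)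
    rcases glue_aux f r s h' with h | ⟨c, d, h1, -, -⟩
    · exact Subtype.ext (Quotient.sound h)
    · exact absurd (Quotient.sound h1) (hc c)
  · rintro ⟨c, hc⟩
    induction c using Quotient.inductionOn with | _ z =>
    refine ⟨⟨Quotient.mk r z, fun a h => hc a ?_⟩, rfl⟩
    exact congrArg φ h

theorem card_eq_add_avoid {A Z : Type} [Finite Z] (f : A → Z) (r : Setoid Z) :
    Nat.card (Quotient r) = Nat.card (Quotient (Setoid.comap f r)) + avoid f r := by
  classical
  have e := Equiv.sumCompl (fun c : Quotient r => ∃ a, c = Quotient.mk r (f a))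
  rw [← Nat.card_congr e, Nat.card_sum]
  congr 1
  · symm
    refine Nat.card_congr (Equiv.ofBijective
      (Quotient.lift (fun a => (⟨Quotient.mk r (f a), a, rfl⟩ :
        {c : Quotient r // ∃ a, c = Quotient.mk r (f a)}))
        (fun a b h => Subtype.ext (Quotient.sound h))) ⟨?_, ?_⟩)
    · intro c d h
      induction c using Quotient.inductionOn with | _ z =>
      induction d using Quotient.inductionOn with | _ w =>
      exact Quotient.sound (Quotient.exact (Subtype.ext_iff.1 h) : r (f z) (f w))
    · rintro ⟨_, a, rfl⟩
      exact ⟨Quotient.mk _ a, rfl⟩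
  · exact Nat.card_congr (Equiv.subtypeEquivRight fun c => by simp)

theorem comap_bot {A Z : Type} {f : A → Z} (hf : Function.Injective f) :
    Setoid.comap f (⊥ : Setoid Z) = ⊥ := by
  ext a b
  exact hf.eq_iff

theorem comap_map {A Z : Type} {f : A → Z} (hf : Function.Injective f) (s : Setoid A) :
    Setoid.comap f (Setoid.map s f) = s := by
  have h := comap_glue f ⊥ s
  rwa [comap_bot hf, bot_sup_eq, bot_sup_eq] at h

theorem map_rel {A Z : Type} {f : A → Z} (hf : Function.Injective f) {s : Setoid A} {z w : Z}
    (h : Setoid.map s f z w) : z = w ∨ ∃ a b, s a b ∧ f a = z ∧ f b = w := by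
  have h' : ((⊥ : Setoid Z) ⊔ Setoid.map s f) z w := by rwa [bot_sup_eq]
  rcases glue_aux f ⊥ s h' with h | ⟨a, b, h1, h2, h3⟩
  · exact Or.inl h
  · rw [comap_bot hf, bot_sup_eq] at h2
    exact Or.inr ⟨a, b, h2, (h1 : z = f a).symm, h3⟩

theorem card_bot (Z : Type) : Nat.card (Quotient (⊥ : Setoid Z)) = Nat.card Z :=
  Nat.card_congr (Equiv.ofBijective (fun z => Quotient.mk ⊥ z)
    ⟨fun _ _ h => Quotient.exact h, Quotient.exists_rep⟩).symm

theorem card_map {A Z : Type} [Finite Z] {f : A → Z} (hf : Function.Injective f) (s : Setoid A) :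
    Nat.card (Quotient (Setoid.map s f)) + Nat.card A = Nat.card (Quotient s) + Nat.card Z := by
  have h1 := card_eq_add_avoid f (Setoid.map s f)
  have h2 := card_eq_add_avoid f (⊥ : Setoid Z)
  have h3 := avoid_glue f ⊥ s
  rw [bot_sup_eq] at h3
  rw [comap_map hf] at h1
  rw [comap_bot hf, card_bot, card_bot] at h2
  omega

theorem card_stack {k : ℕ} (α β : Diagram k) :
    Nat.card (Quotient (stack α β)) = Nat.card (Quotient (comp α β)) + middle α β :=
  card_eq_add_avoid _ _

/-- Both bracketings of a triple product are instances: `h` places the inner stack into four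
rows, `g` forgets its middle row, `p` places the inner product into three rows. -/
theorem triple {k : ℕ} (ρ : Setoid (Fin 3 × Fin k)) (γ : Setoid (Fin k ⊕ Fin k))
    (h g : Fin 3 × Fin k → Fin 4 × Fin k) (p q : Fin k ⊕ Fin k → Fin 3 × Fin k)
    (hh : Function.Injective h) (hg : Function.Injective g) (hp : Function.Injective p)
    (hc : ∀ w, g (p w) = h (rowPair 0 2 w))
    (hr : ∀ u a, g u = h a → ∃ w, u = p w ∧ a = rowPair 0 2 w) :
    Setoid.comap g (Setoid.map ρ h ⊔ Setoid.map γ (g ∘ q)) =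
        Setoid.map (Setoid.comap (rowPair 0 2) ρ) p ⊔ Setoid.map γ q ∧
      Nat.card (Quotient (Setoid.map ρ h ⊔ Setoid.map γ (g ∘ q))) =
        Nat.card (Quotient (Setoid.map (Setoid.comap (rowPair 0 2) ρ) p ⊔ Setoid.map γ q)) +
          avoid (rowPair 0 2) ρ := by
  have e : Setoid.comap g (Setoid.map ρ h) = Setoid.map (Setoid.comap (rowPair 0 2) ρ) p := by
    apply le_antisymm
    · intro u v huv
      rcases map_rel hh huv with he | ⟨a, b, hab, ha, hb⟩
      · rw [hg he]
      · obtain ⟨w, rfl, rfl⟩ := hr u a ha.symm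
        obtain ⟨w', rfl, rfl⟩ := hr v b hb.symm
        exact Relation.EqvGen.rel _ _ ⟨w, w', hab, rfl, rfl⟩
    · refine map_le.2 fun {w w'} hw => ?_
      change Setoid.map ρ h (g (p w)) (g (p w'))
      rw [hc, hc]
      exact Relation.EqvGen.rel _ _ ⟨_, _, hw, rfl, rfl⟩
  have c := comap_glue g (Setoid.map ρ h) (Setoid.map γ q)
  rw [map_map, e] at c
  refine ⟨c, ?_⟩
  have a := avoid_glue g (Setoid.map ρ h) (Setoid.map γ q)
  rw [map_map] at a
  have n1 := card_eq_add_avoid g (Setoid.map ρ h ⊔ Setoid.map γ (g ∘ q))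
  have n2 := card_eq_add_avoid g (Setoid.map ρ h)
  have n3 := card_map hh ρ
  have n4 := card_map hp (Setoid.comap (rowPair 0 2) ρ)
  have n5 := card_eq_add_avoid (rowPair 0 2) ρ
  rw [c, a] at n1
  rw [e] at n2
  simp only [Nat.card_eq_fintype_card, Fintype.card_prod, Fintype.card_sum, Fintype.card_fin]
    at n3 n4
  omega

/-- The inclusion of three rows as the rows `r 0, r 1, r 2` of a picture with four rows. -/
def rows {k : ℕ} (r : Fin 3 → Fin 4) (x : Fin 3 × Fin k) : Fin 4 × Fin k := (r x.1, x.2)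

theorem rows_injective {k : ℕ} {r : Fin 3 → Fin 4} (hr : Function.Injective r) :
    Function.Injective (rows (k := k) r) := by
  rintro ⟨a, b⟩ ⟨c, d⟩ h
  simp only [rows, Prod.mk.injEq] at h
  exact Prod.ext (hr h.1) h.2

theorem rows_rowPair {k : ℕ} (r : Fin 3 → Fin 4) (s t : Fin 3) :
    rows (k := k) r ∘ rowPair s t = rowPair (r s) (r t) := by
  funext x; rcases x with a | a <;> rfl

theorem triple_left {k : ℕ} (α β γ : Diagram k) :
    Setoid.comap (rowPair 0 3) (Setoid.map α (rowPair (n := 4) 0 1) ⊔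
        Setoid.map β (rowPair 1 2) ⊔ Setoid.map γ (rowPair 2 3)) = comp (comp α β) γ ∧
      Nat.card (Quotient (Setoid.map α (rowPair (n := 4) 0 1) ⊔
        Setoid.map β (rowPair 1 2) ⊔ Setoid.map γ (rowPair 2 3))) =
        Nat.card (Quotient (stack (comp α β) γ)) + middle α β := by
  have hi : Function.Injective ![(0 : Fin 4), 1, 2] := by decide
  have hj : Function.Injective ![(0 : Fin 4), 2, 3] := by decide
  obtain ⟨h1, h2⟩ := triple (stack α β) γ (rows ![0, 1, 2]) (rows ![0, 2, 3]) (rowPair 0 1)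
    (rowPair 1 2) (rows_injective hi) (rows_injective hj) (rowPair_injective (by decide))
    (by rintro (a | a) <;> rfl)
    (by
      rintro ⟨r, a⟩ ⟨s, b⟩ h
      simp only [rows, Prod.mk.injEq] at h
      obtain ⟨h, rfl⟩ := h
      fin_cases r <;> fin_cases s <;> first
        | exact absurd h (by decide)
        | exact ⟨Sum.inl a, rfl, rfl⟩
        | exact ⟨Sum.inr a, rfl, rfl⟩)
  rw [stack, map_sup, map_map, map_map, rows_rowPair, rows_rowPair, rows_rowPair] at h1 h2
  refine ⟨?_, h2⟩
  have := congrArg (Setoid.comap (rowPair 0 2)) h1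
  refine Eq.trans ?_ this
  ext x y
  rcases x with x | x <;> rcases y with y | y <;> rfl

theorem triple_right {k : ℕ} (α β γ : Diagram k) :
    Setoid.comap (rowPair 0 3) (Setoid.map α (rowPair (n := 4) 0 1) ⊔
        Setoid.map β (rowPair 1 2) ⊔ Setoid.map γ (rowPair 2 3)) = comp α (comp β γ) ∧
      Nat.card (Quotient (Setoid.map α (rowPair (n := 4) 0 1) ⊔
        Setoid.map β (rowPair 1 2) ⊔ Setoid.map γ (rowPair 2 3))) =
        Nat.card (Quotient (stack α (comp β γ))) + middle β γ := by
  have hi : Function.Injective ![(1 : Fin 4), 2, 3] := by decide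
  have hj : Function.Injective ![(0 : Fin 4), 1, 3] := by decide
  obtain ⟨h1, h2⟩ := triple (stack β γ) α (rows ![1, 2, 3]) (rows ![0, 1, 3]) (rowPair 1 2)
    (rowPair 0 1) (rows_injective hi) (rows_injective hj) (rowPair_injective (by decide))
    (by rintro (a | a) <;> rfl)
    (by
      rintro ⟨r, a⟩ ⟨s, b⟩ h
      simp only [rows, Prod.mk.injEq] at h
      obtain ⟨h, rfl⟩ := h
      fin_cases r <;> fin_cases s <;> first
        | exact absurd h (by decide)
        | exact ⟨Sum.inl a, rfl, rfl⟩
        | exact ⟨Sum.inr a, rfl, rfl⟩)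
  rw [stack, map_sup, map_map, map_map, rows_rowPair, rows_rowPair, rows_rowPair] at h1 h2
  rw [sup_comm _ (Setoid.map α _), sup_comm _ (Setoid.map α _)] at h1 h2
  rw [sup_assoc]
  refine ⟨?_, h2⟩
  have := congrArg (Setoid.comap (rowPair 0 2)) h1
  refine Eq.trans ?_ this
  ext x y
  rcases x with x | x <;> rcases y with y | y <;> rfl

theorem comp_assoc {k : ℕ} (α β γ : Diagram k) : comp (comp α β) γ = comp α (comp β γ) :=
  (triple_left α β γ).1.symm.trans (triple_right α β γ).1

theorem middle_assoc {k : ℕ} (α β γ : Diagram k) :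
    middle α β + middle (comp α β) γ = middle β γ + middle α (comp β γ) := by
  have h1 := (triple_left α β γ).2
  have h2 := (triple_right α β γ).2
  have h3 := card_stack (comp α β) γ
  have h4 := card_stack α (comp β γ)
  rw [comp_assoc] at h3
  omega

theorem avoid_eq_zero {A Z : Type} (f : A → Z) (r : Setoid Z) (h : ∀ z, ∃ a, r z (f a)) :
    avoid f r = 0 := by
  have : IsEmpty {c : Quotient r // ∀ a : A, c ≠ Quotient.mk r (f a)} := by
    refine ⟨fun c => ?_⟩
    obtain ⟨c, hc⟩ := c
    induction c using Quotient.inductionOn with | _ z =>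
    obtain ⟨a, ha⟩ := h z
    exact hc a (Quotient.sound ha)
  exact Nat.card_of_isEmpty

theorem id_rel {k : ℕ} (a : Fin k) : idDiagram k (Sum.inl a) (Sum.inr a) := rfl

theorem stack_left {k : ℕ} {α : Diagram k} (β : Diagram k) {v w : Fin k ⊕ Fin k} (h : α v w) :
    stack α β (rowPair 0 1 v) (rowPair 0 1 w) :=
  map_le.1 (le_sup_left : Setoid.map α (rowPair 0 1) ≤ stack α β) h

theorem stack_right {k : ℕ} (α : Diagram k) {β : Diagram k} {v w : Fin k ⊕ Fin k} (h : β v w) :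
    stack α β (rowPair 1 2 v) (rowPair 1 2 w) :=
  map_le.1 (le_sup_right : Setoid.map β (rowPair 1 2) ≤ stack α β) h

theorem id_comp {k : ℕ} (α : Diagram k) : comp (idDiagram k) α = α := by
  let c : Fin 3 × Fin k → Fin k ⊕ Fin k := fun x => ![Sum.inl x.2, Sum.inl x.2, Sum.inr x.2] x.1
  have hs : stack (idDiagram k) α ≤ Setoid.comap c α := by
    refine sup_le (map_le.2 fun {v w} h => ?_) (map_le.2 fun {v w} h => ?_)
    · have h' : (Sum.elim id id v : Fin k) = Sum.elim id id w := h
      rcases v with v | v <;> rcases w with w | w <;> (cases h'; exact α.refl' _)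
    · rcases v with v | v <;> rcases w with w | w <;> exact h
  have hx : ∀ v : Fin k ⊕ Fin k, stack (idDiagram k) α (rowPair 0 2 v) (rowPair 1 2 v) := by
    rintro (v | v)
    · exact stack_left α (id_rel v)
    · exact Setoid.refl' _ _
  ext v w
  constructor
  · intro h
    have := hs h
    rcases v with v | v <;> rcases w with w | w <;> exact this
  · intro h
    exact (stack _ α).trans' (hx v) ((stack _ α).trans' (stack_right _ h) ((stack _ α).symm' (hx w)))

theorem comp_id {k : ℕ} (α : Diagram k) : comp α (idDiagram k) = α := by
  let c : Fin 3 × Fin k → Fin k ⊕ Fin k := fun x => ![Sum.inl x.2, Sum.inr x.2, Sum.inr x.2] x.1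
  have hs : stack α (idDiagram k) ≤ Setoid.comap c α := by
    refine sup_le (map_le.2 fun {v w} h => ?_) (map_le.2 fun {v w} h => ?_)
    · rcases v with v | v <;> rcases w with w | w <;> exact h
    · have h' : (Sum.elim id id v : Fin k) = Sum.elim id id w := h
      rcases v with v | v <;> rcases w with w | w <;> (cases h'; exact α.refl' _)
  have hx : ∀ v : Fin k ⊕ Fin k, stack α (idDiagram k) (rowPair 0 2 v) (rowPair 0 1 v) := by
    rintro (v | v)
    · exact Setoid.refl' _ _
    · exact Setoid.symm' _ (stack_right α (id_rel v))
  ext v w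
  constructor
  · intro h
    have := hs h
    rcases v with v | v <;> rcases w with w | w <;> exact this
  · intro h
    exact (stack α _).trans' (hx v) ((stack α _).trans' (stack_left _ h) ((stack α _).symm' (hx w)))

theorem middle_id_left {k : ℕ} (α : Diagram k) : middle (idDiagram k) α = 0 := by
  refine avoid_eq_zero _ _ ?_
  rintro ⟨r, a⟩
  fin_cases r
  · exact ⟨Sum.inl a, Setoid.refl' _ _⟩
  · exact ⟨Sum.inl a, Setoid.symm' _ (stack_left α (id_rel a))⟩
  · exact ⟨Sum.inr a, Setoid.refl' _ _⟩

theorem middle_id_right {k : ℕ} (α : Diagram k) : middle α (idDiagram k) = 0 := by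
  refine avoid_eq_zero _ _ ?_
  rintro ⟨r, a⟩
  fin_cases r
  · exact ⟨Sum.inl a, Setoid.refl' _ _⟩
  · exact ⟨Sum.inr a, stack_right α (id_rel a)⟩
  · exact ⟨Sum.inr a, Setoid.refl' _ _⟩

/-! ### The partition algebra -/

/-- The formal product `z ^ power * diagram`. -/
@[ext]
structure ScaledDiagram (k : ℕ) : Type where
  power : ℕ
  diagram : Diagram k

/-- `(z^n α) (z^m β) = z^(n + m + m(α, β)) (α ∘ β)`, with unit `z^0 1`. -/
instance (k : ℕ) : Monoid (ScaledDiagram k) where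
  mul x y := ⟨x.power + y.power + middle x.diagram y.diagram, comp x.diagram y.diagram⟩
  one := ⟨0, idDiagram k⟩
  mul_assoc x y z := by
    refine ScaledDiagram.ext ?_ (comp_assoc _ _ _)
    have := middle_assoc x.diagram y.diagram z.diagram
    change x.power + y.power + middle x.diagram y.diagram + z.power +
        middle (comp x.diagram y.diagram) z.diagram =
      x.power + (y.power + z.power + middle y.diagram z.diagram) +
        middle x.diagram (comp y.diagram z.diagram)
    omega
  one_mul x := by
    refine ScaledDiagram.ext ?_ (id_comp _)
    change 0 + x.power + middle (idDiagram k) x.diagram = x.power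
    rw [middle_id_left]; omega
  mul_one x := by
    refine ScaledDiagram.ext ?_ (comp_id _)
    change x.power + 0 + middle x.diagram (idDiagram k) = x.power
    rw [middle_id_right]; omega

/-- The partition algebra `A_{2k}` over `ℂ`: it has the `ℂ`-basis `z^n α` (`n ≥ 0`, `α` a set
partition of `[k] ∪ [k']`), multiplied by `(z^n α) (z^m β) = z^(n + m + m(α, β)) (α ∘ β)`. So it is
the `ℂ[z]`-algebra that is free over `ℂ[z]` on the set partitions, with product
`α β = z^(m(α, β)) (α ∘ β)`, regarded as a `ℂ`-algebra. -/
abbrev PartitionAlgebra (k : ℕ) : Type := MonoidAlgebra ℂ (ScaledDiagram k)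

namespace PartitionAlgebra

/-- A set partition as an element of the partition algebra. -/
def ofDiagram {k : ℕ} (α : Diagram k) : PartitionAlgebra k :=
  MonoidAlgebra.of ℂ (ScaledDiagram k) ⟨0, α⟩

/-- The central parameter `z`. -/
def z (k : ℕ) : PartitionAlgebra k :=
  MonoidAlgebra.of ℂ (ScaledDiagram k) ⟨1, idDiagram k⟩

theorem z_pow_mul_ofDiagram {k : ℕ} (n : ℕ) (α : Diagram k) :
    z k ^ n * ofDiagram α = MonoidAlgebra.of ℂ (ScaledDiagram k) ⟨n, α⟩ := by
  induction n with
  | zero => rw [pow_zero, one_mul]; rfl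
  | succ n ih =>
    rw [pow_succ', mul_assoc, ih, z, ← map_mul]
    congr 1
    refine ScaledDiagram.ext ?_ (id_comp _)
    change 1 + n + middle (idDiagram k) α = n + 1
    rw [middle_id_left]; omega

theorem ofDiagram_mul {k : ℕ} (α β : Diagram k) :
    ofDiagram α * ofDiagram β = z k ^ middle α β * ofDiagram (comp α β) := by
  rw [z_pow_mul_ofDiagram, ofDiagram, ofDiagram, ← map_mul]
  congr 1
  refine ScaledDiagram.ext ?_ rfl
  change 0 + 0 + middle α β = middle α β
  omega

/-- The Coxeter generator `s_i` (`1 ≤ i ≤ k - 1`): blocks `{i, (i+1)'}`, `{i+1, i'}`, and `{a, a'}`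
for the other `a`. -/
def s (k i : ℕ) : PartitionAlgebra k :=
  ofDiagram (Setoid.ker (Sum.elim (fun a : Fin k => (a : ℕ) + 1)
    (fun a : Fin k => Equiv.swap i (i + 1) ((a : ℕ) + 1))))

/-- `e_{2j-1}` (`1 ≤ j ≤ k`): blocks `{j}`, `{j'}`, and `{a, a'}` for the other `a`. -/
def eOdd (k j : ℕ) : PartitionAlgebra k :=
  ofDiagram (Setoid.ker (Sum.elim (fun a : Fin k => (a : ℕ) + 1)
    (fun a : Fin k => if (a : ℕ) + 1 = j then 0 else (a : ℕ) + 1)))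

/-- `e_{2i}` (`1 ≤ i ≤ k - 1`): blocks `{i, i+1, i', (i+1)'}`, and `{a, a'}` for the other `a`. -/
def eEven (k i : ℕ) : PartitionAlgebra k :=
  ofDiagram (Setoid.ker (Sum.elim
    (fun a : Fin k => if (a : ℕ) + 1 = i + 1 then i else (a : ℕ) + 1)
    (fun a : Fin k => if (a : ℕ) + 1 = i + 1 then i else (a : ℕ) + 1)))

/-- The generators `e_j`, `1 ≤ j ≤ 2k - 1`. -/
def e (k j : ℕ) : PartitionAlgebra k :=
  if Even j then eEven k (j / 2) else eOdd k ((j + 1) / 2)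

/-! The Jucys–Murphy elements `L_r` and Enyang's generators `σ_r`, by Enyang's recursion. The
index shift is `LOdd i = L_{2i+1}`, `LEven i = L_{2i+2}`, `σEven i = σ_{2i+2}`,
`σOdd i = σ_{2i+3}`, for `i ≥ 0`. -/

mutual

def LOdd (k : ℕ) : ℕ → PartitionAlgebra k
  | 0 => 0
  | i + 1 =>
    s k (i + 1) * LOdd k i * s k (i + 1)
      - LEven k i * e k (2 * i + 2) - e k (2 * i + 2) * LEven k i
      + (z k - LOdd k i) * e k (2 * i + 2) + σEven k i

def LEven (k : ℕ) : ℕ → PartitionAlgebra k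
  | 0 => e k 1
  | i + 1 =>
    s k (i + 1) * LEven k i * s k (i + 1)
      - s k (i + 1) * LEven k i * e k (2 * i + 2)
      - e k (2 * i + 2) * LEven k i * s k (i + 1)
      + e k (2 * i + 2) * LEven k i * e k (2 * i + 3) * e k (2 * i + 2) + σOdd k i

def σEven (k : ℕ) : ℕ → PartitionAlgebra k
  | 0 => 1
  | i + 1 =>
    s k (i + 1) * s k (i + 2) * σEven k i * s k (i + 2) * s k (i + 1)
      + e k (2 * i + 2) * LEven k i * s k (i + 2) * e k (2 * i + 2) * s k (i + 2)
      + s k (i + 2) * e k (2 * i + 2) * LEven k i * s k (i + 2) * e k (2 * i + 2)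
      - e k (2 * i + 2) * LEven k i * s k (i + 1) * e k (2 * i + 4) * e k (2 * i + 3)
          * e k (2 * i + 2)
      - s k (i + 2) * e k (2 * i + 2) * e k (2 * i + 3) * e k (2 * i + 4) * s k (i + 1)
          * LEven k i * e k (2 * i + 2) * s k (i + 2)

def σOdd (k : ℕ) : ℕ → PartitionAlgebra k
  | 0 => s k 1
  | i + 1 =>
    s k (i + 1) * s k (i + 2) * σOdd k i * s k (i + 2) * s k (i + 1)
      + s k (i + 2) * e k (2 * i + 2) * LEven k i * s k (i + 2) * e k (2 * i + 2) * s k (i + 2)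
      + e k (2 * i + 2) * LEven k i * s k (i + 2) * e k (2 * i + 2)
      - s k (i + 2) * e k (2 * i + 2) * LEven k i * s k (i + 1) * e k (2 * i + 4)
          * e k (2 * i + 3) * e k (2 * i + 2)
      - e k (2 * i + 2) * e k (2 * i + 3) * e k (2 * i + 4) * s k (i + 1) * LEven k i
          * e k (2 * i + 2) * s k (i + 2)

end

/-- The normalised Jucys–Murphy element `X_r`, `1 ≤ r ≤ 2k`: `z - 1 - L_r` for odd `r` and
`L_r - 1` for even `r`. -/
def X (k r : ℕ) : PartitionAlgebra k :=
  if Even r then LEven k (r / 2 - 1) - 1 else z k - 1 - LOdd k (r / 2)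

/-- The normalised Enyang generator `t_r`, `2 ≤ r ≤ 2k - 1`: `t_{2i} = σ_{2i} - e_{2i}` and
`t_{2i+1} = σ_{2i+1} - e_{2i}`. -/
def t (k r : ℕ) : PartitionAlgebra k :=
  if Even r then σEven k (r / 2 - 1) - e k r else σOdd k (r / 2 - 1) - e k (r - 1)

end PartitionAlgebra

/-! ### The affine partition algebra -/

/-- The generators `τ_i` (`2 ≤ i ≤ 2k - 1`), `e_j` (`1 ≤ j ≤ 2k - 1`), `x_r` (`1 ≤ r ≤ 2k`) and
`z_l` (`l ≥ 0`). -/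
inductive AffGen (k : ℕ) : Type
  | tau (i : ℕ) (h : 2 ≤ i ∧ i < 2 * k) : AffGen k
  | e (j : ℕ) (h : 1 ≤ j ∧ j < 2 * k) : AffGen k
  | x (r : ℕ) (h : 1 ≤ r ∧ r ≤ 2 * k) : AffGen k
  | z (l : ℕ) : AffGen k

/-! The generators in the free algebra. The value `0` outside the index range is a placeholder:
every relation below mentions only indices inside the range. -/

namespace Free

def τ (k i : ℕ) : FreeAlgebra ℂ (AffGen k) :=
  if h : 2 ≤ i ∧ i < 2 * k then FreeAlgebra.ι ℂ (AffGen.tau i h) else 0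

def e (k j : ℕ) : FreeAlgebra ℂ (AffGen k) :=
  if h : 1 ≤ j ∧ j < 2 * k then FreeAlgebra.ι ℂ (AffGen.e j h) else 0

def x (k r : ℕ) : FreeAlgebra ℂ (AffGen k) :=
  if h : 1 ≤ r ∧ r ≤ 2 * k then FreeAlgebra.ι ℂ (AffGen.x r h) else 0

def z (k l : ℕ) : FreeAlgebra ℂ (AffGen k) := FreeAlgebra.ι ℂ (AffGen.z l)

/-- `s_j = τ_{2j} τ_{2j+1} + e_{2j}`, `1 ≤ j ≤ k - 1`. -/
def s (k j : ℕ) : FreeAlgebra ℂ (AffGen k) := τ k (2 * j) * τ k (2 * j + 1) + e k (2 * j)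

end Free

open Free in
/-- The defining relations of the affine partition algebra. -/
inductive AffRel (k : ℕ) : FreeAlgebra ℂ (AffGen k) → FreeAlgebra ℂ (AffGen k) → Prop
  -- Involutions
  | r1i (i : ℕ) (hi : 1 ≤ i ∧ i < k) : AffRel k (τ k (2 * i) ^ 2) (1 - e k (2 * i))
  | r1ii (i : ℕ) (hi : 1 ≤ i ∧ i < k) : AffRel k (τ k (2 * i + 1) ^ 2) (1 - e k (2 * i))
  -- Braid relations
  | r2i (i j : ℕ) (hi : 1 ≤ i ∧ i < k) (hj : 1 ≤ j ∧ j < k) (h : j ≠ i + 1) :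
      AffRel k (τ k (2 * i + 1) * τ k (2 * j)) (τ k (2 * j) * τ k (2 * i + 1))
  | r2ii (i j : ℕ) (hi : 1 ≤ i ∧ i < k) (hj : 1 ≤ j ∧ j < k) (h : j ≠ i + 1 ∧ i ≠ j + 1) :
      AffRel k (τ k (2 * i + 1) * τ k (2 * j + 1)) (τ k (2 * j + 1) * τ k (2 * i + 1))
  | r2iii (i j : ℕ) (hi : 1 ≤ i ∧ i < k) (hj : 1 ≤ j ∧ j < k) (h : j ≠ i + 1 ∧ i ≠ j + 1) :
      AffRel k (τ k (2 * i) * τ k (2 * j)) (τ k (2 * j) * τ k (2 * i))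
  | r2iv (i : ℕ) (hi : 1 ≤ i ∧ i + 1 < k) :
      AffRel k (s k i * s k (i + 1) * s k i) (s k (i + 1) * s k i * s k (i + 1))
  -- Idempotent relations
  | r3i (i : ℕ) (hi : 1 ≤ i ∧ i ≤ k) :
      AffRel k (e k (2 * i - 1) ^ 2) (z k 0 * e k (2 * i - 1))
  | r3ii (i : ℕ) (hi : 1 ≤ i ∧ i < k) : AffRel k (e k (2 * i) ^ 2) (e k (2 * i))
  | r3iii (i : ℕ) (hi : 1 ≤ i ∧ i < k) : AffRel k (τ k (2 * i + 1) * e k (2 * i)) 0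
  | r3iii' (i : ℕ) (hi : 1 ≤ i ∧ i < k) : AffRel k (e k (2 * i) * τ k (2 * i + 1)) 0
  | r3iv (i : ℕ) (hi : 1 ≤ i ∧ i < k) : AffRel k (τ k (2 * i) * e k (2 * i)) 0
  | r3iv' (i : ℕ) (hi : 1 ≤ i ∧ i < k) : AffRel k (e k (2 * i) * τ k (2 * i)) 0
  | r3v (i : ℕ) (hi : 1 ≤ i ∧ i < k) :
      AffRel k (τ k (2 * i) * e k (2 * i - 1) * e k (2 * i + 1))
        (τ k (2 * i + 1) * e k (2 * i - 1) * e k (2 * i + 1))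
  | r3vi (i : ℕ) (hi : 1 ≤ i ∧ i < k) :
      AffRel k (e k (2 * i + 1) * e k (2 * i - 1) * τ k (2 * i))
        (e k (2 * i + 1) * e k (2 * i - 1) * τ k (2 * i + 1))
  -- Commutation relations
  | r4i (i j : ℕ) (hi : 1 ≤ i ∧ i < 2 * k) (hj : 1 ≤ j ∧ j < 2 * k)
      (h : i + 2 ≤ j ∨ j + 2 ≤ i) : AffRel k (e k i * e k j) (e k j * e k i)
  | r4ii (i j : ℕ) (hi : 2 ≤ i ∧ i ≤ k) (hj : 1 ≤ j ∧ j ≤ k) (h : j + 1 ≠ i ∧ j ≠ i) :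
      AffRel k (τ k (2 * i - 1) * e k (2 * j - 1)) (e k (2 * j - 1) * τ k (2 * i - 1))
  | r4iii (i j : ℕ) (hi : 2 ≤ i ∧ i ≤ k) (hj : 1 ≤ j ∧ j < k) (h : j ≠ i) :
      AffRel k (τ k (2 * i - 1) * e k (2 * j)) (e k (2 * j) * τ k (2 * i - 1))
  | r4iv (i j : ℕ) (hi : 1 ≤ i ∧ i < k) (hj : 1 ≤ j ∧ j ≤ k) (h : j ≠ i ∧ j ≠ i + 1) :
      AffRel k (τ k (2 * i) * e k (2 * j - 1)) (e k (2 * j - 1) * τ k (2 * i))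
  | r4v (i j : ℕ) (hi : 1 ≤ i ∧ i < k) (hj : 1 ≤ j ∧ j < k) (h : j + 1 ≠ i) :
      AffRel k (τ k (2 * i) * e k (2 * j)) (e k (2 * j) * τ k (2 * i))
  -- Contractions
  | r5i (i : ℕ) (hi : 1 ≤ i ∧ i + 1 < 2 * k) : AffRel k (e k i * e k (i + 1) * e k i) (e k i)
  | r5i' (i : ℕ) (hi : 1 ≤ i ∧ i + 1 < 2 * k) :
      AffRel k (e k (i + 1) * e k i * e k (i + 1)) (e k (i + 1))
  | r5ii (i : ℕ) (hi : 1 ≤ i ∧ i < k) :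
      AffRel k (τ k (2 * i) * e k (2 * i - 1) * τ k (2 * i))
        (τ k (2 * i + 1) * e k (2 * i + 1) * τ k (2 * i + 1))
  | r5iii (i : ℕ) (hi : 2 ≤ i ∧ i < k) :
      AffRel k (τ k (2 * i) * e k (2 * i - 2) * τ k (2 * i))
        (τ k (2 * i - 1) * e k (2 * i) * τ k (2 * i - 1))
  -- Affine commuting relations
  | r6i (i j : ℕ) (hi : 1 ≤ i ∧ i ≤ 2 * k) (hj : 1 ≤ j ∧ j ≤ 2 * k) :
      AffRel k (x k i * x k j) (x k j * x k i)
  | r6ii (i j : ℕ) (hi : 2 ≤ i ∧ i < 2 * k) (hj : 1 ≤ j ∧ j ≤ 2 * k)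
      (h : j + 1 ≠ i ∧ j ≠ i ∧ j ≠ i + 1) : AffRel k (τ k i * x k j) (x k j * τ k i)
  | r6iii (i j : ℕ) (hi : 1 ≤ i ∧ i < 2 * k) (hj : 1 ≤ j ∧ j ≤ 2 * k)
      (h : j ≠ i ∧ j ≠ i + 1) : AffRel k (e k i * x k j) (x k j * e k i)
  -- Braid-like relations
  | r7i (i : ℕ) (hi : 2 ≤ i ∧ i < k) :
      AffRel k (τ k (2 * i - 2) * τ k (2 * i) * τ k (2 * i - 2))
        (τ k (2 * i) * τ k (2 * i - 2) * τ k (2 * i) * (1 - e k (2 * i - 2)))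
  | r7ii (i : ℕ) (hi : 2 ≤ i ∧ i < k) :
      AffRel k (τ k (2 * i + 1) * τ k (2 * i - 1) * τ k (2 * i + 1))
        (τ k (2 * i - 1) * τ k (2 * i + 1) * τ k (2 * i - 1) * (1 - e k (2 * i)))
  | r7iii (i : ℕ) (hi : 2 ≤ i ∧ i < k) :
      AffRel k (τ k (2 * i - 1) * τ k (2 * i) * τ k (2 * i - 1))
        (τ k (2 * i) - e k (2 * i - 2) * τ k (2 * i) - τ k (2 * i) * e k (2 * i - 2))
  | r7iv (i : ℕ) (hi : 2 ≤ i ∧ i < k) :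
      AffRel k (τ k (2 * i) * τ k (2 * i - 1) * τ k (2 * i))
        (τ k (2 * i - 1) - e k (2 * i) * τ k (2 * i - 1) - τ k (2 * i - 1) * e k (2 * i))
  -- Skein-like relations
  | r8i (i : ℕ) (hi : 1 ≤ i ∧ i < k) :
      AffRel k (x k (2 * i + 1))
        (τ k (2 * i) * x k (2 * i - 1) * τ k (2 * i) + e k (2 * i) * e k (2 * i - 1) * τ k (2 * i)
          + τ k (2 * i) * e k (2 * i - 1) * e k (2 * i) - τ k (2 * i))
  | r8ii (i : ℕ) (hi : 1 ≤ i ∧ i < k) :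
      AffRel k (x k (2 * i + 2))
        (τ k (2 * i + 1) * x k (2 * i) * τ k (2 * i + 1)
          + e k (2 * i) * e k (2 * i + 1) * τ k (2 * i + 1) * e k (2 * i + 1) * e k (2 * i)
          + τ k (2 * i + 1))
  | r8iii (i : ℕ) (hi : 1 ≤ i ∧ i < k) :
      AffRel k (x k (2 * i))
        (τ k (2 * i) * x k (2 * i) * τ k (2 * i) + e k (2 * i) * e k (2 * i - 1) * τ k (2 * i)
          + τ k (2 * i) * e k (2 * i - 1) * e k (2 * i))
  | r8iv (i : ℕ) (hi : 1 ≤ i ∧ i < k) :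
      AffRel k (x k (2 * i + 1))
        (τ k (2 * i + 1) * x k (2 * i + 1) * τ k (2 * i + 1)
          + e k (2 * i) * e k (2 * i + 1) * τ k (2 * i + 1)
          + τ k (2 * i + 1) * e k (2 * i + 1) * e k (2 * i))
  -- Anti-symmetry relations
  | r9i (i : ℕ) (hi : 1 ≤ i ∧ i < 2 * k) : AffRel k (e k i * (x k i - x k (i + 1))) 0
  | r9ii (i : ℕ) (hi : 1 ≤ i ∧ i < 2 * k) : AffRel k ((x k i - x k (i + 1)) * e k i) 0
  -- Bubble relations
  | r10i (hk : 1 ≤ k) (l : ℕ) : AffRel k (e k 1 * x k 1 ^ l * e k 1) (z k l * e k 1)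
  | r10ii (l : ℕ) (g : AffGen k) :
      AffRel k (z k l * FreeAlgebra.ι ℂ g) (FreeAlgebra.ι ℂ g * z k l)

/-- The affine partition algebra `A_{2k}^aff`, by generators and relations. -/
abbrev AffinePartitionAlgebra (k : ℕ) : Type := RingQuot (AffRel k)

namespace AffinePartitionAlgebra

/-! The images of the generators; the indices in range are `2 ≤ i ≤ 2k - 1` for `τ`,
`1 ≤ j ≤ 2k - 1` for `e`, and `1 ≤ r ≤ 2k` for `x`. -/

def τ (k i : ℕ) : AffinePartitionAlgebra k := RingQuot.mkAlgHom ℂ (AffRel k) (Free.τ k i)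

def e (k j : ℕ) : AffinePartitionAlgebra k := RingQuot.mkAlgHom ℂ (AffRel k) (Free.e k j)

def x (k r : ℕ) : AffinePartitionAlgebra k := RingQuot.mkAlgHom ℂ (AffRel k) (Free.x k r)

def z (k l : ℕ) : AffinePartitionAlgebra k := RingQuot.mkAlgHom ℂ (AffRel k) (Free.z k l)

end AffinePartitionAlgebra

/-- The prescribed values of `ι` on the generators `z`, `s_i`, `e_j` of `A_{2k}`. -/
structure IsInclusion {k : ℕ} (f : PartitionAlgebra k →ₐ[ℂ] AffinePartitionAlgebra k) : Prop where
  map_z : f (PartitionAlgebra.z k) = AffinePartitionAlgebra.z k 0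
  map_s : ∀ i, 1 ≤ i → i < k →
    f (PartitionAlgebra.s k i) =
      AffinePartitionAlgebra.τ k (2 * i) * AffinePartitionAlgebra.τ k (2 * i + 1)
        + AffinePartitionAlgebra.e k (2 * i)
  map_e : ∀ j, 1 ≤ j → j < 2 * k →
    f (PartitionAlgebra.e k j) = AffinePartitionAlgebra.e k j

/-- The prescribed values of `pr` on the generators `τ_i`, `e_j`, `x_r`, `z_l` of
`A_{2k}^aff`. -/
structure IsProjection {k : ℕ} (f : AffinePartitionAlgebra k →ₐ[ℂ] PartitionAlgebra k) : Prop where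
  map_τ : ∀ i, 2 ≤ i → i < 2 * k → f (AffinePartitionAlgebra.τ k i) = PartitionAlgebra.t k i
  map_e : ∀ j, 1 ≤ j → j < 2 * k → f (AffinePartitionAlgebra.e k j) = PartitionAlgebra.e k j
  map_x : ∀ r, 1 ≤ r → r ≤ 2 * k → f (AffinePartitionAlgebra.x k r) = PartitionAlgebra.X k r
  map_z : ∀ l, f (AffinePartitionAlgebra.z k l) =
    PartitionAlgebra.z k * (PartitionAlgebra.z k - 1) ^ l

end AffinePartition

end

noncomputable section

namespace AffinePartition

set_option linter.unusedSimpArgs false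
set_option linter.unusedSectionVars false

/-! ### Operators on functions of tuples -/

-- The partition algebra acts on functions of sequences of letters from a finite alphabet: a diagram
-- sums over the bottom rows that, together with the given top row, are constant on its blocks, and
-- `z` acts by the number of letters (`diagramOp_mul`, `tupleRep`). No single alphabet acts
-- faithfully, but all finite alphabets together do (`eq_zero_of_tupleRep`), so identities in the
-- partition algebra may be checked on operators (`ext_tupleRep`).
--
-- On operators Enyang's recursion has a closed solution (`tupleRep_rec`). With coordinates counted
-- from 0, z - L_{2i+1} is the sum over letters b of the transpositions (a_i b) applied to the
-- coordinates before i, and L_{2i+2} is the same sum with coordinate i included. The elements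
-- t_{2i+2} and t_{2i+3} vanish where a_i = a_{i+1} and otherwise apply (a_i a_{i+1}) to the
-- coordinates before i, respectively to those up to i + 1. Each defining relation of the affine
-- algebra then becomes an identity about transpositions of letters, or the commutation of operators
-- on disjoint coordinates (`Lower`). This is `freeRep_rel`, and it yields `proj`.
--
-- For the inclusion, the elements τ_{2i} τ_{2i+1} + e_{2i}, e_j and z_0 of the affine algebra are
-- shown to satisfy a list of relations of the partition monoid (`generators`). Conjugating e_{2i-1}
-- into e_{2i+1} uses the generators x: the skein and anti-symmetry relations give e_{2i} e_{2i-1}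
-- τ_{2i} = e_{2i} e_{2i+1} τ_{2i+1} and its mirror image.
--
-- In any monoid with elements satisfying this list, every product of them is a power of z times a
-- normal form: links along a top relation, cuts, a permutation, links along a bottom relation
-- (`exists_eq_of_mem_span`). The normal form depends only on its diagram (`normal_eq_ofDiagram`):
-- the relations may be enlarged to the rows of the diagram (`normal_eq_framed`), a redundant strand
-- may be cut (`framed_cut`), and a strand may be moved inside its block (`framed_swap`).
--
-- Since `proj` sends the normal form of a diagram to that diagram (`proj_ofDiagram`), it is
-- injective on the submonoid generated by these elements. Its inverse there is multiplicative, and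
-- its linear extension is `incl`, a section of `proj`. Injectivity of one map and surjectivity of
-- the other follow.

/-- The endomorphisms of the space of functions of a sequence of letters from `Ω`. -/
abbrev TupleOp (Ω : Type) : Type := Module.End ℂ ((ℕ → Ω) → ℂ)

namespace TupleOp

variable {Ω : Type}

/-- Apply the permutation `g` of the letters to the coordinates `< m`. -/
def act (m : ℕ) (g : Equiv.Perm Ω) (a : ℕ → Ω) : ℕ → Ω := fun j => if j < m then g (a j) else a j

theorem act_of_lt {m j : ℕ} (h : j < m) (g : Equiv.Perm Ω) (a : ℕ → Ω) : act m g a j = g (a j) :=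
  if_pos h

theorem act_of_ge {m j : ℕ} (h : m ≤ j) (g : Equiv.Perm Ω) (a : ℕ → Ω) : act m g a j = a j :=
  if_neg (by omega)

theorem act_zero (g : Equiv.Perm Ω) (a : ℕ → Ω) : act 0 g a = a := rfl

/-- Interchange the coordinates `i` and `i + 1`. -/
def flip (i : ℕ) (a : ℕ → Ω) : ℕ → Ω := fun j => a (Equiv.swap i (i + 1) j)

theorem flip_left (i : ℕ) (a : ℕ → Ω) : flip i a i = a (i + 1) := by simp [flip]

theorem flip_right (i : ℕ) (a : ℕ → Ω) : flip i a (i + 1) = a i := by simp [flip]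

theorem flip_of_ne {i j : ℕ} (h : j ≠ i ∧ j ≠ i + 1) (a : ℕ → Ω) : flip i a j = a j := by
  simp [flip, Equiv.swap_apply_of_ne_of_ne h.1 h.2]

/-- The operator permuting the coordinates `i` and `i + 1`. -/
def S (i : ℕ) : TupleOp Ω := LinearMap.funLeft ℂ ℂ (flip i)

/-- The operator acting by a permutation of letters on the coordinates `< m`. -/
def A (m : ℕ) (g : Equiv.Perm Ω) : TupleOp Ω := LinearMap.funLeft ℂ ℂ (act m g)

/-- The operator setting the coordinate `l` to `c`. -/
def U (l : ℕ) (c : Ω) : TupleOp Ω := LinearMap.funLeft ℂ ℂ (fun a => Function.update a l c)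

theorem S_apply (i : ℕ) (f : (ℕ → Ω) → ℂ) (a : ℕ → Ω) : S i f a = f (flip i a) := rfl

theorem A_apply (m : ℕ) (g : Equiv.Perm Ω) (f : (ℕ → Ω) → ℂ) (a : ℕ → Ω) :
    A m g f a = f (act m g a) := rfl

theorem U_apply (l : ℕ) (c : Ω) (f : (ℕ → Ω) → ℂ) (a : ℕ → Ω) :
    U l c f a = f (Function.update a l c) := rfl

variable [DecidableEq Ω]

/-- The projection to the tuples whose coordinate `l` is `c`. -/
def D (l : ℕ) (c : Ω) : TupleOp Ω where
  toFun f a := if a l = c then f a else 0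
  map_add' f g := by funext a; simp only [Pi.add_apply]; split_ifs <;> simp
  map_smul' r f := by funext a; simp

/-- The projection to the tuples whose coordinates `i` and `i + 1` agree. -/
def Q (i : ℕ) : TupleOp Ω where
  toFun f a := if a i = a (i + 1) then f a else 0
  map_add' f g := by funext a; simp only [Pi.add_apply]; split_ifs <;> simp
  map_smul' r f := by funext a; simp

/-- If the coordinates `i` and `i + 1` differ, interchange these two letters in the
coordinates `< m`. -/
def V (m i : ℕ) : TupleOp Ω where
  toFun f a := if a i = a (i + 1) then 0 else f (act m (Equiv.swap (a i) (a (i + 1))) a)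
  map_add' f g := by funext a; simp only [Pi.add_apply]; split_ifs <;> simp
  map_smul' r f := by funext a; simp

/-- The operator of `t_{2i+2}`. -/
def T (i : ℕ) : TupleOp Ω := V i i

/-- The operator of `t_{2i+3}`. -/
def T' (i : ℕ) : TupleOp Ω := V (i + 2) i

theorem D_apply (l : ℕ) (c : Ω) (f : (ℕ → Ω) → ℂ) (a : ℕ → Ω) :
    D l c f a = if a l = c then f a else 0 := rfl

theorem Q_apply (i : ℕ) (f : (ℕ → Ω) → ℂ) (a : ℕ → Ω) :
    Q i f a = if a i = a (i + 1) then f a else 0 := rfl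

theorem T_apply (i : ℕ) (f : (ℕ → Ω) → ℂ) (a : ℕ → Ω) :
    T i f a = if a i = a (i + 1) then 0 else f (act i (Equiv.swap (a i) (a (i + 1))) a) := rfl

theorem T'_apply (i : ℕ) (f : (ℕ → Ω) → ℂ) (a : ℕ → Ω) :
    T' i f a = if a i = a (i + 1) then 0 else f (act (i + 2) (Equiv.swap (a i) (a (i + 1))) a) :=
  rfl

variable [Fintype Ω]

/-- The operator summing over the letters at the coordinate `i`. -/
def P (i : ℕ) : TupleOp Ω := ∑ b, U i b

/-- The sum over `b` of the transpositions `(a_i b)` applied to the coordinates `< m`. -/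
def J (m i : ℕ) : TupleOp Ω where
  toFun f a := ∑ b, f (act m (Equiv.swap (a i) b) a)
  map_add' f g := by funext a; simp [Finset.sum_add_distrib]
  map_smul' r f := by funext a; simp [Finset.mul_sum]

/-- The operator of `z - L_{2i+1}`. -/
def Y (i : ℕ) : TupleOp Ω := J i i

/-- The operator of `L_{2i+2}`. -/
def Y' (i : ℕ) : TupleOp Ω := J (i + 1) i

theorem P_apply (i : ℕ) (f : (ℕ → Ω) → ℂ) (a : ℕ → Ω) :
    P i f a = ∑ b, f (Function.update a i b) := by
  simp [P, U_apply]

theorem Y_apply (i : ℕ) (f : (ℕ → Ω) → ℂ) (a : ℕ → Ω) :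
    Y i f a = ∑ b, f (act i (Equiv.swap (a i) b) a) := rfl

theorem Y'_apply (i : ℕ) (f : (ℕ → Ω) → ℂ) (a : ℕ → Ω) :
    Y' i f a = ∑ b, f (act (i + 1) (Equiv.swap (a i) b) a) := rfl

end TupleOp

namespace TupleOp

variable {Ω : Type} [DecidableEq Ω]

/-! ### Relations without sums -/

/-- Coordinates i and i + 1 lie outside the range that is permuted, so the second factor uses the
same transposition and undoes the first. -/
theorem T_mul_T (i : ℕ) : (T i * T i : TupleOp Ω) = 1 - Q i := by
  ext f a
  simp (disch := omega) only [Module.End.mul_apply, T_apply, Q_apply, LinearMap.sub_apply,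
    Pi.sub_apply, Module.End.one_apply, act_of_ge]
  split_ifs
  · simp
  · simp; congr 1; funext j; grind [act]

/-- The letters at i and i + 1 are now interchanged too, but they determine the same transposition
in either order. -/
theorem T'_mul_T' (i : ℕ) : (T' i * T' i : TupleOp Ω) = 1 - Q i := by
  ext f a
  simp (disch := omega) only [Module.End.mul_apply, T'_apply, Q_apply, LinearMap.sub_apply,
    Pi.sub_apply, Module.End.one_apply, act_of_lt, Equiv.swap_apply_left, Equiv.swap_apply_right]
  split_ifs
  · simp
  · grind
  · simp; congr 1; funext j; grind [act]

theorem T_mul_T'_comm (i : ℕ) : (T i * T' i : TupleOp Ω) = T' i * T i := by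
  ext f a
  simp (disch := omega) only [Module.End.mul_apply, T_apply, T'_apply, act_of_ge,
    act_of_lt, Equiv.swap_apply_left, Equiv.swap_apply_right]
  split_ifs <;> try grind
  congr 1; funext j; grind [act]

/-- Off the diagonal the two transpositions cancel on the coordinates before i, and only the
exchange of coordinates i and i + 1 survives; `Q i` supplies the diagonal. -/
theorem T_mul_T'_add_Q (i : ℕ) : (T i * T' i + Q i : TupleOp Ω) = S i := by
  ext f a
  simp (disch := omega) only [Module.End.mul_apply, T_apply, T'_apply, act_of_ge, S_apply, Q_apply,
    act_of_lt, Equiv.swap_apply_left, Equiv.swap_apply_right, LinearMap.add_apply, Pi.add_apply]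
  split_ifs
  · simp; congr 1; funext j; grind [flip]
  · simp; congr 1; funext j; grind [act, flip]

theorem T'_succ_mul_T (i : ℕ) : (T' (i + 1) * T i : TupleOp Ω) = T i * T' (i + 1) := by
  ext f a
  simp (disch := omega) only [Module.End.mul_apply, T_apply, T'_apply, act_of_ge,
    act_of_lt, Equiv.swap_apply_left, Equiv.swap_apply_right]
  split_ifs <;> try grind
  congr 1; funext j; grind (splits := 30) [act]

theorem Q_mul_Q (i : ℕ) : (Q i * Q i : TupleOp Ω) = Q i := by
  ext f a
  simp only [Module.End.mul_apply, Q_apply]; split_ifs <;> rfl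

theorem Q_mul_Q_succ (i : ℕ) : (Q i * Q (i + 1) : TupleOp Ω) = Q (i + 1) * Q i := by
  ext f a
  simp only [Module.End.mul_apply, Q_apply]; split_ifs <;> rfl

theorem T_mul_Q (i : ℕ) : (T i * Q i : TupleOp Ω) = 0 := by
  ext f a
  simp (disch := omega) only [Module.End.mul_apply, T_apply, Q_apply, act_of_ge]
  split_ifs <;> rfl

theorem Q_mul_T (i : ℕ) : (Q i * T i : TupleOp Ω) = 0 := by
  ext f a
  simp (disch := omega) only [Module.End.mul_apply, T_apply, Q_apply, act_of_ge]
  split_ifs <;> rfl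

theorem T'_mul_Q (i : ℕ) : (T' i * Q i : TupleOp Ω) = 0 := by
  ext f a
  simp (disch := omega) only [Module.End.mul_apply, T'_apply, Q_apply, act_of_lt,
    Equiv.swap_apply_left, Equiv.swap_apply_right]
  split_ifs <;> first | rfl | grind

theorem Q_mul_T' (i : ℕ) : (Q i * T' i : TupleOp Ω) = 0 := by
  ext f a
  simp (disch := omega) only [Module.End.mul_apply, T'_apply, Q_apply]
  split_ifs <;> rfl

theorem T'_succ_mul_Q (i : ℕ) : (T' (i + 1) * Q i : TupleOp Ω) = Q i * T' (i + 1) := by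
  ext f a
  simp (disch := omega) only [Module.End.mul_apply, T'_apply, Q_apply, act_of_lt,
    Equiv.swap_apply_left, Equiv.swap_apply_right]
  split_ifs <;> first | rfl | grind

theorem T_mul_Q_succ (i : ℕ) : (T i * Q (i + 1) : TupleOp Ω) = Q (i + 1) * T i := by
  ext f a
  simp (disch := omega) only [Module.End.mul_apply, T_apply, Q_apply, act_of_ge]
  split_ifs <;> rfl

theorem S_mul_S (i : ℕ) : (S i * S i : TupleOp Ω) = 1 := by
  ext f a
  simp only [Module.End.mul_apply, S_apply, Module.End.one_apply]
  congr 1; funext j; grind [flip]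

theorem S_braid (i : ℕ) : (S i * S (i + 1) * S i : TupleOp Ω) = S (i + 1) * S i * S (i + 1) := by
  ext f a
  simp only [Module.End.mul_apply, S_apply]
  congr 1; funext j; grind [flip]

/-- Both sides are the projection onto the tuples with a_i = a_{i+2} ≠ a_{i+1}. -/
theorem T_mul_Q_mul_T (i : ℕ) :
    (T (i + 1) * Q i * T (i + 1) : TupleOp Ω) = T' i * Q (i + 1) * T' i := by
  ext f a
  simp (disch := omega) only [Module.End.mul_apply, T_apply, T'_apply, Q_apply, act_of_ge,
    act_of_lt, Equiv.swap_apply_left, Equiv.swap_apply_right]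
  split_ifs <;> try grind
  congr 1; funext j; grind [act]

/-- This is the braid relation for transpositions of three distinct letters. The left side vanishes
unless the letters are distinct; the last factor on the right removes the tuples with a_i = a_{i+1},
on which the remaining product need not vanish. -/
theorem T_braid (i : ℕ) :
    (T i * T (i + 1) * T i : TupleOp Ω) = T (i + 1) * T i * T (i + 1) * (1 - Q i) := by
  ext f a
  simp (disch := omega) only [Module.End.mul_apply, T_apply, Q_apply, LinearMap.sub_apply,
    Pi.sub_apply, Module.End.one_apply, act_of_ge, act_of_lt]
  split_ifs <;> try grind
  simp; congr 1; funext j; grind (splits := 40) [act]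

theorem T'_braid (i : ℕ) :
    (T' (i + 1) * T' i * T' (i + 1) : TupleOp Ω) = T' i * T' (i + 1) * T' i * (1 - Q (i + 1)) := by
  ext f a
  simp (disch := omega) only [Module.End.mul_apply, T'_apply, Q_apply, LinearMap.sub_apply,
    Pi.sub_apply, Module.End.one_apply, act_of_ge, act_of_lt, Equiv.swap_apply_left,
    Equiv.swap_apply_right]
  split_ifs <;> try grind
  simp; congr 1; funext j; grind (splits := 40) [act]

/-- Conjugating (a_i a_{i+2}) by (a_i a_{i+1}) gives (a_{i+1} a_{i+2}). The two subtracted terms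
restrict `T (i + 1)` to tuples with a_i different from both a_{i+1} and a_{i+2}. -/
theorem T'_mul_T_mul_T' (i : ℕ) :
    (T' i * T (i + 1) * T' i : TupleOp Ω) = T (i + 1) - Q i * T (i + 1) - T (i + 1) * Q i := by
  ext f a
  simp (disch := omega) only [Module.End.mul_apply, T_apply, T'_apply, Q_apply,
    LinearMap.sub_apply, Pi.sub_apply, act_of_ge, act_of_lt, Equiv.swap_apply_left,
    Equiv.swap_apply_right]
  split_ifs <;> try grind
  simp; congr 1; funext j; grind (splits := 40) [act]

theorem T_mul_T'_mul_T (i : ℕ) :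
    (T (i + 1) * T' i * T (i + 1) : TupleOp Ω)
      = T' i - Q (i + 1) * T' i - T' i * Q (i + 1) := by
  ext f a
  simp (disch := omega) only [Module.End.mul_apply, T_apply, T'_apply, Q_apply,
    LinearMap.sub_apply, Pi.sub_apply, act_of_ge, act_of_lt, Equiv.swap_apply_left,
    Equiv.swap_apply_right]
  split_ifs <;> try grind
  simp; congr 1; funext j
  rcases lt_trichotomy j i with h | rfl | h
  · simp (disch := omega) only [act_of_lt]; grind (splits := 40)
  · simp (disch := omega) only [act_of_lt, act_of_ge]; grind (splits := 40)
  · grind [act]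

/-! ### Relations involving `P` -/

variable [Fintype Ω]

theorem P_mul_P (i : ℕ) : (P i * P i : TupleOp Ω) = (Fintype.card Ω : ℂ) • P i := by
  ext f a
  simp [P_apply]

/-- `T i` and `T' i` differ only in coordinates i and i + 1, which are summed out afterwards. -/
theorem T_mul_P_mul_P (i : ℕ) :
    (T i * P i * P (i + 1) : TupleOp Ω) = T' i * P i * P (i + 1) := by
  ext f a
  simp only [Module.End.mul_apply, T_apply, T'_apply, P_apply]
  congr 1
  refine Finset.sum_congr rfl fun b _ => Finset.sum_congr rfl fun c _ => ?_
  congr 1; funext j; grind [act, Function.update_apply]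

theorem P_mul_P_mul_T (i : ℕ) :
    (P (i + 1) * P i * T i : TupleOp Ω) = P (i + 1) * P i * T' i := by
  ext f a
  simp (disch := omega) only [Module.End.mul_apply, T_apply, T'_apply, P_apply,
    Function.update_self, Function.update_of_ne]
  rw [Finset.sum_comm]
  refine Finset.sum_congr rfl fun b _ => Finset.sum_congr rfl fun c _ => ?_
  split_ifs <;> try grind
  congr 1; funext j; grind [act, Function.update_apply]

theorem P_mul_Q_mul_P (i : ℕ) : (P i * Q i * P i : TupleOp Ω) = P i := by
  ext f a
  simp [P_apply, Q_apply]

theorem P_succ_mul_Q_mul_P_succ (i : ℕ) :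
    (P (i + 1) * Q i * P (i + 1) : TupleOp Ω) = P (i + 1) := by
  ext f a
  simp [P_apply, Q_apply]

theorem Q_mul_P_mul_Q (i : ℕ) : (Q i * P i * Q i : TupleOp Ω) = Q i := by
  ext f a
  simp only [Module.End.mul_apply, P_apply, Q_apply]
  split_ifs with h
  · simp [← h]
  · rfl

theorem Q_mul_P_succ_mul_Q (i : ℕ) : (Q i * P (i + 1) * Q i : TupleOp Ω) = Q i := by
  ext f a
  simp only [Module.End.mul_apply, P_apply, Q_apply]
  split_ifs with h
  · simp [h]
  · rfl

/-- `T'` exchanges the two coordinates, so summing over coordinate i + 1 between two `T'` has the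
effect of summing over coordinate i between two `T`. -/
theorem T_mul_P_mul_T (i : ℕ) :
    (T i * P i * T i : TupleOp Ω) = T' i * P (i + 1) * T' i := by
  ext f a
  simp (disch := omega) only [Module.End.mul_apply, T_apply, T'_apply, P_apply, act_of_ge,
    act_of_lt, Equiv.swap_apply_left, Equiv.swap_apply_right]
  split_ifs
  · rfl
  refine Finset.sum_congr rfl fun b _ => ?_
  simp (disch := omega) [act_of_ge, act_of_lt]
  split_ifs <;> try grind
  congr 1; funext j; grind (splits := 30) [act, Function.update_apply]

end TupleOp

namespace TupleOp

variable {Ω : Type} [DecidableEq Ω] [Fintype Ω]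

/-! ### Relations involving `Y` and `Y'` -/

/-- In the double sum over the letter b placed at i and its partner c, coordinate i ends as b on one
side and as c on the other; exchanging the two summation letters matches them. -/
theorem P_mul_Y (i : ℕ) : (P i * Y i : TupleOp Ω) = P i * Y' i := by
  ext f a
  simp only [Module.End.mul_apply, P_apply, Y_apply, Y'_apply, Function.update_self]
  rw [Finset.sum_comm]
  refine Finset.sum_congr rfl fun b _ => Finset.sum_congr rfl fun c _ => ?_
  congr 1; funext j; grind [act, Function.update_apply]

theorem Y_mul_P (i : ℕ) : (Y i * P i : TupleOp Ω) = Y' i * P i := by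
  ext f a
  simp only [Module.End.mul_apply, P_apply, Y_apply, Y'_apply]
  refine Finset.sum_congr rfl fun b _ => Finset.sum_congr rfl fun c _ => ?_
  congr 1; funext j; grind [act, Function.update_apply]

theorem Q_mul_Y' (i : ℕ) : (Q i * Y' i : TupleOp Ω) = Q i * Y (i + 1) := by
  ext f a
  simp only [Module.End.mul_apply, Q_apply, Y_apply, Y'_apply]
  split_ifs with h
  · rw [h]
  · rfl

/-- The factor `Q i` requires that coordinates i and i + 1 agree after the transposition, which
leaves one letter of the sum on either side. -/
theorem Y'_mul_Q (i : ℕ) : (Y' i * Q i : TupleOp Ω) = Y (i + 1) * Q i := by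
  ext f a
  simp (disch := omega) [Q_apply, Y_apply, Y'_apply, act_of_lt, act_of_ge]
  rw [Finset.sum_eq_single (a i)]
  · simp; congr 1; funext j; grind [act]
  · intro b _ hb
    grind
  · simp

theorem Y_mul_Y' (i : ℕ) : (Y i * Y' i : TupleOp Ω) = Y' i * Y i := by
  ext f a
  simp (disch := omega) only [Module.End.mul_apply, Y_apply, Y'_apply, act_of_lt, act_of_ge,
    Equiv.swap_apply_left]
  rw [Finset.sum_comm]
  refine Finset.sum_congr rfl fun b _ => ?_
  -- Moving (a_i c) past (a_i b) conjugates it, which the relabelling of c by (a_i b) compensates.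
  rw [← Equiv.sum_comp (Equiv.swap (a i) b)]
  refine Finset.sum_congr rfl fun c _ => ?_
  congr 1; funext j; grind (splits := 30) [act]

theorem T_mul_Y'_succ (i : ℕ) : (T i * Y' (i + 1) : TupleOp Ω) = Y' (i + 1) * T i := by
  ext f a
  simp (disch := omega) only [Module.End.mul_apply, T_apply, Y'_apply, act_of_lt, act_of_ge,
    Equiv.swap_apply_left]
  by_cases h : a i = a (i + 1)
  · simp [h]
  · rw [if_neg h]
    refine Finset.sum_congr rfl fun c _ => ?_
    rw [if_neg (by grind)]
    congr 1; funext j; grind (splits := 30) [act]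

theorem T'_mul_Y (i : ℕ) : (T' i * Y i : TupleOp Ω) = Y i * T' i := by
  ext f a
  simp (disch := omega) only [Module.End.mul_apply, T'_apply, Y_apply, act_of_lt, act_of_ge,
    Equiv.swap_apply_left]
  by_cases h : a i = a (i + 1)
  · simp [h]
  · simp only [if_neg h]
    rw [← Equiv.sum_comp (Equiv.swap (a i) (a (i + 1)))]
    refine Finset.sum_congr rfl fun c _ => ?_
    congr 1; funext j; grind (splits := 30) [act]

theorem Q_mul_Y (i : ℕ) : (Q i * Y i : TupleOp Ω) = Y i * Q i := by
  ext f a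
  simp (disch := omega) only [Module.End.mul_apply, Q_apply, Y_apply, act_of_ge]
  split_ifs <;> simp

theorem Q_mul_Y'_succ (i : ℕ) : (Q i * Y' (i + 1) : TupleOp Ω) = Y' (i + 1) * Q i := by
  ext f a
  simp (disch := omega) only [Module.End.mul_apply, Q_apply, Y'_apply, act_of_lt,
    EmbeddingLike.apply_eq_iff_eq]
  split_ifs <;> simp

/-- The skein identities are compared letter by letter: all letters but one match, and the
exceptional letter accounts for the terms outside the two sums. -/
theorem sum_eq_sum_add {F G : Ω → ℂ} (c : Ω) {t : ℂ} (h : ∀ b, b ≠ c → F b = G b)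
    (ht : F c = G c + t) : ∑ b, F b = ∑ b, G b + t := by
  rw [← Finset.sum_erase_add _ F (Finset.mem_univ c), ← Finset.sum_erase_add _ G (Finset.mem_univ c),
    Finset.sum_congr rfl fun b hb => h b (Finset.ne_of_mem_erase hb), ht]
  ring

/-- Conjugating by `T i` turns transpositions with a_i into transpositions with a_{i+1}. The summand
`Q i` is absent from the skein relation for x: there x acts as `Y - 1`, and the shift by 1
contributes T² = 1 - Q. -/
theorem Y_succ (i : ℕ) : (Y (i + 1) : TupleOp Ω) =
    T i * Y i * T i + Q i + Q i * P i * T i + T i * P i * Q i - T i := by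
  ext f a
  simp (disch := omega) only [Module.End.mul_apply, Q_apply, Y_apply, Y'_apply, T_apply, T'_apply,
    P_apply, S_apply, act_of_ge, act_of_lt, LinearMap.add_apply, LinearMap.sub_apply, Pi.add_apply,
    Pi.sub_apply, Function.update_self, Function.update_of_ne, ne_eq, Nat.left_eq_add, one_ne_zero,
    Nat.succ_ne_self, not_false_eq_true, Equiv.swap_apply_left, Equiv.swap_apply_right]
  by_cases h : a i = a (i + 1)
  · simp only [h, if_true, zero_add, add_zero, sub_zero]
    rw [add_comm (f a)]
    refine sum_eq_sum_add (a (i + 1)) (fun c hc => ?_) ?_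
    · rw [if_neg hc]
      congr 1; funext j; grind (splits := 30) [act, Function.update_apply]
    · rw [if_pos rfl, zero_add, Equiv.swap_self]
      congr 1; funext j; grind [act]
  · simp only [h, if_false]
    rw [Finset.sum_ite_eq' , if_pos (Finset.mem_univ _), add_zero, add_zero, add_sub_assoc,
      ← Equiv.sum_comp (Equiv.swap (a i) (a (i + 1)))]
    refine sum_eq_sum_add (a (i + 1)) (fun c hc => ?_) ?_
    · congr 1; funext j
      rcases lt_trichotomy j i with hj | rfl | hj
      · simp (disch := omega) only [act_of_lt, Function.update_of_ne]; grind (splits := 40)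
      · simp (disch := omega) only [act_of_lt, act_of_ge, Function.update_self]
        grind (splits := 40)
      · grind (splits := 40) [act, Function.update_apply]
    -- For this letter the term of `T i * Y i * T i` applies one and the same transposition three
    -- times; it therefore equals the term of `T i` and cancels it.
    · have h1 : act i (Equiv.swap (a i) (a (i + 1))) (act i (Equiv.swap (a i) (a (i + 1)))
          (act i (Equiv.swap (a i) (a (i + 1))) a)) = act i (Equiv.swap (a i) (a (i + 1))) a := by
        funext j; grind [act]
      rw [h1, Equiv.swap_apply_right, add_sub_cancel]
      congr 1; funext j; grind [act, Function.update_apply]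

theorem Y'_eq (i : ℕ) : (Y' i : TupleOp Ω) =
    T i * Y' i * T i + Q i + Q i * P i * T i + T i * P i * Q i := by
  ext f a
  simp (disch := omega) only [Module.End.mul_apply, Q_apply, Y_apply, Y'_apply, T_apply, T'_apply,
    P_apply, S_apply, act_of_ge, act_of_lt, LinearMap.add_apply, LinearMap.sub_apply, Pi.add_apply,
    Pi.sub_apply, Function.update_self, Function.update_of_ne, ne_eq, Nat.left_eq_add, one_ne_zero,
    Nat.succ_ne_self, not_false_eq_true, Equiv.swap_apply_left, Equiv.swap_apply_right]
  by_cases h : a i = a (i + 1)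
  · simp only [h, if_true, zero_add, add_zero, sub_zero]
    rw [add_comm (f a)]
    refine sum_eq_sum_add (a (i + 1)) (fun c hc => ?_) ?_
    · rw [if_neg hc]
      congr 1; funext j; grind (splits := 30) [act, Function.update_apply]
    · rw [if_pos rfl, zero_add, Equiv.swap_self]
      congr 1; funext j; grind [act]
  · simp only [h, if_false]
    rw [Finset.sum_ite_eq' , if_pos (Finset.mem_univ _), add_zero, add_zero]
    refine sum_eq_sum_add (a (i + 1)) (fun c hc => ?_) ?_
    · rw [if_neg hc]
      congr 1; funext j
      rcases lt_trichotomy j i with hj | rfl | hj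
      · simp (disch := omega) only [act_of_lt, Function.update_of_ne]; grind (splits := 40)
      · simp (disch := omega) only [act_of_lt, act_of_ge, Function.update_self]
      · grind (splits := 40) [act, Function.update_apply]
    · rw [if_pos rfl, zero_add]
      congr 1; funext j; grind [act, Function.update_apply]

theorem Y_succ_eq (i : ℕ) : (Y (i + 1) : TupleOp Ω) =
    T' i * Y (i + 1) * T' i + Q i + Q i * P (i + 1) * T' i + T' i * P (i + 1) * Q i := by
  ext f a
  simp (disch := omega) only [Module.End.mul_apply, Q_apply, Y_apply, Y'_apply, T_apply, T'_apply,
    P_apply, S_apply, act_of_ge, act_of_lt, LinearMap.add_apply, LinearMap.sub_apply, Pi.add_apply,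
    Pi.sub_apply, Function.update_self, Function.update_of_ne, ne_eq, Nat.left_eq_add, one_ne_zero,
    Nat.succ_ne_self, not_false_eq_true, Equiv.swap_apply_left, Equiv.swap_apply_right]
  by_cases h : a i = a (i + 1)
  · simp only [h, if_true, zero_add, add_zero, sub_zero]
    rw [add_comm (f a)]
    refine sum_eq_sum_add (a (i + 1)) (fun c hc => ?_) ?_
    · rw [if_neg (Ne.symm hc)]
      congr 1; funext j; grind (splits := 30) [act, Function.update_apply]
    · rw [if_pos rfl, zero_add, Equiv.swap_self]
      congr 1; funext j; grind [act]
  · simp only [h, if_false]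
    rw [Finset.sum_ite_eq , if_pos (Finset.mem_univ _), add_zero, add_zero,
      ← Equiv.sum_comp (Equiv.swap (a i) (a (i + 1)))]
    refine sum_eq_sum_add (a (i + 1)) (fun c hc => ?_) ?_
    · rw [if_neg (by grind)]
      congr 1; funext j; grind (splits := 30) [act, Function.update_apply]
    · rw [if_pos (by simp), zero_add, Equiv.swap_apply_right]
      congr 1; funext j; grind [act, Function.update_apply]

theorem Y'_succ (i : ℕ) : (Y' (i + 1) : TupleOp Ω) =
    T' i * Y' i * T' i + Q i + Q i * P (i + 1) * T' i * P (i + 1) * Q i + T' i := by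
  ext f a
  simp (disch := omega) only [Module.End.mul_apply, Q_apply, Y_apply, Y'_apply, T_apply, T'_apply,
    P_apply, S_apply, act_of_ge, act_of_lt, LinearMap.add_apply, LinearMap.sub_apply, Pi.add_apply,
    Pi.sub_apply, Function.update_self, Function.update_of_ne, ne_eq, Nat.left_eq_add, one_ne_zero,
    Nat.succ_ne_self, not_false_eq_true, Equiv.swap_apply_left, Equiv.swap_apply_right]
  by_cases h : a i = a (i + 1)
  · simp only [h, if_true, zero_add, add_zero, sub_zero]
    rw [add_comm (f a)]
    refine sum_eq_sum_add (a (i + 1)) (fun c hc => ?_) ?_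
    · rw [if_neg (Ne.symm hc), Finset.sum_ite_eq, if_pos (Finset.mem_univ _)]
      congr 1; funext j; grind (splits := 30) [act, Function.update_apply]
    · rw [if_pos rfl, zero_add, Equiv.swap_self]
      congr 1; funext j; grind [act]
  · simp only [h, if_false]
    rw [add_zero, add_zero]
    -- Here the exceptional letter is a_i: its term on the left is exactly `T' i`, and the
    -- corresponding term of `T' i * Y' i * T' i` vanishes.
    refine sum_eq_sum_add (a i) (fun c hc => ?_) ?_
    · rw [if_neg hc]
      congr 1; funext j; grind (splits := 50) [act, Function.update_apply]
    · rw [if_pos rfl, zero_add, Equiv.swap_comm]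

end TupleOp

namespace TupleOp

variable {Ω : Type} [DecidableEq Ω] [Fintype Ω]

/-! ### Enyang's recursion -/

/-- In the recursion identities the evaluated tuples coincide in pairs, so signed identities of
values reduce to equalities of tuples. -/
theorem apply_eq_add_sub {X : Type} (f : X → ℂ) {u v w x : X} (h : u = w) (h' : v = x) :
    f u = f v + f w - f x := by
  rw [h, h']; ring

theorem apply_eq_add_add_sub_sub {X : Type} (f : X → ℂ) {u u₁ u₂ u₃ u₄ u₅ : X} (h₁ : u₁ = u)
    (h₂ : u₂ = u) (h₃ : u₃ = u) (h₄ : u₄ = u) (h₅ : u₅ = u) :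
    f u = f u₁ + f u₂ + f u₃ - f u₄ - f u₅ := by
  rw [h₁, h₂, h₃, h₄, h₅]; ring

/-- This is the recursion of `LOdd` rewritten for z - L, with σ replaced by `T i + Q i`; hence the
reversed signs. -/
theorem Y_succ_rec (i : ℕ) : (Y (i + 1) : TupleOp Ω) =
    S i * Y i * S i + Y' i * Q i + Q i * Y' i - Y i * Q i - T i - Q i := by
  ext f a
  simp (disch := omega) only [Module.End.mul_apply, Q_apply, Y_apply, Y'_apply, T_apply, T'_apply,
    P_apply, S_apply, act_of_ge, act_of_lt, LinearMap.add_apply, LinearMap.sub_apply, Pi.add_apply,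
    Pi.sub_apply, Function.update_self, Function.update_of_ne, ne_eq, Nat.left_eq_add, one_ne_zero,
    Nat.succ_ne_self, not_false_eq_true, Equiv.swap_apply_left, Equiv.swap_apply_right, flip_left,
    flip_right, flip_of_ne, Finset.sum_ite_eq, Finset.sum_ite_eq', Finset.mem_univ, if_true]
  by_cases h : a i = a (i + 1)
  · simp only [h, if_true, Equiv.swap_self, sub_zero]
    have h1 : act (i + 1) (Equiv.refl Ω) a = a := by funext j; grind [act]
    have h2 : ∀ b, flip i (act i (Equiv.swap (a (i + 1)) b) (flip i a))
        = act i (Equiv.swap (a (i + 1)) b) a := by intro b; funext j; grind [act, flip]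
    simp only [h1, h2]
    ring
  · simp only [h, if_false, Finset.sum_const_zero, sub_zero, add_zero]
    rw [add_sub_assoc]
    refine sum_eq_sum_add (a i) (fun c hc => ?_) ?_
    · congr 1; funext j; grind (splits := 40) [act, flip, Function.update_apply]
    · rw [add_sub_left_comm]
      rw [Equiv.swap_comm]
      refine (add_eq_left.2 (sub_eq_zero.2 ?_)).symm
      congr 1; funext j; grind (splits := 40) [act, flip, Function.update_apply]

theorem Y'_succ_rec (i : ℕ) : (Y' (i + 1) : TupleOp Ω) =
    S i * Y' i * S i - S i * Y' i * Q i - Q i * Y' i * S i + Q i * Y' i * P (i + 1) * Q i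
      + T' i + Q i := by
  ext f a
  simp (disch := omega) only [Module.End.mul_apply, Q_apply, Y_apply, Y'_apply, T_apply, T'_apply,
    P_apply, S_apply, act_of_ge, act_of_lt, LinearMap.add_apply, LinearMap.sub_apply, Pi.add_apply,
    Pi.sub_apply, Function.update_self, Function.update_of_ne, ne_eq, Nat.left_eq_add, one_ne_zero,
    Nat.succ_ne_self, not_false_eq_true, Equiv.swap_apply_left, Equiv.swap_apply_right, flip_left,
    flip_right, flip_of_ne, Finset.sum_ite_eq, Finset.sum_ite_eq', Finset.mem_univ, if_true]
  by_cases h : a i = a (i + 1)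
  · simp only [h, if_true, Equiv.swap_self, add_zero]
    have h1 : act (i + 1) (Equiv.refl Ω) (flip i a) = a := by funext j; grind [act, flip]
    have h2 : ∀ b, flip i (act (i + 1) (Equiv.swap (a (i + 1)) b) (flip i a))
        = flip i (act (i + 1) (Equiv.swap (a (i + 1)) b) a) := by
      intro b; funext j; grind [act, flip]
    have h3 : ∀ b, Function.update (act (i + 1) (Equiv.swap (a (i + 1)) b) a) (i + 1) b
        = act (i + 1 + 1) (Equiv.swap (a (i + 1)) b) a := by
      intro b; funext j; grind (splits := 40) [act, flip, Function.update_apply]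
    simp only [h1, h2, h3]
    ring
  · simp only [h, if_false, sub_zero, add_zero]
    rw [sub_add_eq_add_sub, add_sub_assoc]
    refine sum_eq_sum_add (a i) (fun c hc => ?_) ?_
    · congr 1; funext j; grind (splits := 40) [act, flip, Function.update_apply]
    · refine (apply_eq_add_sub f ?_ ?_).trans (add_sub_assoc _ _ _)
      · rw [Equiv.swap_comm]
      · funext j; grind (splits := 40) [act, flip, Function.update_apply]

/-- The sums hidden in `Y'` and `P` collapse, because a factor `Q` fixes the summation letter. What
remains depends only on which of three consecutive letters coincide: one, three or five terms
survive on the right. -/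
theorem T_succ_rec (i : ℕ) : (T (i + 1) + Q (i + 1) : TupleOp Ω) =
    S i * S (i + 1) * (T i + Q i) * S (i + 1) * S i
      + Q i * Y' i * S (i + 1) * Q i * S (i + 1)
      + S (i + 1) * Q i * Y' i * S (i + 1) * Q i
      - Q i * Y' i * S i * Q (i + 1) * P (i + 1) * Q i
      - S (i + 1) * Q i * P (i + 1) * Q (i + 1) * S i * Y' i * Q i * S (i + 1) := by
  ext f a
  simp (disch := omega) only [Module.End.mul_apply, Q_apply, Y_apply, Y'_apply, T_apply, T'_apply,
    P_apply, S_apply, act_of_ge, act_of_lt, LinearMap.add_apply, LinearMap.sub_apply, Pi.add_apply,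
    Pi.sub_apply, Function.update_self, Function.update_of_ne, ne_eq, Nat.left_eq_add, one_ne_zero,
    Nat.succ_ne_self, not_false_eq_true, Equiv.swap_apply_left, Equiv.swap_apply_right, flip_left,
    flip_right, flip_of_ne, Finset.sum_ite_eq, Finset.sum_ite_eq', Finset.mem_univ, if_true]
  by_cases h1 : a (i + 1) = a (i + 1 + 1)
  · by_cases h2 : a i = a (i + 1)
    · have h3 : a i = a (i + 1 + 1) := h2.trans h1
      simp only [h1, h2, if_true, zero_add, Equiv.swap_self]
      apply apply_eq_add_add_sub_sub <;> funext j <;>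
        grind (splits := 40) [act, flip, Function.update_apply]
    · have h3 : ¬a i = a (i + 1 + 1) := fun h => h2 (h.trans h1.symm)
      simp only [if_pos h1, if_neg h2, if_neg h3, zero_add, add_zero, sub_zero]
      congr 1; funext j; grind [flip]
  · by_cases h2 : a i = a (i + 1)
    · have h3 : ¬a i = a (i + 1 + 1) := fun h => h1 (h2.symm.trans h)
      simp only [if_neg h1, if_pos h2, if_neg h3, add_zero, sub_zero]
      apply apply_eq_add_sub <;> funext j <;>
        grind (splits := 40) [act, flip, Function.update_apply]
    · by_cases h3 : a i = a (i + 1 + 1)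
      · simp only [if_neg h1, if_neg h2, if_pos h3, add_zero, sub_zero]
        apply apply_eq_add_sub <;> funext j <;>
          grind (splits := 40) [act, flip, Function.update_apply]
      · simp only [if_neg h1, if_neg h2, if_neg h3, add_zero, sub_zero]
        congr 1; funext j; grind (splits := 40) [act, flip, Function.update_apply]

theorem T'_succ_rec (i : ℕ) : (T' (i + 1) + Q (i + 1) : TupleOp Ω) =
    S i * S (i + 1) * (T' i + Q i) * S (i + 1) * S i
      + S (i + 1) * Q i * Y' i * S (i + 1) * Q i * S (i + 1)
      + Q i * Y' i * S (i + 1) * Q i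
      - S (i + 1) * Q i * Y' i * S i * Q (i + 1) * P (i + 1) * Q i
      - Q i * P (i + 1) * Q (i + 1) * S i * Y' i * Q i * S (i + 1) := by
  ext f a
  simp (disch := omega) only [Module.End.mul_apply, Q_apply, Y_apply, Y'_apply, T_apply, T'_apply,
    P_apply, S_apply, act_of_ge, act_of_lt, LinearMap.add_apply, LinearMap.sub_apply, Pi.add_apply,
    Pi.sub_apply, Function.update_self, Function.update_of_ne, ne_eq, Nat.left_eq_add, one_ne_zero,
    Nat.succ_ne_self, not_false_eq_true, Equiv.swap_apply_left, Equiv.swap_apply_right, flip_left,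
    flip_right, flip_of_ne, Finset.sum_ite_eq, Finset.sum_ite_eq', Finset.mem_univ, if_true]
  by_cases h1 : a (i + 1) = a (i + 1 + 1)
  · by_cases h2 : a i = a (i + 1)
    · have h3 : a i = a (i + 1 + 1) := h2.trans h1
      simp only [h1, h2, if_true, zero_add, Equiv.swap_self]
      apply apply_eq_add_add_sub_sub <;> funext j <;>
        grind (splits := 40) [act, flip, Function.update_apply]
    · have h3 : ¬a i = a (i + 1 + 1) := fun h => h2 (h.trans h1.symm)
      simp only [if_pos h1, if_neg h2, if_neg h3, zero_add, add_zero, sub_zero]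
      congr 1; funext j; grind [flip]
  · by_cases h2 : a i = a (i + 1)
    · have h3 : ¬a i = a (i + 1 + 1) := fun h => h1 (h2.symm.trans h)
      simp only [if_neg h1, if_pos h2, if_neg h3, add_zero, sub_zero]
      apply apply_eq_add_sub <;> funext j <;>
        grind (splits := 40) [act, flip, Function.update_apply]
    · by_cases h3 : a i = a (i + 1 + 1)
      · simp only [if_neg h1, if_neg h2, if_pos h3, add_zero, sub_zero]
        apply apply_eq_add_sub <;> funext j <;>
          grind (splits := 40) [act, flip, Function.update_apply]
      · simp only [if_neg h1, if_neg h2, if_neg h3, add_zero, sub_zero]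
        congr 1; funext j; grind (splits := 40) [act, flip, Function.update_apply]

end TupleOp

namespace TupleOp

variable {Ω : Type} [DecidableEq Ω]

/-! ### Operators on disjoint coordinates commute -/

/-- The operator involves the coordinates `< m` only, equivariantly for the permutations of the
letters. -/
structure Lower (m : ℕ) (O : TupleOp Ω) : Prop where
  A : ∀ l, m ≤ l → ∀ g, Commute O (A l g)
  D : ∀ l, m ≤ l → ∀ c, Commute O (D l c)
  U : ∀ l, m ≤ l → ∀ c, Commute O (U l c)

theorem Lower.of_apply {m : ℕ} {O : TupleOp Ω}
    (hA : ∀ l, m ≤ l → ∀ g f a, O (TupleOp.A l g f) a = O f (act l g a))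
    (hD : ∀ l, m ≤ l → ∀ c f a, O (TupleOp.D l c f) a = if a l = c then O f a else 0)
    (hU : ∀ l, m ≤ l → ∀ c f a, O (TupleOp.U l c f) a = O f (Function.update a l c)) :
    Lower m O :=
  ⟨fun l hl g => LinearMap.ext fun f => funext fun a => hA l hl g f a,
    fun l hl c => LinearMap.ext fun f => funext fun a => hD l hl c f a,
    fun l hl c => LinearMap.ext fun f => funext fun a => hU l hl c f a⟩

/-- A permutation of letters conjugates the transposition of x and y into that of their images; this
is the source of equivariance for all operators defined by transpositions. -/
theorem act_act_swap {m l : ℕ} (h : m ≤ l) (g : Equiv.Perm Ω) (x y : Ω) (a : ℕ → Ω) :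
    act l g (act m (Equiv.swap x y) a) = act m (Equiv.swap (g x) (g y)) (act l g a) := by
  funext j
  rw [Equiv.swap_apply_apply]
  by_cases hm : j < m
  · rw [act_of_lt (by omega), act_of_lt hm, act_of_lt hm, act_of_lt (by omega)]
    simp
  · simp [act, hm]

theorem lower_Q (i : ℕ) : Lower (i + 2) (Q i : TupleOp Ω) := by
  refine Lower.of_apply (fun l hl g f a => ?_) (fun l hl c f a => ?_) (fun l hl c f a => ?_)
  · simp (disch := omega) only [Q_apply, A_apply, act_of_lt, EmbeddingLike.apply_eq_iff_eq]
  · simp only [Q_apply, D_apply]; split_ifs <;> rfl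
  · simp (disch := omega) only [Q_apply, U_apply, Function.update_of_ne]

theorem lower_T (i : ℕ) : Lower (i + 2) (T i : TupleOp Ω) := by
  refine Lower.of_apply (fun l hl g f a => ?_) (fun l hl c f a => ?_) (fun l hl c f a => ?_)
  · simp (disch := omega) only [T_apply, A_apply, act_of_lt, EmbeddingLike.apply_eq_iff_eq]
    split_ifs
    · rfl
    · rw [act_act_swap (by omega)]
  · simp (disch := omega) only [T_apply, D_apply, act_of_ge]; split_ifs <;> rfl
  · simp (disch := omega) only [T_apply, U_apply, Function.update_of_ne]
    split_ifs
    · rfl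
    · congr 1; funext j; grind [act, Function.update_apply]

theorem lower_T' (i : ℕ) : Lower (i + 2) (T' i : TupleOp Ω) := by
  refine Lower.of_apply (fun l hl g f a => ?_) (fun l hl c f a => ?_) (fun l hl c f a => ?_)
  · simp (disch := omega) only [T'_apply, A_apply, act_of_lt, EmbeddingLike.apply_eq_iff_eq]
    split_ifs
    · rfl
    · rw [act_act_swap (by omega)]
  · simp (disch := omega) only [T'_apply, D_apply, act_of_ge]; split_ifs <;> rfl
  · simp (disch := omega) only [T'_apply, U_apply, Function.update_of_ne]
    split_ifs
    · rfl
    · congr 1; funext j; grind [act, Function.update_apply]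

variable [Fintype Ω]

theorem lower_P (i : ℕ) : Lower (i + 1) (P i : TupleOp Ω) := by
  refine Lower.of_apply (fun l hl g f a => ?_) (fun l hl c f a => ?_) (fun l hl c f a => ?_)
  · simp only [P_apply, A_apply]
    rw [← Equiv.sum_comp g (fun b => f (Function.update (act l g a) i b))]
    refine Finset.sum_congr rfl fun b _ => ?_
    congr 1; funext j; grind [act, Function.update_apply]
  · simp (disch := omega) only [P_apply, D_apply, Function.update_of_ne]; split_ifs <;> simp
  · simp only [P_apply, U_apply]
    refine Finset.sum_congr rfl fun b _ => ?_
    rw [Function.update_comm (by omega)]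

theorem lower_Y (i : ℕ) : Lower (i + 1) (Y i : TupleOp Ω) := by
  refine Lower.of_apply (fun l hl g f a => ?_) (fun l hl c f a => ?_) (fun l hl c f a => ?_)
  · simp (disch := omega) only [Y_apply, A_apply, act_of_lt]
    rw [← Equiv.sum_comp g (fun b => f (act i (Equiv.swap (g (a i)) b) (act l g a)))]
    refine Finset.sum_congr rfl fun b _ => ?_
    rw [act_act_swap (by omega)]
  · simp (disch := omega) only [Y_apply, D_apply, act_of_ge]; split_ifs <;> simp
  · simp (disch := omega) only [Y_apply, U_apply, Function.update_of_ne]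
    refine Finset.sum_congr rfl fun b _ => ?_
    congr 1; funext j; grind [act, Function.update_apply]

theorem lower_Y' (i : ℕ) : Lower (i + 1) (Y' i : TupleOp Ω) := by
  refine Lower.of_apply (fun l hl g f a => ?_) (fun l hl c f a => ?_) (fun l hl c f a => ?_)
  · simp (disch := omega) only [Y'_apply, A_apply, act_of_lt]
    rw [← Equiv.sum_comp g (fun b => f (act (i + 1) (Equiv.swap (g (a i)) b) (act l g a)))]
    refine Finset.sum_congr rfl fun b _ => ?_
    rw [act_act_swap (by omega)]
  · simp (disch := omega) only [Y'_apply, D_apply, act_of_ge]; split_ifs <;> simp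
  · simp (disch := omega) only [Y'_apply, U_apply, Function.update_of_ne]
    refine Finset.sum_congr rfl fun b _ => ?_
    congr 1; funext j; grind [act, Function.update_apply]

/-- This and the expansions below write the operators at coordinate l through `D`, `U` and `A`, with
which every operator that is `Lower m`, m ≤ l, commutes. -/
theorem S_eq_sum (l : ℕ) :
    (S l : TupleOp Ω) = ∑ b, ∑ c, D l b * D (l + 1) c * U l c * U (l + 1) b := by
  ext f a
  simp [D_apply, U_apply, S_apply]
  congr 1; funext j; grind [flip, Function.update_apply]

theorem Q_eq_sum (l : ℕ) : (Q l : TupleOp Ω) = ∑ b, D l b * D (l + 1) b := by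
  ext f a
  simp [D_apply, Q_apply, eq_comm]

theorem T_eq_sum (l : ℕ) : (T l : TupleOp Ω) =
    ∑ b, ∑ c, if b = c then 0 else D l b * D (l + 1) c * A l (Equiv.swap b c) := by
  ext f a
  have h : ∀ b c, (if b = c then (0 : TupleOp Ω) else D l b * D (l + 1) c * A l (Equiv.swap b c)) f a
      = if a l = b then if a (l + 1) = c then if b = c then 0 else f (act l (Equiv.swap b c) a)
        else 0 else 0 := by
    intro b c
    by_cases hb : b = c
    · simp [hb]
    · simp only [if_neg hb, Module.End.mul_apply, D_apply, A_apply]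
  simp only [LinearMap.sum_apply, Finset.sum_apply, h]
  simp [T_apply]

/-- Multiply S = T T' + Q by T on the left. -/
theorem T'_eq_mul (l : ℕ) : (T' l : TupleOp Ω) = T l * S l := by
  rw [← T_mul_T'_add_Q, mul_add, T_mul_Q, ← mul_assoc, T_mul_T, sub_mul, Q_mul_T']
  simp

theorem Y_eq_sum (l : ℕ) : (Y l : TupleOp Ω) = ∑ b, ∑ c, D l b * A l (Equiv.swap b c) := by
  ext f a
  simp only [LinearMap.sum_apply, Finset.sum_apply, Module.End.mul_apply, D_apply, A_apply]
  rw [Finset.sum_comm]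
  simp [Y_apply]

theorem Y'_eq_sum (l : ℕ) :
    (Y' l : TupleOp Ω) = ∑ b, ∑ c, D l b * A l (Equiv.swap b c) * U l c := by
  ext f a
  simp only [LinearMap.sum_apply, Finset.sum_apply, Module.End.mul_apply, D_apply, A_apply, U_apply]
  rw [Finset.sum_comm]
  simp only [Finset.sum_ite_eq, Finset.mem_univ, if_true, Y'_apply]
  refine Finset.sum_congr rfl fun b _ => ?_
  congr 1; funext j; grind [act, Function.update_apply]

namespace Lower

variable {m l : ℕ} {O : TupleOp Ω}

theorem commute_S (h : Lower m O) (hl : m ≤ l) : Commute O (S l) := by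
  rw [S_eq_sum]
  exact Commute.sum_right _ _ _ fun b _ => Commute.sum_right _ _ _ fun c _ =>
    (((h.D _ hl _).mul_right (h.D _ (by omega) _)).mul_right (h.U _ hl _)).mul_right
      (h.U _ (by omega) _)

theorem commute_P (h : Lower m O) (hl : m ≤ l) : Commute O (P l) :=
  Commute.sum_right _ _ _ fun b _ => h.U _ hl _

theorem commute_Q (h : Lower m O) (hl : m ≤ l) : Commute O (Q l) := by
  rw [Q_eq_sum]
  exact Commute.sum_right _ _ _ fun b _ => (h.D _ hl _).mul_right (h.D _ (by omega) _)

theorem commute_T (h : Lower m O) (hl : m ≤ l) : Commute O (T l) := by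
  rw [T_eq_sum]
  refine Commute.sum_right _ _ _ fun b _ => Commute.sum_right _ _ _ fun c _ => ?_
  split_ifs
  · exact Commute.zero_right _
  · exact ((h.D _ hl _).mul_right (h.D _ (by omega) _)).mul_right (h.A _ hl _)

theorem commute_T' (h : Lower m O) (hl : m ≤ l) : Commute O (T' l) := by
  rw [T'_eq_mul]
  exact (h.commute_T hl).mul_right (h.commute_S hl)

theorem commute_Y (h : Lower m O) (hl : m ≤ l) : Commute O (Y l) := by
  rw [Y_eq_sum]
  exact Commute.sum_right _ _ _ fun b _ => Commute.sum_right _ _ _ fun c _ =>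
    (h.D _ hl _).mul_right (h.A _ hl _)

theorem commute_Y' (h : Lower m O) (hl : m ≤ l) : Commute O (Y' l) := by
  rw [Y'_eq_sum]
  exact Commute.sum_right _ _ _ fun b _ => Commute.sum_right _ _ _ fun c _ =>
    ((h.D _ hl _).mul_right (h.A _ hl _)).mul_right (h.U _ hl _)

end Lower

end TupleOp

/-! ### The partition algebra acts on functions of tuples -/

/-- The number of extensions of `u` along `f` to a function that is constant on the classes of
`r`. -/
theorem card_extensions {A Z Ω : Type} [Finite Z] (f : A → Z) (r : Setoid Z) (u : A → Ω)
    (h : Setoid.comap f r ≤ Setoid.ker u) :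
    Nat.card {v : Z → Ω // v ∘ f = u ∧ r ≤ Setoid.ker v} = Nat.card Ω ^ avoid f r := by
  classical
  have : Finite (Quotient r) := Quotient.finite r
  rw [avoid, ← Nat.card_fun]
  refine Nat.card_congr
    { toFun := fun v c => Quotient.lift v.1 (fun a b hab => v.2.2 hab) c.1
      invFun := fun g =>
        ⟨fun z => if hz : ∃ a, Quotient.mk r z = Quotient.mk r (f a) then u hz.choose
          else g ⟨Quotient.mk r z, fun a ha => hz ⟨a, ha⟩⟩, ?_, ?_⟩
      left_inv := ?_
      right_inv := ?_ }
  · funext a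
    have hz : ∃ b, Quotient.mk r (f a) = Quotient.mk r (f b) := ⟨a, rfl⟩
    simp only [Function.comp, dif_pos hz]
    exact h (show r (f hz.choose) (f a) from Quotient.exact hz.choose_spec.symm)
  · intro z w hzw
    have e : Quotient.mk r z = Quotient.mk r w := Quotient.sound hzw
    change dite _ _ _ = dite _ _ _
    simp only [e]
  · rintro ⟨v, hv, hr⟩
    refine Subtype.ext (funext fun z => ?_)
    by_cases hz : ∃ a, Quotient.mk r z = Quotient.mk r (f a)
    · simp only [dif_pos hz]
      rw [← hv]
      exact (hr (Quotient.exact hz.choose_spec)).symm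
    · simp only [dif_neg hz]
      rfl
  · intro g
    funext ⟨c, hc⟩
    induction c using Quotient.inductionOn with | _ z =>
    have hz : ¬∃ a, Quotient.mk r z = Quotient.mk r (f a) := fun ⟨a, ha⟩ => hc a ha
    change dite _ _ _ = _
    rw [dif_neg hz]

theorem no_extensions {A Z Ω : Type} (f : A → Z) (r : Setoid Z) (u : A → Ω)
    (h : ¬Setoid.comap f r ≤ Setoid.ker u) (v : Z → Ω) (hv : v ∘ f = u) : ¬r ≤ Setoid.ker v := by
  intro hr
  apply h
  intro a b hab
  rw [← hv]
  exact hr hab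

/-- Overwrite the first `k` coordinates. -/
def overwrite {Ω : Type} {k : ℕ} (b : Fin k → Ω) (a : ℕ → Ω) : ℕ → Ω :=
  fun j => if h : j < k then b ⟨j, h⟩ else a j

theorem overwrite_apply {Ω : Type} {k : ℕ} (b : Fin k → Ω) (a : ℕ → Ω) (i : Fin k) :
    overwrite b a i = b i := dif_pos i.2

theorem overwrite_overwrite {Ω : Type} {k : ℕ} (b c : Fin k → Ω) (a : ℕ → Ω) :
    overwrite c (overwrite b a) = overwrite c a := by
  funext j; simp only [overwrite]; split_ifs <;> rfl

theorem overwrite_self {Ω : Type} {k : ℕ} (a : ℕ → Ω) :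
    overwrite (fun i : Fin k => a i) a = a := by
  funext j; simp only [overwrite]; split_ifs <;> rfl

/-- The letters in the top row and the bottom row are constant on the blocks of `α`. -/
def Compatible {Ω : Type} {k : ℕ} (α : Diagram k) (a b : Fin k → Ω) : Prop :=
  α ≤ Setoid.ker (Sum.elim a b)

theorem stack_le_iff {Ω : Type} {k : ℕ} (α β : Diagram k) (v : Fin 3 × Fin k → Ω) :
    stack α β ≤ Setoid.ker v ↔ Compatible α (fun i => v (0, i)) (fun i => v (1, i)) ∧
      Compatible β (fun i => v (1, i)) (fun i => v (2, i)) := by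
  have h : ∀ (γ : Diagram k) (r s : Fin 3), Setoid.map γ (rowPair r s) ≤ Setoid.ker v ↔
      Compatible γ (fun i => v (r, i)) (fun i => v (s, i)) := by
    intro γ r s
    rw [map_le, Compatible]
    have : Setoid.comap (rowPair r s) (Setoid.ker v) =
        Setoid.ker (Sum.elim (fun i => v (r, i)) (fun i => v (s, i))) := by
      ext (x | x) (y | y) <;> rfl
    rw [this]
  rw [stack, sup_le_iff, h, h]

-- A compatible middle row is an extension of the two outer rows to the stacked picture that is
-- constant on components. Only the components inside the middle row can be labelled freely, which
-- gives the exponent.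
open Classical in
theorem card_middle {Ω : Type} [Fintype Ω] {k : ℕ} (α β : Diagram k) (a c : Fin k → Ω) :
    (Finset.univ.filter fun b : Fin k → Ω => Compatible α a b ∧ Compatible β b c).card
      = if Compatible (comp α β) a c then Fintype.card Ω ^ middle α β else 0 := by
  have hcard : (Finset.univ.filter fun b : Fin k → Ω => Compatible α a b ∧ Compatible β b c).card
      = Nat.card {v : Fin 3 × Fin k → Ω // v ∘ rowPair 0 2 = Sum.elim a c ∧
          stack α β ≤ Setoid.ker v} := by
    rw [← Fintype.card_subtype, ← Nat.card_eq_fintype_card]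
    refine Nat.card_congr
      { toFun := fun b => ⟨fun x => ![a x.2, b.1 x.2, c x.2] x.1, ?_, ?_⟩
        invFun := fun v => ⟨fun i => v.1 (1, i), ?_⟩
        left_inv := fun b => rfl
        right_inv := ?_ }
    · funext x; rcases x with x | x <;> rfl
    · exact (stack_le_iff _ _ _).2 b.2
    · obtain ⟨v, h, hv⟩ := v
      have ha : a = fun i => v (0, i) := funext fun i => (congrFun h (Sum.inl i)).symm
      have hc : c = fun i => v (2, i) := funext fun i => (congrFun h (Sum.inr i)).symm
      subst ha hc
      exact (stack_le_iff _ _ _).1 hv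
    · rintro ⟨v, h, hv⟩
      refine Subtype.ext (funext ?_)
      rintro ⟨r, i⟩
      fin_cases r
      · exact (congrFun h (Sum.inl i)).symm
      · rfl
      · exact (congrFun h (Sum.inr i)).symm
  rw [hcard]
  split_ifs with h
  · rw [card_extensions _ _ _ h, Nat.card_eq_fintype_card]; rfl
  · have : IsEmpty {v : Fin 3 × Fin k → Ω // v ∘ rowPair 0 2 = Sum.elim a c ∧
          stack α β ≤ Setoid.ker v} := ⟨fun v => no_extensions _ _ _ h v.1 v.2.1 v.2.2⟩
    exact Nat.card_of_isEmpty

open Classical in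
/-- The operator of a diagram: the sum over the bottom rows that are compatible with the given top
row. -/
def diagramOp (Ω : Type) [Fintype Ω] {k : ℕ} (α : Diagram k) : TupleOp Ω where
  toFun f a := ∑ b : Fin k → Ω, if Compatible α (fun i => a i) b then f (overwrite b a) else 0
  map_add' f g := by
    funext a
    simp only [Pi.add_apply, ← Finset.sum_add_distrib]
    exact Finset.sum_congr rfl fun b _ => by split_ifs <;> simp
  map_smul' r f := by
    funext a
    simp [Finset.mul_sum]

open Classical in
theorem diagramOp_apply {Ω : Type} [Fintype Ω] {k : ℕ} (α : Diagram k) (f : (ℕ → Ω) → ℂ)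
    (a : ℕ → Ω) : diagramOp Ω α f a =
      ∑ b : Fin k → Ω, if Compatible α (fun i => a i) b then f (overwrite b a) else 0 := rfl

/-- The coefficient of a bottom row on the left counts the middle rows compatible with both
diagrams, as evaluated by `card_middle`. -/
theorem diagramOp_mul {Ω : Type} [Fintype Ω] {k : ℕ} (α β : Diagram k) :
    diagramOp Ω α * diagramOp Ω β
      = (Fintype.card Ω : ℂ) ^ middle α β • diagramOp Ω (comp α β) := by
  classical
  ext f a
  simp only [Module.End.mul_apply, LinearMap.smul_apply, Pi.smul_apply, diagramOp_apply,
    overwrite_apply, overwrite_overwrite, smul_eq_mul, Finset.mul_sum]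
  have h : ∀ b : Fin k → Ω, (if Compatible α (fun i => a i) b then
        ∑ c, if Compatible β b c then f (overwrite c a) else 0 else 0) =
      ∑ c, if Compatible α (fun i => a i) b ∧ Compatible β b c then f (overwrite c a) else 0 := by
    intro b
    split_ifs with h <;> simp [h]
  simp only [h]
  rw [Finset.sum_comm]
  refine Finset.sum_congr rfl fun c _ => ?_
  rw [← Finset.sum_filter, Finset.sum_const, card_middle]
  split_ifs <;> simp

theorem diagramOp_apply_of_unique {Ω : Type} [Fintype Ω] {k : ℕ} {α : Diagram k} {a : ℕ → Ω}
    {b : Fin k → Ω} (h : ∀ c, Compatible α (fun i => a i) c ↔ c = b) (f : (ℕ → Ω) → ℂ) :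
    diagramOp Ω α f a = f (overwrite b a) := by
  classical
  simp [diagramOp_apply, h]

theorem compatible_ker_iff {Ω X : Type} {k : ℕ} (u v : Fin k → X) (a b : Fin k → Ω) :
    Compatible (Setoid.ker (Sum.elim u v)) a b ↔ (∀ i j, u i = u j → a i = a j) ∧
      (∀ i j, u i = v j → a i = b j) ∧ (∀ i j, v i = v j → b i = b j) := by
  constructor
  · intro h
    exact ⟨fun i j hij => @h (Sum.inl i) (Sum.inl j) hij,
      fun i j hij => @h (Sum.inl i) (Sum.inr j) hij, fun i j hij => @h (Sum.inr i) (Sum.inr j) hij⟩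
  · rintro ⟨h1, h2, h3⟩ (x | x) (y | y) hxy
    · exact h1 x y hxy
    · exact h2 x y hxy
    · exact (h2 y x hxy.symm).symm
    · exact h3 x y hxy

theorem diagramOp_id {Ω : Type} [Fintype Ω] (k : ℕ) : diagramOp Ω (idDiagram k) = 1 := by
  ext f a
  rw [diagramOp_apply_of_unique (b := fun i => a i), overwrite_self]
  · rfl
  · intro c
    rw [idDiagram, compatible_ker_iff]
    constructor
    · rintro ⟨-, h, -⟩
      exact funext fun i => (h i i rfl).symm
    · rintro rfl
      simp

/-- The representation of the partition algebra on functions of tuples of letters from `Ω`; `z`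
acts by the number of letters. -/
def tupleRep (Ω : Type) [Fintype Ω] (k : ℕ) : PartitionAlgebra k →ₐ[ℂ] TupleOp Ω :=
  MonoidAlgebra.lift ℂ (TupleOp Ω) (ScaledDiagram k)
    { toFun := fun x => (Fintype.card Ω : ℂ) ^ x.power • diagramOp Ω x.diagram
      map_one' := by
        change (Fintype.card Ω : ℂ) ^ 0 • diagramOp Ω (idDiagram k) = 1
        rw [diagramOp_id, pow_zero, one_smul]
      map_mul' := fun x y => by
        change (Fintype.card Ω : ℂ) ^ (x.power + y.power + middle x.diagram y.diagram) •
          diagramOp Ω (comp x.diagram y.diagram) = _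
        rw [smul_mul_smul_comm, diagramOp_mul, smul_smul, pow_add, pow_add] }

theorem tupleRep_of {Ω : Type} [Fintype Ω] {k : ℕ} (x : ScaledDiagram k) :
    tupleRep Ω k (MonoidAlgebra.of ℂ (ScaledDiagram k) x)
      = (Fintype.card Ω : ℂ) ^ x.power • diagramOp Ω x.diagram :=
  MonoidAlgebra.lift_of _ _

theorem tupleRep_ofDiagram {Ω : Type} [Fintype Ω] {k : ℕ} (α : Diagram k) :
    tupleRep Ω k (PartitionAlgebra.ofDiagram α) = diagramOp Ω α := by
  rw [PartitionAlgebra.ofDiagram, tupleRep_of]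
  exact (congrArg (· • _) (pow_zero _)).trans (one_smul _ _)

theorem tupleRep_z {Ω : Type} [Fintype Ω] (k : ℕ) :
    tupleRep Ω k (PartitionAlgebra.z k) = (Fintype.card Ω : ℂ) • 1 := by
  rw [PartitionAlgebra.z, tupleRep_of, diagramOp_id, pow_one]

/-- An element of the partition algebra that acts by `0` on the tuples over every alphabet is
`0`. -/
theorem eq_zero_of_tupleRep {k : ℕ} (x : PartitionAlgebra k)
    (h : ∀ n : ℕ, tupleRep (Fin n) k x = 0) : x = 0 := by
  classical
  by_contra hx
  have hne : x.coeff.support.Nonempty := by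
    rw [Finset.nonempty_iff_ne_empty]
    intro h0
    exact hx (MonoidAlgebra.coeff_injective (Finsupp.support_eq_empty.1 h0))
  obtain ⟨p, hp, hmin⟩ := Finset.exists_minimalFor ScaledDiagram.diagram _ hne
  -- `F` is the ℂ[z]-coefficient of the diagram of `p` in `x`. Its value at each large n will be a
  -- matrix entry of the action over n letters, hence 0.
  let F : Polynomial ℂ := ∑ q ∈ x.coeff.support,
    if q.diagram = p.diagram then Polynomial.monomial q.power (x.coeff q) else 0
  have hF : F.coeff p.power = x.coeff p := by
    simp only [F, Polynomial.finsetSum_coeff]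
    rw [Finset.sum_eq_single p]
    · simp
    · intro q _ hq
      split_ifs with hd
      · rw [Polynomial.coeff_monomial, if_neg]
        exact fun hpow => hq (ScaledDiagram.ext hpow hd)
      · simp
    · exact fun h => absurd hp h
  have hzero : F = 0 := by
    refine Polynomial.eq_zero_of_infinite_isRoot F ?_
    -- A diagram has at most 2k blocks; the extra 1 keeps the alphabet nonempty when k = 0.
    refine Set.Infinite.mono (s := (fun n : ℕ => (n : ℂ)) '' Set.Ici (2 * k + 1)) ?_
      ((Set.Ici_infinite _).image Nat.cast_injective.injOn)
    rintro _ ⟨n, hn, rfl⟩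
    have hcard : Fintype.card (Quotient p.diagram) ≤ Fintype.card (Fin n) := by
      refine (Fintype.card_quotient_le _).trans ?_
      simp only [Fintype.card_sum, Fintype.card_fin]
      have : 2 * k + 1 ≤ n := hn
      omega
    obtain ⟨ψ⟩ := Function.Embedding.nonempty_of_card_le hcard
    have : NeZero n := ⟨by have : 2 * k + 1 ≤ n := hn; omega⟩
    -- The letters separate the blocks of `p`, so the diagrams compatible with this pair of rows are
    -- those finer than or equal to that of `p`; in the support only that diagram itself remains.
    let c : Fin k ⊕ Fin k → Fin n := fun v => ψ (Quotient.mk _ v)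
    let a : ℕ → Fin n := overwrite (fun i => c (Sum.inl i)) fun _ => 0
    let b : Fin k → Fin n := fun i => c (Sum.inr i)
    have ha : (fun i : Fin k => a i) = fun i => c (Sum.inl i) :=
      funext fun i => overwrite_apply _ _ i
    have hc : ∀ q ∈ x.coeff.support, Compatible q.diagram (fun i => a i) b ↔
        q.diagram = p.diagram := by
      intro q hq
      have e : Setoid.ker (Sum.elim (fun i : Fin k => a i) b) = p.diagram := by
        rw [ha]
        ext v w
        have hs : Sum.elim (fun i => c (Sum.inl i)) b = c := by
          funext v; rcases v with v | v <;> rfl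
        rw [hs]
        exact ⟨fun h => Quotient.exact (ψ.injective h), fun h => congrArg ψ (Quotient.sound h)⟩
      rw [Compatible, e]
      exact ⟨fun hle => le_antisymm hle (hmin hq hle), fun he => he.le⟩
    -- Testing on the indicator function of one tuple extracts a single matrix entry.
    have key := congrFun (LinearMap.congr_fun (h n)
      (fun a' => if a' = overwrite b a then 1 else 0)) a
    rw [tupleRep, MonoidAlgebra.lift_apply, Finsupp.sum, LinearMap.sum_apply,
      Finset.sum_apply] at key
    rw [Set.mem_ofPred_eq, Polynomial.IsRoot, Polynomial.eval_finsetSum]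
    refine Eq.trans (Finset.sum_congr rfl fun q hq => ?_) key
    have hb : ∀ b' : Fin k → Fin n, overwrite b' a = overwrite b a ↔ b' = b := by
      intro b'
      refine ⟨fun h => funext fun i => ?_, fun h => h ▸ rfl⟩
      rw [← overwrite_apply b' a, h, overwrite_apply]
    have hd : diagramOp (Fin n) q.diagram (fun a' => if a' = overwrite b a then 1 else 0) a
        = if q.diagram = p.diagram then 1 else 0 := by
      rw [diagramOp_apply, Finset.sum_eq_single b]
      · simp only [hc q hq, if_true]
      · intro b' _ hb'
        simp [hb, hb']
      · simp
    change _ = x.coeff q * ((Fintype.card (Fin n) : ℂ) ^ q.power * _)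
    rw [hd]
    split_ifs <;> simp
  rw [hzero, Polynomial.coeff_zero] at hF
  exact (Finsupp.mem_support_iff.1 hp) hF.symm

theorem ext_tupleRep {k : ℕ} {x y : PartitionAlgebra k}
    (h : ∀ n : ℕ, tupleRep (Fin n) k x = tupleRep (Fin n) k y) : x = y :=
  sub_eq_zero.1 (eq_zero_of_tupleRep _ fun n => by rw [map_sub, h, sub_self])

/-! ### The operators of the generators -/

section Generators

open PartitionAlgebra

variable {Ω : Type} [Fintype Ω] [DecidableEq Ω] {k : ℕ}

theorem e_even (k i : ℕ) : e k (2 * i + 2) = eEven k (i + 1) := by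
  rw [e, if_pos (by grind)]
  congr 1; omega

theorem e_odd (k i : ℕ) : e k (2 * i + 1) = eOdd k (i + 1) := by
  rw [e, if_neg (by grind)]
  congr 1; omega

theorem tupleRep_s {i : ℕ} (hi : i + 1 < k) : tupleRep Ω k (s k (i + 1)) = TupleOp.S i := by
  rw [s, tupleRep_ofDiagram]
  ext f a
  rw [diagramOp_apply_of_unique (b := fun j => TupleOp.flip i a j), TupleOp.S_apply]
  · congr 1
    funext j
    simp only [overwrite]
    split_ifs with h
    · rfl
    · exact (TupleOp.flip_of_ne (by omega) a).symm
  · have hsw : ∀ j : ℕ, Equiv.swap (i + 1) (i + 1 + 1) (j + 1) = Equiv.swap i (i + 1) j + 1 := by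
      intro j
      simp only [Equiv.swap_apply_def]
      split_ifs <;> omega
    intro c
    rw [compatible_ker_iff]
    simp only [hsw]
    constructor
    · rintro ⟨-, h, -⟩
      funext j
      have hj : Equiv.swap i (i + 1) j < k := by
        rw [Equiv.swap_apply_def]; split_ifs <;> omega
      exact (h ⟨_, hj⟩ j rfl).symm
    · rintro rfl
      refine ⟨fun j l h => ?_, fun j l h => ?_, fun j l h => ?_⟩
      · exact congrArg a (Nat.succ_injective h)
      · exact congrArg a (Nat.succ_injective h)
      · exact congrArg a (Nat.succ_injective h)

theorem tupleRep_e_even {i : ℕ} (hi : i + 1 < k) :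
    tupleRep Ω k (e k (2 * i + 2)) = TupleOp.Q i := by
  classical
  rw [e_even, eEven, tupleRep_ofDiagram]
  ext f a
  rw [TupleOp.Q_apply]
  split_ifs with h
  · rw [diagramOp_apply_of_unique (b := fun j => a j), overwrite_self]
    intro c
    rw [compatible_ker_iff]
    constructor
    · rintro ⟨-, h, -⟩
      exact funext fun j => (h j j rfl).symm
    · rintro rfl
      simp only [and_self]
      intro x y hxy
      by_cases hx : (x : ℕ) = i + 1 <;> by_cases hy : (y : ℕ) = i + 1
      · rw [hx, hy]
      · simp only [hx, if_true, add_left_inj, hy, if_false] at hxy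
        rw [hx, ← hxy, h]
      · simp only [hx, if_true, add_left_inj, hy, if_false] at hxy
        rw [hy, hxy, h]
      · simp only [add_left_inj, hx, hy, if_false] at hxy
        rw [hxy]
  · rw [diagramOp_apply]
    refine Finset.sum_eq_zero fun c _ => if_neg fun hc => h ?_
    rw [compatible_ker_iff] at hc
    exact hc.1 ⟨i, by omega⟩ ⟨i + 1, hi⟩ (by simp)

theorem tupleRep_e_odd {i : ℕ} (hi : i < k) :
    tupleRep Ω k (e k (2 * i + 1)) = TupleOp.P i := by
  classical
  rw [e_odd, eOdd, tupleRep_ofDiagram]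
  ext f a
  rw [TupleOp.P_apply, diagramOp_apply, ← Finset.sum_filter]
  symm
  refine Finset.sum_nbij' (fun b => Function.update (fun j : Fin k => a j) ⟨i, hi⟩ b)
    (fun c => c ⟨i, hi⟩) ?_ ?_ ?_ ?_ ?_
  · intro b _
    rw [Finset.mem_filter, compatible_ker_iff]
    refine ⟨Finset.mem_univ _, fun x y h => ?_, fun x y h => ?_, fun x y h => ?_⟩
    · exact congrArg a (Nat.succ_injective h)
    · by_cases hy : (y : ℕ) = i
      · simp [hy] at h
      · simp only [add_left_inj, hy, if_false] at h
        rw [Function.update_of_ne (fun he => hy (congrArg Fin.val he)), h]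
    · by_cases hx : (x : ℕ) = i <;> by_cases hy : (y : ℕ) = i
      · rw [Fin.ext (hx.trans hy.symm)]
      · simp [hx, hy] at h
      · simp [hx, hy] at h
      · simp only [add_left_inj, hx, hy, if_false] at h
        rw [Fin.ext h]
  · intro _ _; exact Finset.mem_univ _
  · intro b _; simp
  · intro c hc
    rw [Finset.mem_filter, compatible_ker_iff] at hc
    funext j
    by_cases hj : j = ⟨i, hi⟩
    · subst hj; simp
    · have hj' : (j : ℕ) ≠ i := fun h => hj (Fin.ext h)
      rw [Function.update_of_ne hj]
      exact hc.2.2.1 j j (by simp [hj'])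
  · intro b _
    congr 1
    funext j
    simp only [overwrite, Function.update_apply, Fin.ext_iff]
    split_ifs <;> first | rfl | omega

/-- The operators of the elements of Enyang's recursion. -/
theorem tupleRep_rec (i : ℕ) :
    (i < k → tupleRep Ω k (LOdd k i) = (Fintype.card Ω : ℂ) • 1 - TupleOp.Y i ∧
      tupleRep Ω k (LEven k i) = TupleOp.Y' i) ∧
    (i + 1 < k → tupleRep Ω k (σEven k i) = TupleOp.T i + TupleOp.Q i ∧
      tupleRep Ω k (σOdd k i) = TupleOp.T' i + TupleOp.Q i) := by
  induction i with
  | zero =>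
    refine ⟨fun hk => ⟨?_, ?_⟩, fun hk => ⟨?_, ?_⟩⟩
    · rw [LOdd, map_zero]
      ext f a
      simp [TupleOp.Y_apply, TupleOp.act_zero]
    · rw [LEven]
      refine (tupleRep_e_odd (i := 0) hk).trans ?_
      ext f a
      simp only [TupleOp.P_apply, TupleOp.Y'_apply]
      refine Finset.sum_congr rfl fun b _ => ?_
      congr 1; funext j; grind [TupleOp.act, Function.update_apply]
    · rw [σEven, map_one]
      ext f a
      simp only [LinearMap.add_apply, Pi.add_apply, TupleOp.T_apply, TupleOp.Q_apply,
        TupleOp.act_zero]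
      split_ifs <;> simp
    · rw [σOdd, tupleRep_s hk]
      ext f a
      simp only [LinearMap.add_apply, Pi.add_apply, TupleOp.T'_apply, TupleOp.Q_apply,
        TupleOp.S_apply]
      split_ifs with h
      · rw [zero_add]; congr 1; funext j; grind [TupleOp.flip]
      · rw [add_zero]; congr 1; funext j; grind [TupleOp.flip, TupleOp.act]
  | succ i ih =>
    refine ⟨fun hk => ?_, fun hk => ?_⟩
    · obtain ⟨h1, h2⟩ := ih.1 (by omega)
      obtain ⟨h3, h4⟩ := ih.2 hk
      constructor
      · rw [LOdd]
        simp only [map_add, map_sub, map_mul, h1, h2, h3, tupleRep_s hk, tupleRep_e_even hk,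
          tupleRep_z, TupleOp.Y_succ_rec, mul_sub, sub_mul, mul_smul_comm, smul_mul_assoc, mul_one,
          one_mul, TupleOp.S_mul_S]
        abel
      · rw [LEven]
        simp only [map_add, map_sub, map_mul, h2, h4, tupleRep_s hk, tupleRep_e_even hk,
          tupleRep_e_odd (i := i + 1) hk, TupleOp.Y'_succ_rec,
          show 2 * i + 3 = 2 * (i + 1) + 1 from rfl]
        abel
    · have hi : i + 1 < k := by omega
      obtain ⟨h1, h2⟩ := ih.1 (by omega)
      obtain ⟨h3, h4⟩ := ih.2 hi
      constructor
      · rw [σEven, TupleOp.T_succ_rec]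
        simp only [map_add, map_sub, map_mul, h2, h3, tupleRep_s (i := i) hi,
          tupleRep_s (i := i + 1) hk, tupleRep_e_even (i := i) hi,
          tupleRep_e_even (i := i + 1) hk, tupleRep_e_odd (i := i + 1) hi,
          show 2 * i + 3 = 2 * (i + 1) + 1 from rfl, show 2 * i + 4 = 2 * (i + 1) + 2 from rfl]
      · rw [σOdd, TupleOp.T'_succ_rec]
        simp only [map_add, map_sub, map_mul, h2, h4, tupleRep_s (i := i) hi,
          tupleRep_s (i := i + 1) hk, tupleRep_e_even (i := i) hi,
          tupleRep_e_even (i := i + 1) hk, tupleRep_e_odd (i := i + 1) hi,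
          show 2 * i + 3 = 2 * (i + 1) + 1 from rfl, show 2 * i + 4 = 2 * (i + 1) + 2 from rfl]

end Generators

/-! ### The projection -/

section Projection

variable {Ω : Type} [Fintype Ω] [DecidableEq Ω] {k : ℕ}

theorem tupleRep_t_even {i : ℕ} (hi : i + 1 < k) :
    tupleRep Ω k (PartitionAlgebra.t k (2 * i + 2)) = TupleOp.T i := by
  have h : (2 * i + 2) / 2 - 1 = i := by omega
  rw [PartitionAlgebra.t, if_pos (by grind), h, map_sub, ((tupleRep_rec i).2 hi).1,
    tupleRep_e_even hi, add_sub_cancel_right]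

theorem tupleRep_t_odd {i : ℕ} (hi : i + 1 < k) :
    tupleRep Ω k (PartitionAlgebra.t k (2 * i + 3)) = TupleOp.T' i := by
  have h : (2 * i + 3) / 2 - 1 = i := by omega
  rw [PartitionAlgebra.t, if_neg (by grind), h, map_sub, ((tupleRep_rec i).2 hi).2,
    show 2 * i + 3 - 1 = 2 * i + 2 from rfl, tupleRep_e_even hi, add_sub_cancel_right]

theorem tupleRep_X_even {i : ℕ} (hi : i < k) :
    tupleRep Ω k (PartitionAlgebra.X k (2 * i + 2)) = TupleOp.Y' i - 1 := by
  have h : (2 * i + 2) / 2 - 1 = i := by omega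
  rw [PartitionAlgebra.X, if_pos (by grind), h, map_sub, ((tupleRep_rec i).1 hi).2, map_one]

theorem tupleRep_X_odd {i : ℕ} (hi : i < k) :
    tupleRep Ω k (PartitionAlgebra.X k (2 * i + 1)) = TupleOp.Y i - 1 := by
  have h : (2 * i + 1) / 2 = i := by omega
  rw [PartitionAlgebra.X, if_neg (by grind), h, map_sub, ((tupleRep_rec i).1 hi).1, map_sub,
    map_one, tupleRep_z]
  abel

/-- The prescribed images of the generators. -/
def genImage (k : ℕ) : AffGen k → PartitionAlgebra k
  | .tau i _ => PartitionAlgebra.t k i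
  | .e j _ => PartitionAlgebra.e k j
  | .x r _ => PartitionAlgebra.X k r
  | .z l => PartitionAlgebra.z k * (PartitionAlgebra.z k - 1) ^ l

variable (Ω k) in
/-- The action of the free algebra on functions of tuples. -/
def freeRep : FreeAlgebra ℂ (AffGen k) →ₐ[ℂ] TupleOp Ω :=
  (tupleRep Ω k).comp (FreeAlgebra.lift ℂ (genImage k))

theorem freeRep_ι (g : AffGen k) :
    freeRep Ω k (FreeAlgebra.ι ℂ g) = tupleRep Ω k (genImage k g) := by
  rw [freeRep, AlgHom.comp_apply, FreeAlgebra.lift_ι_apply]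

theorem freeRep_τ_even {i j : ℕ} (hj : j = 2 * i + 2) (hi : i + 1 < k) :
    freeRep Ω k (Free.τ k j) = TupleOp.T i := by
  subst hj
  rw [Free.τ, dif_pos (by omega), freeRep_ι, genImage, tupleRep_t_even hi]

theorem freeRep_τ_odd {i j : ℕ} (hj : j = 2 * i + 3) (hi : i + 1 < k) :
    freeRep Ω k (Free.τ k j) = TupleOp.T' i := by
  subst hj
  rw [Free.τ, dif_pos (by omega), freeRep_ι, genImage, tupleRep_t_odd hi]

theorem freeRep_e_even {i j : ℕ} (hj : j = 2 * i + 2) (hi : i + 1 < k) :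
    freeRep Ω k (Free.e k j) = TupleOp.Q i := by
  subst hj
  rw [Free.e, dif_pos (by omega), freeRep_ι, genImage, tupleRep_e_even hi]

theorem freeRep_e_odd {i j : ℕ} (hj : j = 2 * i + 1) (hi : i < k) :
    freeRep Ω k (Free.e k j) = TupleOp.P i := by
  subst hj
  rw [Free.e, dif_pos (by omega), freeRep_ι, genImage, tupleRep_e_odd hi]

theorem freeRep_x_even {i j : ℕ} (hj : j = 2 * i + 2) (hi : i < k) :
    freeRep Ω k (Free.x k j) = TupleOp.Y' i - 1 := by
  subst hj
  rw [Free.x, dif_pos (by omega), freeRep_ι, genImage, tupleRep_X_even hi]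

theorem freeRep_x_odd {i j : ℕ} (hj : j = 2 * i + 1) (hi : i < k) :
    freeRep Ω k (Free.x k j) = TupleOp.Y i - 1 := by
  subst hj
  rw [Free.x, dif_pos (by omega), freeRep_ι, genImage, tupleRep_X_odd hi]

theorem freeRep_z (l : ℕ) : freeRep Ω k (Free.z k l)
    = ((Fintype.card Ω : ℂ) * ((Fintype.card Ω : ℂ) - 1) ^ l) • 1 := by
  rw [Free.z, freeRep_ι, genImage, map_mul, map_pow, map_sub, tupleRep_z, map_one]
  have h : (Fintype.card Ω : ℂ) • (1 : TupleOp Ω) - 1 = ((Fintype.card Ω : ℂ) - 1) • 1 := by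
    ext f a
    simp [sub_mul]
  rw [h, smul_pow, one_pow, smul_mul_smul_comm, mul_one]

variable (Ω) in
theorem freeRep_s {i : ℕ} (hi : i + 1 < k) : freeRep Ω k (Free.s k (i + 1)) = TupleOp.S i := by
  rw [Free.s, map_add, map_mul, freeRep_τ_even (i := i) (by omega) hi,
    freeRep_τ_odd (i := i) (by omega) hi, freeRep_e_even (i := i) (by omega) hi,
    TupleOp.T_mul_T'_add_Q]

theorem T'_commute_T {i j : ℕ} (h : j ≠ i + 1) :
    Commute (TupleOp.T' i) (TupleOp.T j : TupleOp Ω) := by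
  by_cases h1 : i + 2 ≤ j
  · exact (TupleOp.lower_T' i).commute_T h1
  by_cases h2 : j + 2 ≤ i
  · exact ((TupleOp.lower_T j).commute_T' h2).symm
  obtain rfl | rfl : j = i ∨ i = j + 1 := by omega
  · exact (TupleOp.T_mul_T'_comm j).symm
  · exact TupleOp.T'_succ_mul_T j

theorem T'_commute_Q {i j : ℕ} (h : j ≠ i + 1) :
    Commute (TupleOp.T' i) (TupleOp.Q j : TupleOp Ω) := by
  by_cases h1 : i + 2 ≤ j
  · exact (TupleOp.lower_T' i).commute_Q h1
  by_cases h2 : j + 2 ≤ i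
  · exact ((TupleOp.lower_Q j).commute_T' h2).symm
  obtain rfl | rfl : j = i ∨ i = j + 1 := by omega
  · exact (TupleOp.T'_mul_Q j).trans (TupleOp.Q_mul_T' j).symm
  · exact TupleOp.T'_succ_mul_Q j

theorem T_commute_Q {i j : ℕ} (h : i ≠ j + 1) :
    Commute (TupleOp.T i) (TupleOp.Q j : TupleOp Ω) := by
  by_cases h1 : i + 2 ≤ j
  · exact (TupleOp.lower_T i).commute_Q h1
  by_cases h2 : j + 2 ≤ i
  · exact ((TupleOp.lower_Q j).commute_T h2).symm
  obtain rfl | rfl : j = i ∨ j = i + 1 := by omega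
  · exact (TupleOp.T_mul_Q j).trans (TupleOp.Q_mul_T j).symm
  · exact TupleOp.T_mul_Q_succ i

theorem even_or_odd_index (j : ℕ) (h : 1 ≤ j) : (∃ i, j = 2 * i + 1) ∨ ∃ i, j = 2 * i + 2 := by
  rcases Nat.even_or_odd' j with ⟨i, rfl | rfl⟩
  · exact Or.inr ⟨i - 1, by omega⟩
  · exact Or.inl ⟨i, rfl⟩

theorem freeRep_e_commute_e {i j : ℕ} (hi : 1 ≤ i ∧ i < 2 * k) (hj : 1 ≤ j ∧ j < 2 * k)
    (h : i + 2 ≤ j) : Commute (freeRep Ω k (Free.e k i)) (freeRep Ω k (Free.e k j)) := by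
  rcases even_or_odd_index i hi.1 with ⟨i, rfl⟩ | ⟨i, rfl⟩ <;>
    rcases even_or_odd_index j hj.1 with ⟨j, rfl⟩ | ⟨j, rfl⟩
  · rw [freeRep_e_odd rfl (by omega), freeRep_e_odd rfl (by omega)]
    exact (TupleOp.lower_P i).commute_P (by omega)
  · rw [freeRep_e_odd rfl (by omega), freeRep_e_even rfl (by omega)]
    exact (TupleOp.lower_P i).commute_Q (by omega)
  · rw [freeRep_e_even rfl (by omega), freeRep_e_odd rfl (by omega)]
    exact (TupleOp.lower_Q i).commute_P (by omega)
  · rw [freeRep_e_even rfl (by omega), freeRep_e_even rfl (by omega)]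
    rcases (show j = i + 1 ∨ i + 2 ≤ j by omega) with rfl | h
    · exact TupleOp.Q_mul_Q_succ i
    · exact (TupleOp.lower_Q i).commute_Q h

theorem commute_sub_one {R : Type} [Ring R] {x y : R} (h : Commute x y) : Commute x (y - 1) :=
  h.sub_right (Commute.one_right x)

theorem freeRep_x_commute_x {i j : ℕ} (hi : 1 ≤ i ∧ i ≤ 2 * k) (hj : 1 ≤ j ∧ j ≤ 2 * k)
    (h : i ≤ j) : Commute (freeRep Ω k (Free.x k i)) (freeRep Ω k (Free.x k j)) := by
  rcases h.eq_or_lt with rfl | h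
  · exact Commute.refl _
  rcases even_or_odd_index i hi.1 with ⟨i, rfl⟩ | ⟨i, rfl⟩ <;>
    rcases even_or_odd_index j hj.1 with ⟨j, rfl⟩ | ⟨j, rfl⟩
  · rw [freeRep_x_odd rfl (by omega), freeRep_x_odd rfl (by omega)]
    exact commute_sub_one
      (commute_sub_one ((TupleOp.lower_Y i).commute_Y (l := j) (by omega)).symm).symm
  · rw [freeRep_x_odd rfl (by omega), freeRep_x_even rfl (by omega)]
    refine commute_sub_one (commute_sub_one (Commute.symm ?_)).symm
    rcases (show i = j ∨ i + 1 ≤ j by omega) with rfl | h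
    · exact TupleOp.Y_mul_Y' i
    · exact (TupleOp.lower_Y i).commute_Y' h
  · rw [freeRep_x_even rfl (by omega), freeRep_x_odd rfl (by omega)]
    exact commute_sub_one
      (commute_sub_one ((TupleOp.lower_Y' i).commute_Y (l := j) (by omega)).symm).symm
  · rw [freeRep_x_even rfl (by omega), freeRep_x_even rfl (by omega)]
    exact commute_sub_one
      (commute_sub_one ((TupleOp.lower_Y' i).commute_Y' (l := j) (by omega)).symm).symm

theorem freeRep_τ_commute_x {i j : ℕ} (hi : 2 ≤ i ∧ i < 2 * k) (hj : 1 ≤ j ∧ j ≤ 2 * k)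
    (h : j + 1 ≠ i ∧ j ≠ i ∧ j ≠ i + 1) :
    Commute (freeRep Ω k (Free.τ k i)) (freeRep Ω k (Free.x k j)) := by
  have hi' : (∃ l, i = 2 * l + 3) ∨ ∃ l, i = 2 * l + 2 := by
    rcases even_or_odd_index i (by omega) with ⟨l, rfl⟩ | ⟨l, rfl⟩
    · exact Or.inl ⟨l - 1, by omega⟩
    · exact Or.inr ⟨l, rfl⟩
  rcases hi' with ⟨i, rfl⟩ | ⟨i, rfl⟩ <;>
    rcases even_or_odd_index j hj.1 with ⟨j, rfl⟩ | ⟨j, rfl⟩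
  · rw [freeRep_τ_odd rfl (by omega), freeRep_x_odd rfl (by omega)]
    apply commute_sub_one
    rcases (show j + 1 ≤ i ∨ j = i ∨ i + 2 ≤ j by omega) with h | rfl | h
    · exact ((TupleOp.lower_Y j).commute_T' h).symm
    · exact TupleOp.T'_mul_Y j
    · exact (TupleOp.lower_T' i).commute_Y h
  · rw [freeRep_τ_odd rfl (by omega), freeRep_x_even rfl (by omega)]
    apply commute_sub_one
    rcases (show j + 1 ≤ i ∨ i + 2 ≤ j by omega) with h | h
    · exact ((TupleOp.lower_Y' j).commute_T' h).symm
    · exact (TupleOp.lower_T' i).commute_Y' h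
  · rw [freeRep_τ_even rfl (by omega), freeRep_x_odd rfl (by omega)]
    apply commute_sub_one
    rcases (show j + 1 ≤ i ∨ i + 2 ≤ j by omega) with h | h
    · exact ((TupleOp.lower_Y j).commute_T h).symm
    · exact (TupleOp.lower_T i).commute_Y h
  · rw [freeRep_τ_even rfl (by omega), freeRep_x_even rfl (by omega)]
    apply commute_sub_one
    rcases (show j + 1 ≤ i ∨ j = i + 1 ∨ i + 2 ≤ j by omega) with h | rfl | h
    · exact ((TupleOp.lower_Y' j).commute_T h).symm
    · exact TupleOp.T_mul_Y'_succ i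
    · exact (TupleOp.lower_T i).commute_Y' h

theorem freeRep_e_commute_x {i j : ℕ} (hi : 1 ≤ i ∧ i < 2 * k) (hj : 1 ≤ j ∧ j ≤ 2 * k)
    (h : j ≠ i ∧ j ≠ i + 1) :
    Commute (freeRep Ω k (Free.e k i)) (freeRep Ω k (Free.x k j)) := by
  rcases even_or_odd_index i hi.1 with ⟨i, rfl⟩ | ⟨i, rfl⟩ <;>
    rcases even_or_odd_index j hj.1 with ⟨j, rfl⟩ | ⟨j, rfl⟩
  · rw [freeRep_e_odd rfl (by omega), freeRep_x_odd rfl (by omega)]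
    apply commute_sub_one
    rcases (show j + 1 ≤ i ∨ i + 1 ≤ j by omega) with h | h
    · exact ((TupleOp.lower_Y j).commute_P h).symm
    · exact (TupleOp.lower_P i).commute_Y h
  · rw [freeRep_e_odd rfl (by omega), freeRep_x_even rfl (by omega)]
    apply commute_sub_one
    rcases (show j + 1 ≤ i ∨ i + 1 ≤ j by omega) with h | h
    · exact ((TupleOp.lower_Y' j).commute_P h).symm
    · exact (TupleOp.lower_P i).commute_Y' h
  · rw [freeRep_e_even rfl (by omega), freeRep_x_odd rfl (by omega)]
    apply commute_sub_one
    rcases (show j + 1 ≤ i ∨ j = i ∨ i + 2 ≤ j by omega) with h | rfl | h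
    · exact ((TupleOp.lower_Y j).commute_Q h).symm
    · exact TupleOp.Q_mul_Y j
    · exact (TupleOp.lower_Q i).commute_Y h
  · rw [freeRep_e_even rfl (by omega), freeRep_x_even rfl (by omega)]
    apply commute_sub_one
    rcases (show j + 1 ≤ i ∨ j = i + 1 ∨ i + 2 ≤ j by omega) with h | rfl | h
    · exact ((TupleOp.lower_Y' j).commute_Q h).symm
    · exact TupleOp.Q_mul_Y'_succ i
    · exact (TupleOp.lower_Q i).commute_Y' h

end Projection

-- The affine relations on operators, and the projection

section Relations

variable {Ω : Type} [Fintype Ω] [DecidableEq Ω] {k : ℕ}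

open TupleOp

/-- No coordinate precedes coordinate 0, so `Y 0` is the scalar |Ω|; this explains the prescribed
value z (z - 1)^l of the bubbles. -/
theorem P_mul_Y_pow_mul_P (l : ℕ) : (P 0 * (Y 0 - 1) ^ l * P 0 : TupleOp Ω)
    = ((Fintype.card Ω : ℂ) * ((Fintype.card Ω : ℂ) - 1) ^ l) • P 0 := by
  have h : (Y 0 - 1 : TupleOp Ω) = ((Fintype.card Ω : ℂ) - 1) • 1 := by
    ext f a
    simp [Y_apply, act_zero, sub_mul]
  rw [h, smul_pow, one_pow, mul_smul_comm, mul_one, smul_mul_assoc, P_mul_P, smul_smul, mul_comm]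

theorem freeRep_e_mul_e_mul_e {i : ℕ} (hi : 1 ≤ i ∧ i + 1 < 2 * k) :
    freeRep Ω k (Free.e k i) * freeRep Ω k (Free.e k (i + 1)) * freeRep Ω k (Free.e k i)
        = freeRep Ω k (Free.e k i) ∧
      freeRep Ω k (Free.e k (i + 1)) * freeRep Ω k (Free.e k i) * freeRep Ω k (Free.e k (i + 1))
        = freeRep Ω k (Free.e k (i + 1)) := by
  rcases even_or_odd_index i hi.1 with ⟨i, rfl⟩ | ⟨i, rfl⟩
  · rw [freeRep_e_odd (i := i) rfl (by omega),
      freeRep_e_even (i := i) (j := 2 * i + 1 + 1) rfl (by omega)]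
    exact ⟨P_mul_Q_mul_P i, Q_mul_P_mul_Q i⟩
  · rw [freeRep_e_even (i := i) rfl (by omega),
      freeRep_e_odd (i := i + 1) (j := 2 * i + 2 + 1) rfl (by omega)]
    exact ⟨Q_mul_P_succ_mul_Q i, P_succ_mul_Q_mul_P_succ i⟩

theorem freeRep_e_mul_x_sub {i : ℕ} (hi : 1 ≤ i ∧ i < 2 * k) :
    freeRep Ω k (Free.e k i) * (freeRep Ω k (Free.x k i) - freeRep Ω k (Free.x k (i + 1))) = 0 ∧
      (freeRep Ω k (Free.x k i) - freeRep Ω k (Free.x k (i + 1))) * freeRep Ω k (Free.e k i)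
        = 0 := by
  rcases even_or_odd_index i hi.1 with ⟨i, rfl⟩ | ⟨i, rfl⟩
  · rw [freeRep_e_odd (i := i) rfl (by omega), freeRep_x_odd (i := i) rfl (by omega),
      freeRep_x_even (i := i) (j := 2 * i + 1 + 1) rfl (by omega), sub_sub_sub_cancel_right,
      mul_sub, sub_mul]
    exact ⟨sub_eq_zero.2 (P_mul_Y i), sub_eq_zero.2 (Y_mul_P i)⟩
  · rw [freeRep_e_even (i := i) rfl (by omega), freeRep_x_even (i := i) rfl (by omega),
      freeRep_x_odd (i := i + 1) (j := 2 * i + 2 + 1) rfl (by omega), sub_sub_sub_cancel_right,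
      mul_sub, sub_mul]
    exact ⟨sub_eq_zero.2 (Q_mul_Y' i), sub_eq_zero.2 (Y'_mul_Q i)⟩

variable (Ω) in
theorem freeRep_rel {a b : FreeAlgebra ℂ (AffGen k)} (h : AffRel k a b) :
    freeRep Ω k a = freeRep Ω k b := by
  -- The relations count indices from 1 and write them in several forms. These facts match each form
  -- once i has been replaced by i + 1, or by i + 2 where i ≥ 2.
  have t1 : ∀ i, i + 1 < k → freeRep Ω k (Free.τ k (2 * (i + 1))) = T i :=
    fun i hi => freeRep_τ_even rfl hi
  have t2 : ∀ i, i + 1 < k → freeRep Ω k (Free.τ k (2 * (i + 1) + 1)) = T' i :=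
    fun i hi => freeRep_τ_odd rfl hi
  have t3 : ∀ i, i + 1 < k → freeRep Ω k (Free.τ k (2 * (i + 1 + 1) - 1)) = T' i :=
    fun i hi => freeRep_τ_odd rfl hi
  have t4 : ∀ i, i + 1 < k → freeRep Ω k (Free.τ k (2 * (i + 1 + 1) - 2)) = T i :=
    fun i hi => freeRep_τ_even rfl hi
  have e1 : ∀ i, i + 1 < k → freeRep Ω k (Free.e k (2 * (i + 1))) = Q i :=
    fun i hi => freeRep_e_even rfl hi
  have e2 : ∀ i, i < k → freeRep Ω k (Free.e k (2 * (i + 1) - 1)) = P i :=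
    fun i hi => freeRep_e_odd rfl hi
  have e3 : ∀ i, i + 1 < k → freeRep Ω k (Free.e k (2 * (i + 1) + 1)) = P (i + 1) :=
    fun i hi => freeRep_e_odd rfl hi
  have e4 : ∀ i, i + 1 < k → freeRep Ω k (Free.e k (2 * (i + 1 + 1) - 2)) = Q i :=
    fun i hi => freeRep_e_even rfl hi
  have x1 : ∀ i, i < k → freeRep Ω k (Free.x k (2 * (i + 1))) = Y' i - 1 :=
    fun i hi => freeRep_x_even rfl hi
  have x2 : ∀ i, i < k → freeRep Ω k (Free.x k (2 * (i + 1) - 1)) = Y i - 1 :=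
    fun i hi => freeRep_x_odd rfl hi
  have x3 : ∀ i, i + 1 < k → freeRep Ω k (Free.x k (2 * (i + 1) + 1)) = Y (i + 1) - 1 :=
    fun i hi => freeRep_x_odd rfl hi
  have x4 : ∀ i, i + 1 < k → freeRep Ω k (Free.x k (2 * (i + 1) + 2)) = Y' (i + 1) - 1 :=
    fun i hi => freeRep_x_even rfl hi
  have pos : ∀ {i : ℕ}, 1 ≤ i → ∃ j, i = j + 1 := fun {i} hi => ⟨i - 1, by omega⟩
  have two : ∀ {i : ℕ}, 2 ≤ i → ∃ j, i = j + 1 + 1 := fun {i} hi => ⟨i - 2, by omega⟩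
  cases h with
  | r1i i hi =>
    obtain ⟨i, rfl⟩ := pos hi.1
    rw [map_pow, map_sub, map_one, t1 i hi.2, e1 i hi.2, sq, T_mul_T]
  | r1ii i hi =>
    obtain ⟨i, rfl⟩ := pos hi.1
    rw [map_pow, map_sub, map_one, t2 i hi.2, e1 i hi.2, sq, T'_mul_T']
  | r2i i j hi hj h =>
    obtain ⟨i, rfl⟩ := pos hi.1
    obtain ⟨j, rfl⟩ := pos hj.1
    rw [map_mul, map_mul, t2 i hi.2, t1 j hj.2]
    exact T'_commute_T (by omega)
  | r2ii i j hi hj h =>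
    obtain ⟨i, rfl⟩ := pos hi.1
    obtain ⟨j, rfl⟩ := pos hj.1
    rw [map_mul, map_mul, t2 i hi.2, t2 j hj.2]
    rcases (show i = j ∨ i + 2 ≤ j ∨ j + 2 ≤ i by omega) with rfl | h | h
    · rfl
    · exact (lower_T' i).commute_T' h
    · exact ((lower_T' j).commute_T' h).symm
  | r2iii i j hi hj h =>
    obtain ⟨i, rfl⟩ := pos hi.1
    obtain ⟨j, rfl⟩ := pos hj.1
    rw [map_mul, map_mul, t1 i hi.2, t1 j hj.2]
    rcases (show i = j ∨ i + 2 ≤ j ∨ j + 2 ≤ i by omega) with rfl | h | h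
    · rfl
    · exact (lower_T i).commute_T h
    · exact ((lower_T j).commute_T h).symm
  | r2iv i hi =>
    obtain ⟨i, rfl⟩ := pos hi.1
    simp only [map_mul, freeRep_s Ω (show i + 1 < k by omega), freeRep_s Ω hi.2]
    exact S_braid i
  | r3i i hi =>
    obtain ⟨i, rfl⟩ := pos hi.1
    rw [map_pow, map_mul, e2 i hi.2, freeRep_z, pow_zero, mul_one, smul_one_mul, sq, P_mul_P]
  | r3ii i hi =>
    obtain ⟨i, rfl⟩ := pos hi.1
    rw [map_pow, e1 i hi.2, sq, Q_mul_Q]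
  | r3iii i hi =>
    obtain ⟨i, rfl⟩ := pos hi.1
    rw [map_mul, map_zero, t2 i hi.2, e1 i hi.2, T'_mul_Q]
  | r3iii' i hi =>
    obtain ⟨i, rfl⟩ := pos hi.1
    rw [map_mul, map_zero, t2 i hi.2, e1 i hi.2, Q_mul_T']
  | r3iv i hi =>
    obtain ⟨i, rfl⟩ := pos hi.1
    rw [map_mul, map_zero, t1 i hi.2, e1 i hi.2, T_mul_Q]
  | r3iv' i hi =>
    obtain ⟨i, rfl⟩ := pos hi.1
    rw [map_mul, map_zero, t1 i hi.2, e1 i hi.2, Q_mul_T]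
  | r3v i hi =>
    obtain ⟨i, rfl⟩ := pos hi.1
    simp only [map_mul, t1 i hi.2, t2 i hi.2, e2 i (by omega), e3 i hi.2]
    exact T_mul_P_mul_P i
  | r3vi i hi =>
    obtain ⟨i, rfl⟩ := pos hi.1
    simp only [map_mul, t1 i hi.2, t2 i hi.2, e2 i (by omega), e3 i hi.2]
    exact P_mul_P_mul_T i
  | r4i i j hi hj h =>
    rw [map_mul, map_mul]
    rcases h with h | h
    · exact freeRep_e_commute_e hi hj h
    · exact (freeRep_e_commute_e hj hi h).symm
  | r4ii i j hi hj h =>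
    obtain ⟨i, rfl⟩ := two hi.1
    obtain ⟨j, rfl⟩ := pos hj.1
    rw [map_mul, map_mul, t3 i (by omega), e2 j hj.2]
    rcases (show i + 2 ≤ j ∨ j + 1 ≤ i by omega) with h | h
    · exact (lower_T' i).commute_P h
    · exact ((lower_P j).commute_T' h).symm
  | r4iii i j hi hj h =>
    obtain ⟨i, rfl⟩ := two hi.1
    obtain ⟨j, rfl⟩ := pos hj.1
    rw [map_mul, map_mul, t3 i (by omega), e1 j hj.2]
    exact T'_commute_Q (by omega)
  | r4iv i j hi hj h =>
    obtain ⟨i, rfl⟩ := pos hi.1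
    obtain ⟨j, rfl⟩ := pos hj.1
    rw [map_mul, map_mul, t1 i hi.2, e2 j hj.2]
    rcases (show i + 2 ≤ j ∨ j + 1 ≤ i by omega) with h | h
    · exact (lower_T i).commute_P h
    · exact ((lower_P j).commute_T h).symm
  | r4v i j hi hj h =>
    obtain ⟨i, rfl⟩ := pos hi.1
    obtain ⟨j, rfl⟩ := pos hj.1
    rw [map_mul, map_mul, t1 i hi.2, e1 j hj.2]
    exact T_commute_Q (by omega)
  | r5i i hi =>
    rw [map_mul, map_mul]
    exact (freeRep_e_mul_e_mul_e hi).1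
  | r5i' i hi =>
    rw [map_mul, map_mul]
    exact (freeRep_e_mul_e_mul_e hi).2
  | r5ii i hi =>
    obtain ⟨i, rfl⟩ := pos hi.1
    simp only [map_mul, t1 i hi.2, t2 i hi.2, e2 i (by omega), e3 i hi.2]
    exact T_mul_P_mul_T i
  | r5iii i hi =>
    obtain ⟨i, rfl⟩ := two hi.1
    simp only [map_mul, t1 (i + 1) hi.2, t3 i (by omega), e4 i (by omega), e1 (i + 1) hi.2]
    exact T_mul_Q_mul_T i
  | r6i i j hi hj =>
    rw [map_mul, map_mul]
    rcases le_total i j with h | h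
    · exact freeRep_x_commute_x hi hj h
    · exact (freeRep_x_commute_x hj hi h).symm
  | r6ii i j hi hj h =>
    rw [map_mul, map_mul]
    exact freeRep_τ_commute_x hi hj h
  | r6iii i j hi hj h =>
    rw [map_mul, map_mul]
    exact freeRep_e_commute_x hi hj h
  | r7i i hi =>
    obtain ⟨i, rfl⟩ := two hi.1
    simp only [map_mul, map_sub, map_one, t1 (i + 1) hi.2, t4 i (by omega), e4 i (by omega)]
    exact T_braid i
  | r7ii i hi =>
    obtain ⟨i, rfl⟩ := two hi.1
    simp only [map_mul, map_sub, map_one, t2 (i + 1) hi.2, t3 i (by omega), e1 (i + 1) hi.2]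
    exact T'_braid i
  | r7iii i hi =>
    obtain ⟨i, rfl⟩ := two hi.1
    simp only [map_mul, map_sub, t1 (i + 1) hi.2, t3 i (by omega), e4 i (by omega)]
    exact T'_mul_T_mul_T' i
  | r7iv i hi =>
    obtain ⟨i, rfl⟩ := two hi.1
    simp only [map_mul, map_sub, t1 (i + 1) hi.2, t3 i (by omega), e1 (i + 1) hi.2]
    exact T_mul_T'_mul_T i
  | r8i i hi =>
    obtain ⟨i, rfl⟩ := pos hi.1
    simp only [map_mul, map_sub, map_add, t1 i hi.2, e1 i hi.2, e2 i (by omega), x2 i (by omega),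
      x3 i hi.2, mul_sub, sub_mul, mul_one, T_mul_T]
    rw [Y_succ]
    abel
  | r8ii i hi =>
    obtain ⟨i, rfl⟩ := pos hi.1
    simp only [map_mul, map_sub, map_add, t2 i hi.2, e1 i hi.2, e3 i hi.2, x1 i (by omega),
      x4 i hi.2, mul_sub, sub_mul, mul_one, T'_mul_T']
    rw [Y'_succ]
    abel
  | r8iii i hi =>
    obtain ⟨i, rfl⟩ := pos hi.1
    simp only [map_mul, map_add, t1 i hi.2, e1 i hi.2, e2 i (by omega), x1 i (by omega),
      mul_sub, sub_mul, mul_one, T_mul_T]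
    conv_lhs => rw [Y'_eq]
    abel
  | r8iv i hi =>
    obtain ⟨i, rfl⟩ := pos hi.1
    simp only [map_mul, map_add, t2 i hi.2, e1 i hi.2, e3 i hi.2, x3 i hi.2,
      mul_sub, sub_mul, mul_one, T'_mul_T']
    conv_lhs => rw [Y_succ_eq]
    abel
  | r9i i hi =>
    rw [map_mul, map_sub, map_zero]
    exact (freeRep_e_mul_x_sub hi).1
  | r9ii i hi =>
    rw [map_mul, map_sub, map_zero]
    exact (freeRep_e_mul_x_sub hi).2
  | r10i hk l =>
    simp only [map_mul, map_pow, freeRep_e_odd (i := 0) (j := 1) rfl hk,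
      freeRep_x_odd (i := 0) (j := 1) rfl hk, freeRep_z, smul_one_mul]
    exact P_mul_Y_pow_mul_P l
  | r10ii l g =>
    rw [map_mul, map_mul, freeRep_z, smul_one_mul, mul_smul_one]

/-- The projection from the affine partition algebra onto the partition algebra. -/
def proj (k : ℕ) : AffinePartitionAlgebra k →ₐ[ℂ] PartitionAlgebra k :=
  RingQuot.liftAlgHom ℂ ⟨FreeAlgebra.lift ℂ (genImage k), fun _ _ h =>
    ext_tupleRep fun n => freeRep_rel (Fin n) h⟩

theorem proj_mk (a : FreeAlgebra ℂ (AffGen k)) :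
    proj k (RingQuot.mkAlgHom ℂ (AffRel k) a) = FreeAlgebra.lift ℂ (genImage k) a :=
  RingQuot.liftAlgHom_mkAlgHom_apply _ _ _ _

theorem proj_isProjection (k : ℕ) : IsProjection (proj k) where
  map_τ i h1 h2 := by
    rw [AffinePartitionAlgebra.τ, proj_mk, Free.τ, dif_pos ⟨h1, h2⟩, FreeAlgebra.lift_ι_apply]
    rfl
  map_e i h1 h2 := by
    rw [AffinePartitionAlgebra.e, proj_mk, Free.e, dif_pos ⟨h1, h2⟩, FreeAlgebra.lift_ι_apply]
    rfl
  map_x i h1 h2 := by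
    rw [AffinePartitionAlgebra.x, proj_mk, Free.x, dif_pos ⟨h1, h2⟩, FreeAlgebra.lift_ι_apply]
    rfl
  map_z l := by
    rw [AffinePartitionAlgebra.z, proj_mk, Free.z, FreeAlgebra.lift_ι_apply]
    rfl

theorem isProjection_unique {f : AffinePartitionAlgebra k →ₐ[ℂ] PartitionAlgebra k}
    (hf : IsProjection f) : f = proj k := by
  have hp := proj_isProjection k
  refine RingQuot.ringQuot_ext' _ _ _ (FreeAlgebra.hom_ext (funext fun g => ?_))
  cases g with
  | tau i h =>
    have h1 := (hf.map_τ i h.1 h.2).trans (hp.map_τ i h.1 h.2).symm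
    rwa [AffinePartitionAlgebra.τ, Free.τ, dif_pos h] at h1
  | e i h =>
    have h1 := (hf.map_e i h.1 h.2).trans (hp.map_e i h.1 h.2).symm
    rwa [AffinePartitionAlgebra.e, Free.e, dif_pos h] at h1
  | x i h =>
    have h1 := (hf.map_x i h.1 h.2).trans (hp.map_x i h.1 h.2).symm
    rwa [AffinePartitionAlgebra.x, Free.x, dif_pos h] at h1
  | z l => exact (hf.map_z l).trans (hp.map_z l).symm

end Relations

/-! ### The presentation of the partition monoid -/

/-- Elements of a monoid that satisfy the defining relations of the partition monoid. The index
shift is `s i = s_{i+1}`, `p i = e_{2i+1}`, `q i = e_{2i+2}`. -/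
structure PartitionGenerators (k : ℕ) (B : Type) [Monoid B] where
  z : B
  s : ℕ → B
  p : ℕ → B
  q : ℕ → B
  z_comm_s : ∀ i, i + 1 < k → Commute z (s i)
  z_comm_p : ∀ i, i < k → Commute z (p i)
  z_comm_q : ∀ i, i + 1 < k → Commute z (q i)
  s_mul_s : ∀ i, i + 1 < k → s i * s i = 1
  s_braid : ∀ i, i + 2 < k → s i * s (i + 1) * s i = s (i + 1) * s i * s (i + 1)
  s_comm : ∀ i j, i + 2 ≤ j → j + 1 < k → Commute (s i) (s j)
  p_mul_p : ∀ i, i < k → p i * p i = z * p i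
  q_mul_q : ∀ i, i + 1 < k → q i * q i = q i
  p_q_p : ∀ i, i + 1 < k → p i * q i * p i = p i
  q_p_q : ∀ i, i + 1 < k → q i * p i * q i = q i
  p_comm : ∀ i j, i < k → j < k → Commute (p i) (p j)
  q_comm : ∀ i j, i + 1 < k → j + 1 < k → Commute (q i) (q j)
  p_comm_q : ∀ i j, i < k → j + 1 < k → i ≠ j → i ≠ j + 1 → Commute (p i) (q j)
  s_mul_q : ∀ i, i + 1 < k → s i * q i = q i
  q_mul_s : ∀ i, i + 1 < k → q i * s i = q i
  s_mul_p_mul_p : ∀ i, i + 1 < k → s i * (p i * p (i + 1)) = p i * p (i + 1)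
  s_mul_p : ∀ i, i + 1 < k → s i * p i = p (i + 1) * s i
  s_comm_p : ∀ i j, i + 1 < k → j < k → j ≠ i → j ≠ i + 1 → Commute (s i) (p j)
  s_comm_q : ∀ i j, i + 1 < k → j + 1 < k → i + 2 ≤ j ∨ j + 2 ≤ i → Commute (s i) (q j)
  s_q_s : ∀ i, i + 2 < k → s (i + 1) * q i * s (i + 1) = s i * q (i + 1) * s i

/-- The transposition of `i` and `i + 1`. -/
def adjSwap (k i : ℕ) : Equiv.Perm (Fin k) :=
  if h : i + 1 < k then Equiv.swap ⟨i, by omega⟩ ⟨i + 1, h⟩ else 1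

theorem coe_adjSwap {k i : ℕ} (h : i + 1 < k) (j : Fin k) :
    (adjSwap k i j : ℕ) = if (j : ℕ) = i then i + 1 else if (j : ℕ) = i + 1 then i else j := by
  rw [adjSwap, dif_pos h, Equiv.swap_apply_def]
  simp only [Fin.ext_iff]
  split_ifs <;> rfl

theorem adjSwap_mul_self (k i : ℕ) : adjSwap k i * adjSwap k i = 1 := by
  rw [adjSwap]; split_ifs <;> simp

theorem adjSwap_comm {k i j : ℕ} (h : i + 2 ≤ j) (hj : j + 1 < k) :
    adjSwap k i * adjSwap k j = adjSwap k j * adjSwap k i := by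
  ext x
  simp only [Equiv.Perm.mul_apply, coe_adjSwap hj, coe_adjSwap (show i + 1 < k by omega)]
  split_ifs <;> omega

theorem adjSwap_braid {k i : ℕ} (h : i + 2 < k) :
    adjSwap k i * adjSwap k (i + 1) * adjSwap k i
      = adjSwap k (i + 1) * adjSwap k i * adjSwap k (i + 1) := by
  ext x
  simp only [Equiv.Perm.mul_apply, coe_adjSwap (show i + 1 + 1 < k from h),
    coe_adjSwap (show i + 1 < k by omega)]
  split_ifs <;> omega

/-- The product `s_j s_{j+1} ⋯ s_{j+n-1}`. -/
def ascending {B : Type} [Monoid B] (s : ℕ → B) : ℕ → ℕ → B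
  | _, 0 => 1
  | j, n + 1 => s j * ascending s (j + 1) n

section Ascending

variable {B : Type} [Monoid B] {k : ℕ} {s : ℕ → B}

theorem mul_ascending_of_lt (comm : ∀ i j, i + 2 ≤ j → j + 1 < k → s i * s j = s j * s i)
    {i : ℕ} : ∀ {j n : ℕ}, i + 2 ≤ j → j + n < k →
    s i * ascending s j n = ascending s j n * s i
  | j, 0, _, _ => by simp [ascending]
  | j, n + 1, h, hk => by
    rw [ascending, ← mul_assoc, comm i j h (by omega), mul_assoc,
      mul_ascending_of_lt comm (by omega) (by omega), mul_assoc]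

/-- The generator s_{i+1} commutes with the factors before s_i, the braid relation at s_i s_{i+1}
turns it into s_i, and this commutes with the remaining factors. -/
theorem mul_ascending (comm : ∀ i j, i + 2 ≤ j → j + 1 < k → s i * s j = s j * s i)
    (braid : ∀ i, i + 2 < k → s i * s (i + 1) * s i = s (i + 1) * s i * s (i + 1)) {i : ℕ} :
    ∀ {j n : ℕ}, j ≤ i → i + 1 < j + n → j + n < k →
    s (i + 1) * ascending s j n = ascending s j n * s i
  | j, 0, h, h', _ => by omega
  | j, 1, h, h', _ => by omega
  | j, n + 2, h, h', hk => by
    by_cases hi : i = j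
    · subst hi
      rw [ascending, ascending, mul_assoc, mul_assoc,
        ← mul_ascending_of_lt comm (by omega) (by omega), ← mul_assoc, ← mul_assoc, ← mul_assoc,
        ← mul_assoc, braid i (by omega)]
    · rw [ascending, ← mul_assoc, ← comm j (i + 1) (by omega) (by omega), mul_assoc,
        mul_ascending comm braid (by omega) (by omega) (by omega), mul_assoc]

end Ascending

theorem ascending_adjSwap_apply {k : ℕ} : ∀ {j n : ℕ} (h : j + n < k),
    ascending (adjSwap k) j n ⟨j + n, h⟩ = ⟨j, by omega⟩
  | j, 0, h => rfl
  | j, n + 1, h => by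
    have e : (⟨j + (n + 1), h⟩ : Fin k) = ⟨j + 1 + n, by omega⟩ := Fin.ext (by simp; omega)
    rw [ascending, Equiv.Perm.mul_apply, e, ascending_adjSwap_apply]
    apply Fin.ext
    rw [coe_adjSwap (by omega)]
    simp

theorem ascending_adjSwap_apply_of_lt {k : ℕ} {x : Fin k} : ∀ {j n : ℕ}, j + n < x →
    ascending (adjSwap k) j n x = x
  | j, 0, h => rfl
  | j, n + 1, h => by
    rw [ascending, Equiv.Perm.mul_apply, ascending_adjSwap_apply_of_lt (by omega)]
    apply Fin.ext
    rw [coe_adjSwap (by omega)]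
    split_ifs <;> omega

theorem ascending_mem_closure {k m : ℕ} : ∀ {j n : ℕ}, j + n < m →
    ascending (adjSwap k) j n ∈ Submonoid.closure {g | ∃ i, i + 1 < m ∧ g = adjSwap k i}
  | _, 0, _ => one_mem _
  | j, n + 1, h => mul_mem (Submonoid.subset_closure ⟨j, by omega, rfl⟩)
      (ascending_mem_closure (by omega))

/-- A permutation fixing the points `≥ m` is a product of adjacent transpositions below `m`. -/
theorem mem_closure_adjSwap {k : ℕ} (m : ℕ) (hm : m ≤ k) (g : Equiv.Perm (Fin k))
    (hg : ∀ j : Fin k, m ≤ j → g j = j) :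
    g ∈ Submonoid.closure {g | ∃ i, i + 1 < m ∧ g = adjSwap k i} := by
  induction m generalizing g with
  | zero =>
    rw [show g = 1 from Equiv.ext fun j => hg j (Nat.zero_le _)]
    exact one_mem _
  | succ m ih =>
    let l : Fin k := ⟨m, hm⟩
    have hgl : g l ≤ l := by
      by_contra h
      have h' : g (g l) = g l := hg _ (by simpa [l, Fin.lt_def] using h)
      exact h (g.injective h').le
    have hjm : (g l : ℕ) ≤ m := hgl
    set c := ascending (adjSwap k) (g l) (m - g l) with hc
    -- The ascending word moves the last point `l` to `g l`, so removing it from the left of `g`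
    -- leaves a permutation that also fixes `l`.
    have e : l = ⟨g l + (m - g l), by omega⟩ := Fin.ext (by change m = _; simp only; omega)
    have hcl : c l = g l := by
      have := ascending_adjSwap_apply (k := k) (j := g l) (n := m - g l) (by omega)
      rw [← e] at this
      exact this
    have h1 : c⁻¹ * g ∈ Submonoid.closure {g | ∃ i, i + 1 < m ∧ g = adjSwap k i} := by
      refine ih (by omega) _ fun j hj => ?_
      rw [Equiv.Perm.mul_apply, Equiv.Perm.inv_eq_iff_eq]
      by_cases hjl : j = l
      · rw [hjl, hcl]
      · have hlt : m < j := lt_of_le_of_ne hj fun h => hjl (Fin.ext h.symm)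
        rw [hg j hlt]
        exact (ascending_adjSwap_apply_of_lt (by omega)).symm
    rw [← mul_inv_cancel_left c g]
    refine mul_mem (ascending_mem_closure (by omega)) (Submonoid.closure_mono ?_ h1)
    rintro _ ⟨i, hi, rfl⟩
    exact ⟨i, by omega, rfl⟩

namespace PartitionGenerators

variable {k : ℕ} {B : Type} [Monoid B] (G : PartitionGenerators k B)

/-- A lift of the permutations fixing the points `≥ m`, built along the cosets of the stabilizer
of the last point. -/
theorem exists_lift (m : ℕ) (hm : m ≤ k) : ∃ ν : Equiv.Perm (Fin k) → B, ν 1 = 1 ∧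
    ∀ i g, i + 1 < m → (∀ j : Fin k, m ≤ j → g j = j) → ν (adjSwap k i * g) = G.s i * ν g := by
  induction m with
  | zero => exact ⟨fun _ => 1, rfl, fun i g h => by omega⟩
  | succ m ih =>
    obtain ⟨ν, h1, hν⟩ := ih (by omega)
    -- The ascending words represent the cosets of the stabilizer of the last point, here in the
    -- symmetric group and in `B`; the word of index `j` sends the last point to `j`.
    let c : Fin k → Equiv.Perm (Fin k) := fun j => ascending (adjSwap k) j (m - j)
    let C : Fin k → B := fun j => ascending G.s j (m - j)
    let l : Fin k := ⟨m, hm⟩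
    have hcl : ∀ j : Fin k, j ≤ l → c j l = j := by
      intro j hj
      have hj' : (j : ℕ) ≤ m := hj
      have e : l = ⟨j + (m - j), by omega⟩ := Fin.ext (by simp [l]; omega)
      have := ascending_adjSwap_apply (k := k) (j := j) (n := m - j) (by omega)
      simp only [c]
      rw [e]
      exact this
    have hc1 : c l = 1 := by simp [c, l, ascending]
    have hC1 : C l = 1 := by simp [C, l, ascending]
    refine ⟨fun g => C (g l) * ν ((c (g l))⁻¹ * g), ?_, ?_⟩
    · simp only [Equiv.Perm.one_apply, hc1, hC1, inv_one, one_mul, h1]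
    · intro i g hi hg
      have hgl : g l ≤ l := by
        by_contra h
        have h' : g (g l) = g l := hg _ (by simpa [l, Fin.lt_def] using h)
        exact h (g.injective h').le
      have hjm : (g l : ℕ) ≤ m := hgl
      have hfix : ∀ j : Fin k, m ≤ j → ((c (g l))⁻¹ * g) j = j := by
        intro j hj
        rw [Equiv.Perm.mul_apply, Equiv.Perm.inv_eq_iff_eq]
        by_cases hjl : j = l
        · rw [hjl, hcl _ hgl]
        · have hlt : m < j := lt_of_le_of_ne hj fun h => hjl (Fin.ext h.symm)
          rw [hg j hlt]
          exact (ascending_adjSwap_apply_of_lt (by omega)).symm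
      set j := g l with hj
      have hval := coe_adjSwap (k := k) (i := i) (by omega) j
      simp only [Equiv.Perm.mul_apply, ← hj]
      have hs := G.s_mul_s i (by omega)
      have hss := adjSwap_mul_self k i
      -- the four positions of `j` relative to `i, i + 1`
      rcases (show (j : ℕ) = i ∨ (j : ℕ) = i + 1 ∨ i + 2 ≤ j ∨ (j : ℕ) < i by omega) with
        h | h | h | h
      · have e1 : m - i = m - (i + 1) + 1 := by omega
        have hv : (adjSwap k i j : ℕ) = i + 1 := by rw [hval, if_pos h]
        have ec : c j = adjSwap k i * c (adjSwap k i j) := by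
          simp only [c, hv]; rw [h, e1, ascending]
        have eC : C j = G.s i * C (adjSwap k i j) := by
          simp only [C, hv]; rw [h, e1, ascending]
        rw [ec, eC, mul_inv_rev, inv_eq_of_mul_eq_one_right hss, ← mul_assoc (G.s i),
          ← mul_assoc (G.s i), hs, one_mul, mul_assoc]
      · have e1 : m - i = m - (i + 1) + 1 := by omega
        have hv : (adjSwap k i j : ℕ) = i := by rw [hval, if_neg (by omega), if_pos h]
        have ec : c (adjSwap k i j) = adjSwap k i * c j := by
          simp only [c, hv]; rw [h, e1, ascending]
        have eC : C (adjSwap k i j) = G.s i * C j := by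
          simp only [C, hv]; rw [h, e1, ascending]
        rw [ec, eC, mul_inv_rev, inv_eq_of_mul_eq_one_right hss, mul_assoc, mul_assoc,
          ← mul_assoc _ _ g, hss, one_mul]
      · have hv : adjSwap k i j = j := by
          apply Fin.ext
          rw [hval, if_neg (by omega), if_neg (by omega)]
        have ec : adjSwap k i * c j = c j * adjSwap k i :=
          mul_ascending_of_lt (fun a b => adjSwap_comm) h (by omega)
        have eC : G.s i * C j = C j * G.s i :=
          mul_ascending_of_lt (fun a b h h' => G.s_comm a b h h') h (by omega)
        have e2 : (c j)⁻¹ * (adjSwap k i * g) = adjSwap k i * ((c j)⁻¹ * g) := by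
          rw [inv_mul_eq_iff_eq_mul, ← mul_assoc, ← ec, mul_assoc, mul_inv_cancel_left]
        rw [hv, e2, hν i _ (by omega) hfix, ← mul_assoc, ← mul_assoc, eC]
      -- Below, the generator loses one from its index when it crosses the coset word, and so lands
      -- in the range of the smaller lift.
      · obtain ⟨i, rfl⟩ : ∃ i', i = i' + 1 := ⟨i - 1, by omega⟩
        have hv : adjSwap k (i + 1) j = j := by
          apply Fin.ext
          rw [hval, if_neg (by omega), if_neg (by omega)]
        have ec : adjSwap k (i + 1) * c j = c j * adjSwap k i :=
          mul_ascending (fun a b => adjSwap_comm) (fun a => adjSwap_braid) (by omega) (by omega)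
            (by omega)
        have eC : G.s (i + 1) * C j = C j * G.s i :=
          mul_ascending (fun a b h h' => G.s_comm a b h h') G.s_braid (by omega) (by omega)
            (by omega)
        have e2 : (c j)⁻¹ * (adjSwap k (i + 1) * g) = adjSwap k i * ((c j)⁻¹ * g) := by
          rw [inv_mul_eq_iff_eq_mul, ← mul_assoc, ← ec, mul_assoc, mul_inv_cancel_left]
        rw [hv, e2, hν i _ (by omega) hfix, ← mul_assoc, ← mul_assoc, eC]

/-- The lift respects left multiplication by adjacent transpositions, and these generate the
symmetric group, so it is multiplicative. -/
theorem exists_hom : ∃ W : Equiv.Perm (Fin k) →* B, ∀ i, i + 1 < k → W (adjSwap k i) = G.s i := by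
  obtain ⟨ν, h1, hν⟩ := G.exists_lift k le_rfl
  have hfix : ∀ (g : Equiv.Perm (Fin k)) (j : Fin k), k ≤ j → g j = j := fun g j h => by omega
  refine ⟨{ toFun := ν, map_one' := h1, map_mul' := fun g h => ?_ }, fun i hi => ?_⟩
  · have hg := mem_closure_adjSwap k le_rfl g (hfix g)
    induction hg using Submonoid.closure_induction_left with
    | one => rw [one_mul, h1, one_mul]
    | mul_left x hx y hy ih =>
      obtain ⟨i, hi, rfl⟩ := hx
      rw [mul_assoc, hν i _ hi (hfix _), ih, hν i _ hi (hfix _), mul_assoc]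
  · have := hν i 1 hi (hfix _)
    rwa [mul_one, h1, mul_one] at this

/-- The homomorphism from the symmetric group. -/
def W : Equiv.Perm (Fin k) →* B := G.exists_hom.choose

theorem W_adjSwap {i : ℕ} (hi : i + 1 < k) : G.W (adjSwap k i) = G.s i :=
  G.exists_hom.choose_spec i hi

theorem W_inv_mul (g : Equiv.Perm (Fin k)) : G.W g⁻¹ * G.W g = 1 := by
  rw [← map_mul, inv_mul_cancel, map_one]

theorem W_mul_inv (g : Equiv.Perm (Fin k)) : G.W g * G.W g⁻¹ = 1 := by
  rw [← map_mul, mul_inv_cancel, map_one]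

end PartitionGenerators

/-- The symmetric group is transitive on injective families. -/
theorem exists_perm_comp_eq {A : Type} {k : ℕ} {f f' : A → Fin k} (hf : Function.Injective f)
    (hf' : Function.Injective f') : ∃ g : Equiv.Perm (Fin k), ∀ a, g (f a) = f' a := by
  classical
  let e : {x // x ∈ Set.range f} ≃ {x // x ∈ Set.range f'} :=
    (Equiv.ofInjective f hf).symm.trans (Equiv.ofInjective f' hf')
  refine ⟨e.extendSubtype, fun a => ?_⟩
  rw [Equiv.extendSubtype_apply_of_mem e (f a) ⟨a, rfl⟩]
  have : (Equiv.ofInjective f hf).symm ⟨f a, a, rfl⟩ = a := Equiv.ofInjective_symm_apply hf a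
  simp only [e, Equiv.trans_apply, this]
  rfl

theorem exists_perm_pair {k : ℕ} {a b c d : Fin k} (h : a ≠ b) (h' : c ≠ d) :
    ∃ g : Equiv.Perm (Fin k), g a = c ∧ g b = d := by
  have hi : ∀ x y : Fin k, x ≠ y → Function.Injective ![x, y] := fun x y hxy i j hij => by
    fin_cases i <;> fin_cases j <;> simp_all [eq_comm]
  obtain ⟨g, hg⟩ := exists_perm_comp_eq (hi a b h) (hi c d h')
  exact ⟨g, hg 0, hg 1⟩

theorem exists_perm_triple {k : ℕ} {a b c d e f : Fin k} (hab : a ≠ b) (hac : a ≠ c) (hbc : b ≠ c)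
    (hde : d ≠ e) (hdf : d ≠ f) (hef : e ≠ f) :
    ∃ g : Equiv.Perm (Fin k), g a = d ∧ g b = e ∧ g c = f := by
  have hi : ∀ x y z : Fin k, x ≠ y → x ≠ z → y ≠ z → Function.Injective ![x, y, z] :=
    fun x y z h h' h'' i j hij => by
      fin_cases i <;> fin_cases j <;> simp_all [eq_comm]
  obtain ⟨g, hg⟩ := exists_perm_comp_eq (hi a b c hab hac hbc) (hi d e f hde hdf hef)
  exact ⟨g, hg 0, hg 1, hg 2⟩

theorem exists_perm_quadruple {k : ℕ} {a b c d e f u v : Fin k} (hab : a ≠ b) (hac : a ≠ c)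
    (had : a ≠ d) (hbc : b ≠ c) (hbd : b ≠ d) (hcd : c ≠ d) (hef : e ≠ f) (heu : e ≠ u)
    (hev : e ≠ v) (hfu : f ≠ u) (hfv : f ≠ v) (huv : u ≠ v) :
    ∃ g : Equiv.Perm (Fin k), g a = e ∧ g b = f ∧ g c = u ∧ g d = v := by
  have hi : ∀ x y z w : Fin k, x ≠ y → x ≠ z → x ≠ w → y ≠ z → y ≠ w → z ≠ w →
      Function.Injective ![x, y, z, w] :=
    fun x y z w h1 h2 h3 h4 h5 h6 i j hij => by
      fin_cases i <;> fin_cases j <;> simp_all [eq_comm]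
  obtain ⟨g, hg⟩ := exists_perm_comp_eq (hi a b c d hab hac had hbc hbd hcd)
    (hi e f u v hef heu hev hfu hfv huv)
  exact ⟨g, hg 0, hg 1, hg 2, hg 3⟩

-- Cuts and links indexed by arbitrary points

namespace PartitionGenerators

variable {k : ℕ} {B : Type} [Monoid B] (G : PartitionGenerators k B)

/-- The generator that cuts off a point. -/
def pt (i : Fin k) : B := G.p i

theorem W_induction {motive : Equiv.Perm (Fin k) → Prop} (one : motive 1)
    (mul : ∀ i g, i + 1 < k → motive g → motive (adjSwap k i * g)) (g : Equiv.Perm (Fin k)) :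
    motive g := by
  have hg := mem_closure_adjSwap k le_rfl g fun j h => by omega
  induction hg using Submonoid.closure_induction_left with
  | one => exact one
  | mul_left x hx y hy ih =>
    obtain ⟨i, hi, rfl⟩ := hx
    exact mul i y hi ih

theorem W_mul_pt (g : Equiv.Perm (Fin k)) (j : Fin k) :
    G.W g * G.pt j = G.pt (g j) * G.W g := by
  induction g using W_induction with
  | one => simp
  | mul i g hi ih =>
    rw [map_mul, mul_assoc, ih, Equiv.Perm.mul_apply, ← mul_assoc, ← mul_assoc]
    congr 1
    rw [G.W_adjSwap hi, pt, pt, coe_adjSwap hi]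
    split_ifs with h1 h2
    · rw [h1, G.s_mul_p i hi]
    · rw [h2]
      have h := G.s_mul_p i hi
      have hs := G.s_mul_s i hi
      -- The relation is given only in the direction from p_i to p_{i+1}; the reverse follows
      -- because s_i is an involution.
      calc G.s i * G.p (i + 1) = G.s i * (G.p (i + 1) * G.s i) * G.s i := by
            rw [mul_assoc, mul_assoc, hs, mul_one]
        _ = G.p i * G.s i := by rw [← h, ← mul_assoc, hs, one_mul]
    · exact (G.s_comm_p i _ hi (g j).2 h1 h2).eq

theorem z_comm_W (g : Equiv.Perm (Fin k)) : Commute G.z (G.W g) := by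
  induction g using W_induction with
  | one => simp
  | mul i g hi ih =>
    rw [map_mul, G.W_adjSwap hi]
    exact (G.z_comm_s i hi).mul_right ih

/-- The conjugate by `g` of the last generator `q`. -/
def linkAux (g : Equiv.Perm (Fin k)) : B := G.W g * G.q (k - 2) * G.W g⁻¹

/-- Two permutations with the same values at the last two points differ by one fixing both points.
That is a product of adjacent transpositions far from these points, and each commutes with the last
q. Interchanging the two values costs the last transposition, which q absorbs. The last pair is used
because its pointwise stabilizer is generated by an initial run of adjacent transpositions. -/
theorem linkAux_eq {g h : Equiv.Perm (Fin k)} {a b : Fin k} (ha : (a : ℕ) = k - 2)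
    (hb : (b : ℕ) = k - 1) (hab : a ≠ b) (e : g a = h a ∧ g b = h b ∨ g a = h b ∧ g b = h a) :
    G.linkAux g = G.linkAux h := by
  have hk : k - 2 + 1 < k := by
    have := a.2
    have h' : (a : ℕ) ≠ b := fun h => hab (Fin.ext h)
    omega
  have main : ∀ u : Equiv.Perm (Fin k), u a = a → u b = b →
      G.W u * G.q (k - 2) = G.q (k - 2) * G.W u := by
    intro u hua hub
    have hu := mem_closure_adjSwap (k - 2) (by omega) u fun j hj => by
      rcases (show (j : ℕ) = a ∨ (j : ℕ) = b by omega) with h' | h'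
      · rw [Fin.ext h', hua]
      · rw [Fin.ext h', hub]
    clear hua hub
    induction hu using Submonoid.closure_induction_left with
    | one => simp
    | mul_left x hx y hy ih =>
      obtain ⟨i, hi, rfl⟩ := hx
      rw [map_mul, mul_assoc, ih, ← mul_assoc, G.W_adjSwap (by omega),
        (G.s_comm_q i (k - 2) (by omega) hk (by omega)).eq, mul_assoc]
  have fixed : ∀ g h : Equiv.Perm (Fin k), g a = h a → g b = h b → G.linkAux g = G.linkAux h := by
    intro g h hga hgb
    have h1 := main (h⁻¹ * g) (by simp [hga]) (by simp [hgb])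
    have h2 : G.W g = G.W h * G.W (h⁻¹ * g) := by rw [← map_mul, mul_inv_cancel_left]
    rw [linkAux, linkAux, h2, mul_assoc (G.W h), h1, mul_assoc, mul_assoc, ← map_mul G.W,
      mul_inv_cancel_right, mul_assoc]
  rcases e with ⟨e1, e2⟩ | ⟨e1, e2⟩
  · exact fixed g h e1 e2
  · have ht : ∀ j, adjSwap k (k - 2) j = if j = a then b else if j = b then a else j := by
      intro j
      apply Fin.ext
      rw [coe_adjSwap hk]
      simp only [Fin.ext_iff]
      split_ifs <;> omega
    have h1 : G.linkAux (h * adjSwap k (k - 2)) = G.linkAux h := by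
      rw [linkAux, linkAux, mul_inv_rev, inv_eq_of_mul_eq_one_right (adjSwap_mul_self k (k - 2)),
        map_mul, map_mul, G.W_adjSwap hk, mul_assoc (G.W h), G.s_mul_q _ hk,
        mul_assoc, ← mul_assoc (G.q _), G.q_mul_s _ hk, mul_assoc]
    rw [← h1]
    refine fixed _ _ ?_ ?_
    · rw [e1, Equiv.Perm.mul_apply, ht, if_pos rfl]
    · rw [e2, Equiv.Perm.mul_apply, ht, if_neg hab.symm, if_pos rfl]

open Classical in
/-- The generator that links two points; it is `1` for equal points. -/
def link (i j : Fin k) : B :=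
  if h : ∃ g : Equiv.Perm (Fin k), ∃ a b : Fin k,
    (a : ℕ) = k - 2 ∧ (b : ℕ) = k - 1 ∧ a ≠ b ∧ g a = i ∧ g b = j then G.linkAux h.choose else 1

theorem link_self (i : Fin k) : G.link i i = 1 := by
  rw [link, dif_neg]
  rintro ⟨g, a, b, -, -, h, h1, h2⟩
  exact h (g.injective (h1.trans h2.symm))

theorem link_eq_linkAux {g : Equiv.Perm (Fin k)} {a b : Fin k} (ha : (a : ℕ) = k - 2)
    (hb : (b : ℕ) = k - 1) (hab : a ≠ b) : G.link (g a) (g b) = G.linkAux g := by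
  have h : ∃ g' : Equiv.Perm (Fin k), ∃ a' b' : Fin k,
    (a' : ℕ) = k - 2 ∧ (b' : ℕ) = k - 1 ∧ a' ≠ b' ∧ g' a' = g a ∧ g' b' = g b :=
    ⟨g, a, b, ha, hb, hab, rfl, rfl⟩
  rw [link, dif_pos h]
  obtain ⟨a', b', ha', hb', -, e1, e2⟩ := h.choose_spec
  rw [show a' = a from Fin.ext (ha'.trans ha.symm)] at e1
  rw [show b' = b from Fin.ext (hb'.trans hb.symm)] at e2
  exact G.linkAux_eq ha hb hab (Or.inl ⟨e1, e2⟩)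

theorem exists_standard {i j : Fin k} (h : i ≠ j) : ∃ (g : Equiv.Perm (Fin k)) (a b : Fin k),
    (a : ℕ) = k - 2 ∧ (b : ℕ) = k - 1 ∧ a ≠ b ∧ g a = i ∧ g b = j := by
  have h' : (i : ℕ) ≠ j := fun h' => h (Fin.ext h')
  have hab : (⟨k - 2, by omega⟩ : Fin k) ≠ ⟨k - 1, by omega⟩ := by
    rw [Ne, Fin.mk.injEq]; omega
  obtain ⟨g, h1, h2⟩ := exists_perm_pair hab h
  exact ⟨g, _, _, rfl, rfl, hab, h1, h2⟩

theorem link_symm (i j : Fin k) : G.link i j = G.link j i := by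
  by_cases hij : i = j
  · rw [hij]
  obtain ⟨g, a, b, ha, hb, hab, rfl, rfl⟩ := exists_standard hij
  obtain ⟨h, a', b', ha', hb', -, e1, e2⟩ := exists_standard (Ne.symm hij)
  obtain rfl : a' = a := Fin.ext (ha'.trans ha.symm)
  obtain rfl : b' = b := Fin.ext (hb'.trans hb.symm)
  rw [G.link_eq_linkAux ha hb hab, ← e1, ← e2, G.link_eq_linkAux ha hb hab]
  exact G.linkAux_eq ha hb hab (Or.inr ⟨e2.symm, e1.symm⟩)

theorem W_mul_link (g : Equiv.Perm (Fin k)) (i j : Fin k) :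
    G.W g * G.link i j = G.link (g i) (g j) * G.W g := by
  by_cases hij : i = j
  · rw [hij, link_self, link_self, mul_one, one_mul]
  obtain ⟨h, a, b, ha, hb, hab, rfl, rfl⟩ := exists_standard hij
  rw [← Equiv.Perm.mul_apply, ← Equiv.Perm.mul_apply, G.link_eq_linkAux ha hb hab,
    G.link_eq_linkAux ha hb hab, linkAux, linkAux, map_mul, mul_assoc, mul_inv_rev]
  rw [map_mul]
  simp only [mul_assoc, W_inv_mul, mul_one]

/-- Descending from the last pair, the relation between neighbouring q's shows that s_{i+1} s_i
conjugates q_{i+1} into q_i. -/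
theorem link_adj_aux (n i : ℕ) (h : i + 2 + n = k) : ∃ (g : Equiv.Perm (Fin k)),
    G.linkAux g = G.q i ∧ g ⟨k - 2, by omega⟩ = ⟨i, by omega⟩ ∧
      g ⟨k - 1, by omega⟩ = ⟨i + 1, by omega⟩ := by
  induction n generalizing i with
  | zero =>
    refine ⟨1, ?_, Fin.ext ?_, Fin.ext ?_⟩
    · rw [linkAux, inv_one, map_one, one_mul, mul_one, show k - 2 = i by omega]
    · change k - 2 = i; omega
    · change k - 1 = i + 1; omega
  | succ n ih =>
    obtain ⟨g, h1, h2, h3⟩ := ih (i + 1) (by omega)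
    refine ⟨adjSwap k (i + 1) * (adjSwap k i * g), ?_, ?_, ?_⟩
    · have e : G.linkAux (adjSwap k (i + 1) * (adjSwap k i * g))
          = G.s (i + 1) * (G.s i * G.linkAux g * G.s i) * G.s (i + 1) := by
        simp only [linkAux, mul_inv_rev, map_mul,
          inv_eq_of_mul_eq_one_right (adjSwap_mul_self k _),
          G.W_adjSwap (show i + 1 + 1 < k by omega), G.W_adjSwap (show i + 1 < k by omega),
          mul_assoc]
      rw [e, h1, ← G.s_q_s i (by omega)]
      have hs := G.s_mul_s (i + 1) (by omega)
      rw [← mul_assoc, ← mul_assoc, hs, one_mul, mul_assoc, hs, mul_one]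
    · simp only [Equiv.Perm.mul_apply, h2]
      apply Fin.ext
      rw [coe_adjSwap (by omega), coe_adjSwap (by omega)]
      simp only
      split_ifs <;> omega
    · simp only [Equiv.Perm.mul_apply, h3]
      apply Fin.ext
      rw [coe_adjSwap (by omega), coe_adjSwap (by omega)]
      simp only
      split_ifs <;> omega

theorem link_adj {i : ℕ} (h : i + 1 < k) : G.link ⟨i, by omega⟩ ⟨i + 1, h⟩ = G.q i := by
  obtain ⟨g, h1, h2, h3⟩ := G.link_adj_aux (k - 2 - i) i (by omega)
  rw [← h1, ← h2, ← h3]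
  refine G.link_eq_linkAux rfl rfl ?_
  rw [Ne, Fin.mk.injEq]; omega

/-! ### Relations at arbitrary points -/

theorem pt_conj (g : Equiv.Perm (Fin k)) (i : Fin k) : G.pt (g i) = G.W g * G.pt i * G.W g⁻¹ := by
  rw [W_mul_pt, mul_assoc, W_mul_inv, mul_one]

theorem link_conj (g : Equiv.Perm (Fin k)) (i j : Fin k) :
    G.link (g i) (g j) = G.W g * G.link i j * G.W g⁻¹ := by
  rw [W_mul_link, mul_assoc, W_mul_inv, mul_one]

/-- Conjugation, as a multiplicative map. -/
def conj (g : Equiv.Perm (Fin k)) : B →* B where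
  toFun x := G.W g * x * G.W g⁻¹
  map_one' := by rw [mul_one, W_mul_inv]
  map_mul' x y := by
    have h : ∀ u, G.W g⁻¹ * (G.W g * u) = u := fun u => by rw [← mul_assoc, W_inv_mul, one_mul]
    simp only [mul_assoc, h]

theorem conj_pt (g : Equiv.Perm (Fin k)) (i : Fin k) : G.conj g (G.pt i) = G.pt (g i) :=
  (G.pt_conj g i).symm

theorem conj_link (g : Equiv.Perm (Fin k)) (i j : Fin k) :
    G.conj g (G.link i j) = G.link (g i) (g j) :=
  (G.link_conj g i j).symm

theorem conj_W (g h : Equiv.Perm (Fin k)) : G.conj g (G.W h) = G.W (g * h * g⁻¹) := by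
  rw [map_mul, map_mul]; rfl

end PartitionGenerators

namespace PartitionGenerators

variable {k : ℕ} {B : Type} [Monoid B] (G : PartitionGenerators k B)

theorem two_le_of_ne {i j : Fin k} (h : i ≠ j) : 0 + 1 < k := by
  have : (i : ℕ) ≠ j := fun h' => h (Fin.ext h')
  omega

theorem three_le_of_ne {i j l : Fin k} (hij : i ≠ j) (hil : i ≠ l) (hjl : j ≠ l) :
    0 + 1 + 1 < k := by
  have h1 : (i : ℕ) ≠ j := fun h' => hij (Fin.ext h')
  have h2 : (i : ℕ) ≠ l := fun h' => hil (Fin.ext h')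
  have h3 : (j : ℕ) ≠ l := fun h' => hjl (Fin.ext h')
  omega

/-- Relations between arbitrary points are conjugates of the given relations at the first few
points. -/
theorem exists_perm_zero_one {i j : Fin k} (h : i ≠ j) (hk : 0 + 1 < k) :
    ∃ g : Equiv.Perm (Fin k), g ⟨0, by omega⟩ = i ∧ g ⟨0 + 1, hk⟩ = j :=
  exists_perm_pair (by rw [Ne, Fin.mk.injEq]; omega) h

theorem exists_perm_zero_one_two {i j l : Fin k} (hij : i ≠ j) (hil : i ≠ l) (hjl : j ≠ l)
    (hk : 0 + 1 + 1 < k) : ∃ g : Equiv.Perm (Fin k),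
      g ⟨0, by omega⟩ = i ∧ g ⟨0 + 1, by omega⟩ = j ∧ g ⟨0 + 1 + 1, hk⟩ = l :=
  exists_perm_triple (by rw [Ne, Fin.mk.injEq]; omega) (by rw [Ne, Fin.mk.injEq]; omega)
    (by rw [Ne, Fin.mk.injEq]; omega) hij hil hjl

theorem z_comm_link (i j : Fin k) : Commute G.z (G.link i j) := by
  by_cases h : i = j
  · rw [h, link_self]; exact Commute.one_right _
  have hk := two_le_of_ne h
  obtain ⟨g, rfl, rfl⟩ := exists_perm_zero_one h hk
  rw [link_conj, G.link_adj hk]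
  exact ((G.z_comm_W g).mul_right (G.z_comm_q 0 hk)).mul_right (G.z_comm_W _)

theorem pt_comm (i j : Fin k) : Commute (G.pt i) (G.pt j) := G.p_comm i j i.2 j.2

theorem pt_mul_pt (i : Fin k) : G.pt i * G.pt i = G.z * G.pt i := G.p_mul_p i i.2

theorem link_mul_self (i j : Fin k) : G.link i j * G.link i j = G.link i j := by
  by_cases h : i = j
  · rw [h, link_self, one_mul]
  have hk := two_le_of_ne h
  obtain ⟨g, rfl, rfl⟩ := exists_perm_zero_one h hk
  rw [← conj_link, ← map_mul, G.link_adj hk, G.q_mul_q 0 hk]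

theorem pt_link_pt {i j : Fin k} (h : i ≠ j) : G.pt i * G.link i j * G.pt i = G.pt i := by
  have hk := two_le_of_ne h
  obtain ⟨g, rfl, rfl⟩ := exists_perm_zero_one h hk
  rw [← conj_link, ← conj_pt, ← map_mul, ← map_mul, G.link_adj hk, pt, G.p_q_p 0 hk]

theorem link_pt_link {i j : Fin k} (h : i ≠ j) :
    G.link i j * G.pt i * G.link i j = G.link i j := by
  have hk := two_le_of_ne h
  obtain ⟨g, rfl, rfl⟩ := exists_perm_zero_one h hk
  rw [← conj_link, ← conj_pt, ← map_mul, ← map_mul, G.link_adj hk, pt, G.q_p_q 0 hk]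

theorem conj_W_swap (g : Equiv.Perm (Fin k)) (i j : Fin k) :
    G.W (Equiv.swap (g i) (g j)) = G.conj g (G.W (Equiv.swap i j)) := by
  rw [conj_W, Equiv.swap_apply_apply]

theorem W_swap_adj {i : ℕ} (h : i + 1 < k) :
    G.W (Equiv.swap ⟨i, by omega⟩ ⟨i + 1, h⟩) = G.s i := by
  rw [← G.W_adjSwap h, adjSwap, dif_pos h]

theorem W_swap_mul_link (i j : Fin k) : G.W (Equiv.swap i j) * G.link i j = G.link i j := by
  by_cases h : i = j
  · rw [h, link_self, Equiv.swap_self, mul_one]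
    exact map_one _
  have hk := two_le_of_ne h
  obtain ⟨g, rfl, rfl⟩ := exists_perm_zero_one h hk
  rw [← conj_link, conj_W_swap, ← map_mul, G.link_adj hk, G.W_swap_adj hk, G.s_mul_q 0 hk]

theorem link_mul_W_swap (i j : Fin k) : G.link i j * G.W (Equiv.swap i j) = G.link i j := by
  have h := G.W_mul_link (Equiv.swap i j) i j
  rw [Equiv.swap_apply_left, Equiv.swap_apply_right, W_swap_mul_link, G.link_symm j i] at h
  exact h.symm

theorem W_swap_mul_pt_mul_pt (i j : Fin k) :
    G.W (Equiv.swap i j) * (G.pt i * G.pt j) = G.pt i * G.pt j := by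
  by_cases h : i = j
  · rw [h, Equiv.swap_self]
    exact (congrArg (· * _) (map_one G.W)).trans (one_mul _)
  have hk := two_le_of_ne h
  obtain ⟨g, rfl, rfl⟩ := exists_perm_zero_one h hk
  rw [← conj_pt, ← conj_pt, conj_W_swap, ← map_mul, ← map_mul, G.W_swap_adj hk]
  exact congrArg _ (G.s_mul_p_mul_p 0 hk)

theorem pt_mul_pt_mul_W_swap (i j : Fin k) :
    G.pt i * G.pt j * G.W (Equiv.swap i j) = G.pt i * G.pt j := by
  have h : G.W (Equiv.swap i j) * (G.pt i * G.pt j) = G.pt j * G.pt i * G.W (Equiv.swap i j) := by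
    rw [← mul_assoc, W_mul_pt, mul_assoc, W_mul_pt, Equiv.swap_apply_left, Equiv.swap_apply_right,
      mul_assoc]
  rw [(G.pt_comm i j).eq, ← h, W_swap_mul_pt_mul_pt, (G.pt_comm i j).eq]

theorem pt_comm_link {i j l : Fin k} (hi : l ≠ i) (hj : l ≠ j) :
    Commute (G.pt l) (G.link i j) := by
  by_cases h : i = j
  · rw [h, link_self]; exact Commute.one_right _
  have hk := three_le_of_ne h hi.symm hj.symm
  obtain ⟨g, rfl, rfl, rfl⟩ := exists_perm_zero_one_two h hi.symm hj.symm hk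
  rw [← conj_link, ← conj_pt]
  refine Commute.map ?_ _
  rw [G.link_adj (show 0 + 1 < k by omega)]
  exact G.p_comm_q (0 + 1 + 1) 0 hk (by omega) (by omega) (by omega)

theorem link_comm_of_ne {i j l : Fin k} (hij : i ≠ j) (hil : i ≠ l) (hjl : j ≠ l) :
    Commute (G.link i j) (G.link j l) := by
  have hk := three_le_of_ne hij hil hjl
  obtain ⟨g, rfl, rfl, rfl⟩ := exists_perm_zero_one_two hij hil hjl hk
  rw [← conj_link, ← conj_link]
  refine Commute.map ?_ _
  rw [G.link_adj (show 0 + 1 < k by omega), G.link_adj hk]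
  exact G.q_comm _ _ (by omega) hk

theorem link_comm (i j l m : Fin k) : Commute (G.link i j) (G.link l m) := by
  by_cases hij : i = j
  · rw [hij, link_self]; exact Commute.one_left _
  by_cases hlm : l = m
  · rw [hlm, link_self]; exact Commute.one_right _
  by_cases hil : i = l
  · subst hil
    by_cases hjm : j = m
    · rw [hjm]
    · rw [G.link_symm i j]
      exact G.link_comm_of_ne (Ne.symm hij) hjm hlm
  by_cases him : i = m
  · subst him
    by_cases hjl : j = l
    · rw [hjl, G.link_symm i l]
    · rw [G.link_symm i j, G.link_symm l i]
      exact G.link_comm_of_ne (Ne.symm hij) hjl hil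
  by_cases hjl : j = l
  · subst hjl
    exact G.link_comm_of_ne hij him hlm
  by_cases hjm : j = m
  · subst hjm
    rw [G.link_symm l j]
    exact G.link_comm_of_ne hij hil hjl
  -- With four distinct points the two links are conjugate, simultaneously, to q_0 and q_2.
  have hk : 0 + 1 + 1 + 1 < k := by
    simp only [Fin.ext_iff] at hij hlm hil him hjl hjm
    omega
  obtain ⟨g, rfl, rfl, rfl, rfl⟩ := exists_perm_quadruple
    (show (⟨0, by omega⟩ : Fin k) ≠ ⟨0 + 1, by omega⟩ by rw [Ne, Fin.mk.injEq]; omega)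
    (show (⟨0, by omega⟩ : Fin k) ≠ ⟨0 + 1 + 1, by omega⟩ by rw [Ne, Fin.mk.injEq]; omega)
    (show (⟨0, by omega⟩ : Fin k) ≠ ⟨0 + 1 + 1 + 1, hk⟩ by rw [Ne, Fin.mk.injEq]; omega)
    (by rw [Ne, Fin.mk.injEq]; omega) (by rw [Ne, Fin.mk.injEq]; omega)
    (by rw [Ne, Fin.mk.injEq]; omega) hij hil him hjl hjm hlm
  rw [← conj_link, ← conj_link]
  refine Commute.map ?_ _
  rw [G.link_adj (show 0 + 1 < k by omega), G.link_adj hk]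
  exact G.q_comm _ _ (by omega) hk

/-- The transposition (i j) is absorbed by the link of i and j and carries the link of j and l to
that of i and l. This is what makes linking transitive. -/
theorem link_mul_link (i j l : Fin k) :
    G.link i j * G.link j l = G.link i j * G.link i l := by
  by_cases hij : i = j
  · rw [hij]
  by_cases hjl : j = l
  · rw [hjl, link_self, mul_one, link_mul_self]
  by_cases hil : i = l
  · rw [hil, link_self, mul_one, G.link_symm l j, link_mul_self]
  have h := G.W_mul_link (Equiv.swap i j) j l
  rw [Equiv.swap_apply_right, Equiv.swap_apply_of_ne_of_ne (Ne.symm hil) (Ne.symm hjl)] at h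
  calc G.link i j * G.link j l = G.link i j * G.W (Equiv.swap i j) * G.link j l := by
        rw [link_mul_W_swap]
    _ = G.link i l * (G.link i j * G.W (Equiv.swap i j)) := by
        rw [mul_assoc, h, ← mul_assoc, (G.link_comm i j i l).eq, mul_assoc]
    _ = G.link i j * G.link i l := by rw [link_mul_W_swap, (G.link_comm i j i l).eq]

/-! ### Linking along an equivalence relation -/

section Link

open Classical

/-- The product of the links along an equivalence relation. -/
def linkAll (π : Setoid (Fin k)) : B :=
  (Finset.univ.filter fun x : Fin k × Fin k => π x.1 x.2).noncommProd
    (fun x => G.link x.1 x.2) fun _ _ _ _ _ => G.link_comm _ _ _ _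

theorem commute_linkAll {π : Setoid (Fin k)} {y : B}
    (h : ∀ a b, π a b → Commute y (G.link a b)) : Commute y (G.linkAll π) :=
  Finset.noncommProd_commute _ _ _ _ fun x hx => h _ _ (Finset.mem_filter.1 hx).2

theorem mul_linkAll_of_forall {π : Setoid (Fin k)} {y : B}
    (h : ∀ a b, π a b → y * G.link a b = y) : y * G.linkAll π = y := by
  refine Finset.noncommProd_induction _ _ _ (fun x => y * x = y) ?_ (mul_one y) ?_
  · intro a b ha hb
    rw [← mul_assoc, ha, hb]
  · intro x hx
    exact h _ _ (Finset.mem_filter.1 hx).2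

theorem linkAll_mul_of_forall {π : Setoid (Fin k)} {y : B}
    (h : ∀ a b, π a b → G.link a b * y = y) : G.linkAll π * y = y := by
  refine Finset.noncommProd_induction _ _ _ (fun x => x * y = y) ?_ (one_mul y) ?_
  · intro a b ha hb
    rw [mul_assoc, hb, ha]
  · intro x hx
    exact h _ _ (Finset.mem_filter.1 hx).2

theorem link_comm_linkAll (π : Setoid (Fin k)) (a b : Fin k) :
    Commute (G.link a b) (G.linkAll π) :=
  G.commute_linkAll fun _ _ _ => G.link_comm _ _ _ _

theorem link_mul_linkAll {π : Setoid (Fin k)} {a b : Fin k} (h : π a b) :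
    G.link a b * G.linkAll π = G.linkAll π := by
  have hm : (a, b) ∈ Finset.univ.filter fun x : Fin k × Fin k => π x.1 x.2 :=
    Finset.mem_filter.2 ⟨Finset.mem_univ _, h⟩
  have e := Finset.mul_noncommProd_erase _ hm (fun x => G.link x.1 x.2)
    fun _ _ _ _ _ => G.link_comm _ _ _ _
  rw [linkAll]
  refine (congrArg (G.link a b * ·) e.symm).trans (Eq.trans ?_ e)
  exact (mul_assoc _ _ _).symm.trans (congrArg (· * _) (G.link_mul_self a b))

theorem linkAll_mul_link {π : Setoid (Fin k)} {a b : Fin k} (h : π a b) :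
    G.linkAll π * G.link a b = G.linkAll π := by
  rw [← (G.link_comm_linkAll π a b).eq, link_mul_linkAll _ h]

theorem linkAll_mul_linkAll_of_le {π ρ : Setoid (Fin k)} (h : π ≤ ρ) :
    G.linkAll π * G.linkAll ρ = G.linkAll ρ :=
  G.linkAll_mul_of_forall fun _ _ hab => G.link_mul_linkAll (h hab)

theorem linkAll_mul_linkAll_of_ge {π ρ : Setoid (Fin k)} (h : π ≤ ρ) :
    G.linkAll ρ * G.linkAll π = G.linkAll ρ :=
  G.mul_linkAll_of_forall fun _ _ hab => G.linkAll_mul_link (h hab)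

/-- The points that `x` already links. -/
def leftLinks (x : B) : Setoid (Fin k) where
  r a b := G.link a b * x = x
  iseqv :=
    { refl := fun a => by rw [link_self, one_mul]
      symm := fun {a b} h => by rwa [link_symm]
      trans := fun {a b c} h h' => by
        -- In the presence of the link of a and b, the links of a and c and of b and c have the same
        -- effect.
        have e : G.link a c * (G.link a b * x) = G.link a b * (G.link b c * x) := by
          rw [← mul_assoc, (G.link_comm a c a b).eq, ← link_mul_link, mul_assoc]
        rwa [h', h] at e }

/-- The points that `x` already links on the right. -/
def rightLinks (x : B) : Setoid (Fin k) where
  r a b := x * G.link a b = x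
  iseqv :=
    { refl := fun a => by rw [link_self, mul_one]
      symm := fun {a b} h => by rwa [link_symm]
      trans := fun {a b c} h h' => by
        rw [← h, mul_assoc, ← link_mul_link, ← mul_assoc, h, h'] }

theorem linkAll_leftLinks (x : B) : G.linkAll (G.leftLinks x) * x = x :=
  G.linkAll_mul_of_forall fun _ _ h => h

/-- The new relation is read off from the element itself as everything it absorbs, instead of being
described as a join. In a general monoid it may be coarser than the join, which does no harm. -/
theorem link_mul_linkAll_eq (π : Setoid (Fin k)) (a b : Fin k) :
    G.link a b * G.linkAll π = G.linkAll (G.leftLinks (G.link a b * G.linkAll π)) := by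
  have hab : G.leftLinks (G.link a b * G.linkAll π) a b := by
    change _ * (_ * _) = _
    rw [← mul_assoc, link_mul_self]
  have hπ : π ≤ G.leftLinks (G.link a b * G.linkAll π) := fun {c d} h => by
    change _ * (_ * _) = _
    rw [← mul_assoc, (G.link_comm c d a b).eq, mul_assoc, G.link_mul_linkAll h]
  have h := G.linkAll_leftLinks (G.link a b * G.linkAll π)
  rwa [← mul_assoc, G.linkAll_mul_link hab, G.linkAll_mul_linkAll_of_ge hπ, eq_comm] at h

/-- The equivalence relation in which the class of `i` becomes `{i}`. -/
def isolate (π : Setoid (Fin k)) (i : Fin k) : Setoid (Fin k) where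
  r a b := a = b ∨ π a b ∧ a ≠ i ∧ b ≠ i
  iseqv :=
    { refl := fun a => Or.inl rfl
      symm := by
        rintro a b (h | ⟨h, h1, h2⟩)
        · exact Or.inl h.symm
        · exact Or.inr ⟨π.symm' h, h2, h1⟩
      trans := by
        rintro a b c (rfl | ⟨h, h1, h2⟩) (rfl | ⟨h', h1', h2'⟩)
        · exact Or.inl rfl
        · exact Or.inr ⟨h', h1', h2'⟩
        · exact Or.inr ⟨h, h1, h2⟩
        · exact Or.inr ⟨π.trans' h h', h1, h2'⟩ }

theorem pt_comm_linkAll {π : Setoid (Fin k)} {i : Fin k} (h : ∀ a, π i a → a = i) :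
    Commute (G.pt i) (G.linkAll π) := by
  refine G.commute_linkAll fun a b hab => ?_
  by_cases hi : a = i ∨ b = i
  · have e : a = b := by
      rcases hi with rfl | rfl
      · exact (h b hab).symm
      · exact h a (π.symm' hab)
    rw [e, link_self]; exact Commute.one_right _
  · exact G.pt_comm_link (fun h => hi (Or.inl h.symm)) fun h => hi (Or.inr h.symm)

theorem pt_comm_linkAll_isolate (π : Setoid (Fin k)) (i : Fin k) :
    Commute (G.pt i) (G.linkAll (isolate π i)) := by
  refine G.pt_comm_linkAll ?_
  rintro a (rfl | ⟨-, h, -⟩)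
  · rfl
  · exact absurd rfl h

/-- One link from i to another point of its class restores the whole class: by transitivity the
product absorbs every link of π. -/
theorem link_mul_linkAll_isolate {π : Setoid (Fin k)} {i j : Fin k} (hij : π i j) (hne : j ≠ i) :
    G.link i j * G.linkAll (isolate π i) = G.linkAll π := by
  set x := G.link i j * G.linkAll (isolate π i) with hx
  have hL : G.leftLinks x i j := by
    change _ * x = x
    rw [hx, ← mul_assoc, link_mul_self]
  have hL' : ∀ a b, a ≠ i → b ≠ i → π a b → G.leftLinks x a b := fun a b ha hb h => by
    change _ * x = x
    rw [hx, ← mul_assoc, (G.link_comm a b i j).eq, mul_assoc,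
      G.link_mul_linkAll (π := isolate π i) (Or.inr ⟨h, ha, hb⟩)]
  have hi : ∀ b, π i b → G.leftLinks x i b := fun b h => by
    by_cases hb : b = i
    · rw [hb]
    · exact Setoid.trans' _ hL (hL' j b hne hb (π.trans' (π.symm' hij) h))
  have h1 : G.linkAll π * x = x := G.linkAll_mul_of_forall fun a b hab => by
    by_cases ha : a = i
    · exact hi b (ha ▸ hab) |> fun h => by rw [ha]; exact h
    · by_cases hb : b = i
      · rw [hb]
        exact Setoid.symm' _ (hi a (π.symm' (hb ▸ hab)))
      · exact hL' a b ha hb hab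
  have h2 : isolate π i ≤ π := by
    rintro a b (rfl | ⟨h, -, -⟩)
    · exact π.refl' _
    · exact h
  rw [← h1, hx, ← mul_assoc, G.linkAll_mul_link hij, G.linkAll_mul_linkAll_of_ge h2]

/-- The conjugate absorbs the links of the transported relation on the left, and the transported
product absorbs the original links on the right; together they force equality. -/
theorem W_mul_linkAll (g : Equiv.Perm (Fin k)) (π : Setoid (Fin k)) :
    G.W g * G.linkAll π = G.linkAll (Setoid.comap g.symm π) * G.W g := by
  have h1 : G.W g * G.linkAll π * G.W g⁻¹
      = G.linkAll (Setoid.comap g.symm π) * (G.W g * G.linkAll π * G.W g⁻¹) := by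
    refine (G.linkAll_mul_of_forall fun a b hab => ?_).symm
    have := G.W_mul_link g (g.symm a) (g.symm b)
    rw [Equiv.apply_symm_apply, Equiv.apply_symm_apply] at this
    rw [← mul_assoc, ← mul_assoc, ← this, mul_assoc (G.W g),
      G.link_mul_linkAll (show π (g.symm a) (g.symm b) from hab)]
  have h2 : G.linkAll (Setoid.comap g.symm π) * G.W g
      = G.linkAll (Setoid.comap g.symm π) * G.W g * G.linkAll π := by
    refine (G.mul_linkAll_of_forall fun a b hab => ?_).symm
    rw [mul_assoc, W_mul_link, ← mul_assoc, linkAll_mul_link]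
    change π (g.symm (g a)) (g.symm (g b))
    rwa [Equiv.symm_apply_apply, Equiv.symm_apply_apply]
  rw [h2, mul_assoc]
  calc G.W g * G.linkAll π = G.W g * G.linkAll π * G.W g⁻¹ * G.W g := by
        rw [mul_assoc _ _ (G.W g), W_inv_mul, mul_one]
    _ = _ := by
        rw [h1, mul_assoc, mul_assoc (G.W g * _), W_inv_mul, mul_one]

end Link

/-! ### Cutting off a set of points -/

/-- The product of the cuts at the points of `C`. -/
def cutAll (C : Finset (Fin k)) : B :=
  C.noncommProd G.pt fun _ _ _ _ _ => G.pt_comm _ _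

theorem cutAll_insert {C : Finset (Fin k)} {i : Fin k} (h : i ∉ C) :
    G.cutAll (insert i C) = G.pt i * G.cutAll C :=
  Finset.noncommProd_insert_of_notMem _ _ _ _ h

theorem pt_mul_cutAll_erase {C : Finset (Fin k)} {i : Fin k} (h : i ∈ C) :
    G.pt i * G.cutAll (C.erase i) = G.cutAll C :=
  Finset.mul_noncommProd_erase _ h _ _

theorem commute_cutAll {C : Finset (Fin k)} {y : B} (h : ∀ i ∈ C, Commute y (G.pt i)) :
    Commute y (G.cutAll C) :=
  Finset.noncommProd_commute _ _ _ _ h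

theorem pt_comm_cutAll (C : Finset (Fin k)) (i : Fin k) : Commute (G.pt i) (G.cutAll C) :=
  G.commute_cutAll fun _ _ => G.pt_comm _ _

theorem pt_mul_cutAll {C : Finset (Fin k)} {i : Fin k} (h : i ∈ C) :
    G.pt i * G.cutAll C = G.z * G.cutAll C := by
  rw [← G.pt_mul_cutAll_erase h, ← mul_assoc, pt_mul_pt, mul_assoc]

theorem link_comm_cutAll {C : Finset (Fin k)} {a b : Fin k} (ha : a ∉ C) (hb : b ∉ C) :
    Commute (G.link a b) (G.cutAll C) :=
  G.commute_cutAll fun i hi => (G.pt_comm_link (i := a) (j := b) (l := i)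
    (fun h => ha (h ▸ hi)) fun h => hb (h ▸ hi)).symm

theorem W_mul_cutAll (g : Equiv.Perm (Fin k)) (C : Finset (Fin k)) :
    G.W g * G.cutAll C = G.cutAll (C.map g.toEmbedding) * G.W g := by
  induction C using Finset.induction_on with
  | empty =>
    have e : G.cutAll ∅ = 1 := Finset.noncommProd_empty _ _
    rw [Finset.map_empty, e, one_mul, mul_one]
  | insert a C h ih =>
    rw [cutAll_insert _ h, Finset.map_insert, cutAll_insert, ← mul_assoc, W_mul_pt, mul_assoc, ih,
      mul_assoc]
    · rfl
    · simpa using h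

theorem cutAll_mul_W_swap {C : Finset (Fin k)} {a b : Fin k} (ha : a ∈ C) (hb : b ∈ C) :
    G.cutAll C * G.W (Equiv.swap a b) = G.cutAll C := by
  by_cases hab : a = b
  · rw [hab, Equiv.swap_self]
    exact (congrArg (_ * ·) (map_one G.W)).trans (mul_one _)
  have e : G.cutAll C = G.cutAll ((C.erase a).erase b) * (G.pt a * G.pt b) := by
    rw [← (((G.pt_comm_cutAll _ a).mul_left (G.pt_comm_cutAll _ b))).eq, mul_assoc,
      G.pt_mul_cutAll_erase (Finset.mem_erase.2 ⟨Ne.symm hab, hb⟩), G.pt_mul_cutAll_erase ha]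
  rw [e, mul_assoc, pt_mul_pt_mul_W_swap]

/-- Permutations of the cut points are absorbed. -/
theorem cutAll_mul_W {C : Finset (Fin k)} {g : Equiv.Perm (Fin k)} (h : ∀ a ∉ C, g a = a) :
    G.cutAll C * G.W g = G.cutAll C := by
  classical
  obtain ⟨n, hn⟩ : ∃ n, g.support.card = n := ⟨_, rfl⟩
  induction n using Nat.strong_induction_on generalizing g with | _ n ih =>
  by_cases h1 : g = 1
  · rw [h1, map_one, mul_one]
  obtain ⟨a, ha⟩ : ∃ a, g a ≠ a := by
    by_contra hc
    push Not at hc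
    exact h1 (Equiv.ext hc)
  have haC : a ∈ C := by
    by_contra hc
    exact ha (h a hc)
  have hgaC : g a ∈ C := by
    by_contra hc
    exact ha (g.injective (h _ hc))
  -- The transposition is absorbed by the two cuts, and the remaining factor fixes a as well, so its
  -- support is smaller.
  have e : g = Equiv.swap a (g a) * (Equiv.swap a (g a) * g) := by
    rw [← mul_assoc, Equiv.swap_mul_self, one_mul]
  rw [e, map_mul, ← mul_assoc, G.cutAll_mul_W_swap haC hgaC]
  refine ih _ (hn ▸ Equiv.Perm.card_support_swap_mul ha) (fun b hb => ?_) rfl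
  rw [Equiv.Perm.mul_apply, h b hb, Equiv.swap_apply_of_ne_of_ne]
  · rintro rfl; exact hb haC
  · rintro rfl; exact hb hgaC

end PartitionGenerators

-- Factorizations of diagrams along uncut strands

/-- The data of a factorization `ε_top · cut · perm · ε_bot` of a diagram. -/
structure NormalData (k : ℕ) where
  top : Setoid (Fin k)
  cut : Finset (Fin k)
  perm : Equiv.Perm (Fin k)
  bot : Setoid (Fin k)

/-- The strand at `b` of the permutation is not cut and runs inside a block of `α`, and the
uncut strands meet all blocks that contain points of both rows. -/
structure IsFrame {k : ℕ} (α : Diagram k) (C : Finset (Fin k)) (w : Equiv.Perm (Fin k)) :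
    Prop where
  valid : ∀ b, w b ∉ C → α (Sum.inl (w b)) (Sum.inr b)
  cover : ∀ i j, α (Sum.inl i) (Sum.inr j) → ∃ b, w b ∉ C ∧ α (Sum.inl i) (Sum.inl (w b))

/-- The top row of a diagram. -/
abbrev topRow {k : ℕ} (α : Diagram k) : Setoid (Fin k) := Setoid.comap Sum.inl α

/-- The bottom row of a diagram. -/
abbrev botRow {k : ℕ} (α : Diagram k) : Setoid (Fin k) := Setoid.comap Sum.inr α

namespace NormalData

variable {k : ℕ} (d : NormalData k)

/-- Two equivalence relations that correspond along the uncut strands, glued along them. -/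
@[reducible] def glue (π ρ : Setoid (Fin k))
    (h : ∀ c d', d.perm c ∉ d.cut → d.perm d' ∉ d.cut → (π (d.perm c) (d.perm d') ↔ ρ c d')) :
    Diagram k where
  r := fun x y => match x, y with
    | Sum.inl a, Sum.inl b => π a b
    | Sum.inr a, Sum.inr b => ρ a b
    | Sum.inl a, Sum.inr b => ∃ c, d.perm c ∉ d.cut ∧ π a (d.perm c) ∧ ρ c b
    | Sum.inr a, Sum.inl b => ∃ c, d.perm c ∉ d.cut ∧ π b (d.perm c) ∧ ρ c a
  iseqv :=
    { refl := by
        rintro (a | a)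
        · exact π.refl' a
        · exact ρ.refl' a
      symm := by
        rintro (a | a) (b | b) h
        · exact π.symm' h
        · exact h
        · exact h
        · exact ρ.symm' h
      trans := by
        rintro (a | a) (b | b) (c | c) h1 h2
        · exact π.trans' h1 h2
        · obtain ⟨e, he, h3, h4⟩ := h2
          exact ⟨e, he, π.trans' h1 h3, h4⟩
        · obtain ⟨e, he, h3, h4⟩ := h1
          obtain ⟨e', he', h3', h4'⟩ := h2
          exact π.trans' h3 (π.trans' ((h e e' he he').2 (ρ.trans' h4 (ρ.symm' h4'))) (π.symm' h3'))
        · obtain ⟨e, he, h3, h4⟩ := h1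
          exact ⟨e, he, h3, ρ.trans' h4 h2⟩
        · obtain ⟨e, he, h3, h4⟩ := h1
          exact ⟨e, he, π.trans' (π.symm' h2) h3, h4⟩
        · obtain ⟨e, he, h3, h4⟩ := h1
          obtain ⟨e', he', h3', h4'⟩ := h2
          exact ρ.trans' (ρ.symm' h4) (ρ.trans' ((h e e' he he').1
            (π.trans' (π.symm' h3) h3')) h4')
        · obtain ⟨e, he, h3, h4⟩ := h2
          exact ⟨e, he, h3, ρ.trans' h4 (ρ.symm' h1)⟩
        · exact ρ.trans' h1 h2 }

/-- The diagram of the factorization. -/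
@[reducible] def diag : Diagram k :=
  sInf {γ | d.top ≤ topRow γ ∧ d.bot ≤ botRow γ ∧
    ∀ b, d.perm b ∉ d.cut → γ (Sum.inl (d.perm b)) (Sum.inr b)}

theorem diag_le {γ : Diagram k} (h1 : d.top ≤ topRow γ) (h2 : d.bot ≤ botRow γ)
    (h3 : ∀ b, d.perm b ∉ d.cut → γ (Sum.inl (d.perm b)) (Sum.inr b)) : d.diag ≤ γ :=
  sInf_le ⟨h1, h2, h3⟩

theorem top_le : d.top ≤ topRow d.diag := fun {_ _} h _ hγ => hγ.1 h

theorem bot_le : d.bot ≤ botRow d.diag := fun {_ _} h _ hγ => hγ.2.1 h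

theorem diag_strand (b : Fin k) (h : d.perm b ∉ d.cut) :
    d.diag (Sum.inl (d.perm b)) (Sum.inr b) := fun _ hγ => hγ.2.2 b h

theorem diag_le_glue {π ρ : Setoid (Fin k)}
    (h : ∀ c d', d.perm c ∉ d.cut → d.perm d' ∉ d.cut → (π (d.perm c) (d.perm d') ↔ ρ c d'))
    (h1 : d.top ≤ π) (h2 : d.bot ≤ ρ) : d.diag ≤ d.glue π ρ h :=
  d.diag_le (fun {_ _} hab => h1 hab) (fun {_ _} hab => h2 hab)
    fun b hb => ⟨b, hb, π.refl' _, ρ.refl' _⟩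

/-- The rows of the diagram correspond along the uncut strands. Gluing them there gives an
equivalence relation that contains the diagram, so any connection between the two rows runs through
an uncut strand. -/
theorem isFrame_diag : IsFrame d.diag d.cut d.perm where
  valid := d.diag_strand
  cover i j hij := by
    have h : ∀ c d', d.perm c ∉ d.cut → d.perm d' ∉ d.cut →
        (topRow d.diag (d.perm c) (d.perm d') ↔ botRow d.diag c d') := by
      intro a b ha hb
      have h1 := d.diag_strand a ha
      have h2 := d.diag_strand b hb
      exact ⟨fun h => d.diag.trans' (d.diag.symm' h1) (d.diag.trans' h h2),
        fun h => d.diag.trans' h1 (d.diag.trans' h (d.diag.symm' h2))⟩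
    obtain ⟨c, hc, h1, -⟩ := d.diag_le_glue h d.top_le d.bot_le hij
    exact ⟨c, hc, h1⟩

end NormalData

/-- A frame in which every block contains at most one uncut strand. -/
def IsReducedFrame {k : ℕ} (α : Diagram k) (C : Finset (Fin k)) (w : Equiv.Perm (Fin k)) : Prop :=
  IsFrame α C w ∧
    ∀ b b', w b ∉ C → w b' ∉ C → α (Sum.inl (w b)) (Sum.inl (w b')) → b = b'

/-- For each block meeting both rows choose one top point and one bottom point, let the permutation
join them, and cut all the other top points. -/
theorem exists_isReducedFrame {k : ℕ} (α : Diagram k) : ∃ C w, IsReducedFrame α C w := by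
  classical
  let A := {c : Quotient α // (∃ i, Quotient.mk α (Sum.inl i) = c) ∧
    ∃ j, Quotient.mk α (Sum.inr j) = c}
  let f : A → Fin k := fun c => c.2.1.choose
  let g : A → Fin k := fun c => c.2.2.choose
  have hf : ∀ c : A, Quotient.mk α (Sum.inl (f c)) = c := fun c => c.2.1.choose_spec
  have hg : ∀ c : A, Quotient.mk α (Sum.inr (g c)) = c := fun c => c.2.2.choose_spec
  have hfi : Function.Injective f := fun c c' h => Subtype.ext (by rw [← hf c, ← hf c', h])
  have hgi : Function.Injective g := fun c c' h => Subtype.ext (by rw [← hg c, ← hg c', h])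
  obtain ⟨w, hw⟩ := exists_perm_comp_eq hgi hfi
  have hC : ∀ i, i ∉ (Finset.univ.filter fun i => ¬∃ c, f c = i) ↔ ∃ c, f c = i := by
    intro i; simp
  have hb : ∀ b, (∃ c, f c = w b) → ∃ c, f c = w b ∧ g c = b := by
    rintro b ⟨c, hc⟩
    exact ⟨c, hc, w.injective (by rw [hw, hc])⟩
  refine ⟨Finset.univ.filter fun i => ¬∃ c, f c = i, w, ⟨fun b h => ?_, fun i j hij => ?_⟩,
    fun b b' h h' e => ?_⟩
  · rw [hC] at h
    obtain ⟨c, h1, h2⟩ := hb b h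
    rw [← h1, ← h2]
    exact Quotient.exact ((hf c).trans (hg c).symm)
  · let c : A := ⟨Quotient.mk α (Sum.inl i), ⟨i, rfl⟩, ⟨j, (Quotient.sound hij).symm⟩⟩
    refine ⟨g c, ?_, ?_⟩
    · rw [hC, hw]
      exact ⟨c, rfl⟩
    · rw [hw]
      exact Quotient.exact (hf c).symm
  · rw [hC] at h h'
    obtain ⟨c, h1, h2⟩ := hb b h
    obtain ⟨c', h1', h2'⟩ := hb b' h'
    rw [← h2, ← h2']
    congr 1
    apply Subtype.ext
    rw [← hf c, ← hf c', h1, h1']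
    exact Quotient.sound e

/-- The strand at b still represents the block of the strand that is cut. -/
theorem IsFrame.insert_cut {k : ℕ} {α : Diagram k} {C : Finset (Fin k)} {w : Equiv.Perm (Fin k)}
    (h : IsFrame α C w) {a b : Fin k} (hb : w b ∉ C) (hne : a ≠ b)
    (hab : α (Sum.inl (w a)) (Sum.inl (w b))) : IsFrame α (insert (w a) C) w where
  valid c hc := h.valid c fun h' => hc (Finset.mem_insert_of_mem h')
  cover i j hij := by
    obtain ⟨c, hc, h1⟩ := h.cover i j hij
    have hb' : w b ∉ insert (w a) C := by
      rw [Finset.mem_insert, not_or]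
      exact ⟨fun h => hne (w.injective h).symm, hb⟩
    by_cases hca : c = a
    · exact ⟨b, hb', α.trans' h1 (hca ▸ hab)⟩
    · refine ⟨c, ?_, h1⟩
      rw [Finset.mem_insert, not_or]
      exact ⟨fun h => hca (w.injective h), hc⟩

theorem swap_rel {A : Type} [DecidableEq A] (π : Setoid A) {a b : A} (h : π a b) (c : A) :
    π (Equiv.swap a b c) c := by
  rw [Equiv.swap_apply_def]
  split_ifs with h1 h2
  · exact h1 ▸ π.symm' h
  · exact h2 ▸ h
  · exact π.refl' c

theorem IsFrame.swap {k : ℕ} {α : Diagram k} {C : Finset (Fin k)} {w : Equiv.Perm (Fin k)}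
    (h : IsFrame α C w) {a b c d : Fin k} (hab : topRow α a b) (hcd : botRow α c d) :
    IsFrame α (C.map (Equiv.swap a b).toEmbedding) (Equiv.swap a b * w * Equiv.swap c d) where
  valid x hx := by
    rw [Equiv.Perm.mul_apply, Equiv.Perm.mul_apply] at hx ⊢
    have hx' : w (Equiv.swap c d x) ∉ C := fun h' => hx (Finset.mem_map_of_mem _ h')
    exact α.trans' (swap_rel (topRow α) hab _) (α.trans' (h.valid _ hx')
      (swap_rel (botRow α) hcd _))
  cover i j hij := by
    obtain ⟨x, hx, h1⟩ := h.cover i j hij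
    refine ⟨Equiv.swap c d x, ?_, ?_⟩ <;>
      rw [Equiv.Perm.mul_apply, Equiv.Perm.mul_apply, Equiv.swap_apply_self]
    · intro h'
      obtain ⟨y, hy, hxy⟩ := Finset.mem_map.1 h'
      exact hx ((Equiv.swap a b).injective hxy ▸ hy)
    · exact α.trans' h1 (α.symm' (swap_rel (topRow α) hab _))

-- Normal forms depend only on their diagrams

namespace PartitionGenerators

variable {k : ℕ} {B : Type} [Monoid B] (G : PartitionGenerators k B)

/-- The product of a factorization. -/
def normal (d : NormalData k) : B :=
  G.linkAll d.top * G.cutAll d.cut * G.W d.perm * G.linkAll d.bot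

/-- The product of the factorization of `α` along a frame. -/
def framed (α : Diagram k) (C : Finset (Fin k)) (w : Equiv.Perm (Fin k)) : B :=
  G.normal ⟨topRow α, C, w, botRow α⟩

/-- A link passes through the product along uncut strands, so the relations absorbed on the left and
on the right correspond along them. Glued together they contain the diagram generated by the data;
hence the product absorbs all links within the rows of that diagram. -/
theorem normal_eq_framed (d : NormalData k) : G.normal d = G.framed d.diag d.cut d.perm := by
  set x := G.normal d with hx
  have h : ∀ a b, d.perm a ∉ d.cut → d.perm b ∉ d.cut →
      (G.leftLinks x (d.perm a) (d.perm b) ↔ G.rightLinks x a b) := by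
    intro a b ha hb
    have e : G.link (d.perm a) (d.perm b) * x = x * G.link a b := by
      have e1 := (G.link_comm_linkAll d.top (d.perm a) (d.perm b)).eq
      have e2 := (G.link_comm_cutAll ha hb).eq
      have e3 := (G.link_comm_linkAll d.bot a b).eq
      rw [hx, normal, mul_assoc _ _ (G.link a b), ← e3, ← mul_assoc, ← mul_assoc, ← mul_assoc,
        e1, mul_assoc (G.linkAll d.top), e2, ← mul_assoc _ (G.link a b) (G.linkAll d.bot),
        mul_assoc _ (G.W d.perm) (G.link a b), W_mul_link]
      simp only [mul_assoc]
    exact ⟨fun h => e.symm.trans h, fun h => e.trans h⟩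
  have h1 : d.top ≤ G.leftLinks x := fun {a b} hab => by
    change _ * x = x
    rw [hx, normal, mul_assoc (G.linkAll d.top), mul_assoc (G.linkAll d.top), ← mul_assoc,
      G.link_mul_linkAll hab]
  have h2 : d.bot ≤ G.rightLinks x := fun {a b} hab => by
    change x * _ = x
    rw [hx, normal, mul_assoc _ (G.linkAll d.bot), G.linkAll_mul_link hab]
  have key := d.diag_le_glue h h1 h2
  have h3 : G.linkAll (topRow d.diag) * x = x :=
    G.linkAll_mul_of_forall fun a b hab => key hab
  have h4 : x * G.linkAll (botRow d.diag) = x :=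
    G.mul_linkAll_of_forall fun a b hab => key hab
  rw [← h3, ← h4, hx, normal, framed, normal, mul_assoc _ _ (G.linkAll (botRow d.diag)),
    G.linkAll_mul_linkAll_of_le d.bot_le, ← mul_assoc, ← mul_assoc, ← mul_assoc,
    G.linkAll_mul_linkAll_of_ge d.top_le]

theorem linkAll_mul_W_swap {π : Setoid (Fin k)} {a b : Fin k} (h : π a b) :
    G.linkAll π * G.W (Equiv.swap a b) = G.linkAll π := by
  rw [← G.linkAll_mul_link h, mul_assoc, link_mul_W_swap]

theorem W_swap_mul_linkAll {π : Setoid (Fin k)} {a b : Fin k} (h : π a b) :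
    G.W (Equiv.swap a b) * G.linkAll π = G.linkAll π := by
  rw [← G.link_mul_linkAll h, ← mul_assoc, W_swap_mul_link]

theorem normal_swap_top (d : NormalData k) {a b : Fin k} (h : d.top a b) :
    G.normal d = G.normal ⟨d.top, d.cut.map (Equiv.swap a b).toEmbedding,
      Equiv.swap a b * d.perm, d.bot⟩ := by
  rw [normal, normal, map_mul, ← mul_assoc, mul_assoc (G.linkAll d.top) (G.cutAll (d.cut.map _)),
    ← W_mul_cutAll, ← mul_assoc, G.linkAll_mul_W_swap h]

theorem normal_swap_bot (d : NormalData k) {a b : Fin k} (h : d.bot a b) :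
    G.normal d = G.normal ⟨d.top, d.cut, d.perm * Equiv.swap a b, d.bot⟩ := by
  rw [normal, normal, map_mul, ← mul_assoc, mul_assoc _ (G.W (Equiv.swap a b)),
    G.W_swap_mul_linkAll h]

/-- Two uncut strands in one block are linked at both ends. Since link, cut, link equals link, a cut
may be inserted on one of them. -/
theorem framed_cut {α : Diagram k} {C : Finset (Fin k)} {w : Equiv.Perm (Fin k)}
    (h : IsFrame α C w) {a b : Fin k} (ha : w a ∉ C) (hb : w b ∉ C) (hne : a ≠ b)
    (hab : α (Sum.inl (w a)) (Sum.inl (w b))) :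
    G.framed α C w = G.framed α (insert (w a) C) w := by
  have hbot : botRow α a b :=
    α.trans' (α.symm' (h.valid a ha)) (α.trans' hab (h.valid b hb))
  have e1 : G.W w * G.linkAll (botRow α)
      = G.link (w a) (w b) * (G.W w * G.linkAll (botRow α)) := by
    nth_rw 1 [← G.link_mul_linkAll hbot]
    rw [← mul_assoc, W_mul_link, mul_assoc]
  have e2 : G.linkAll (topRow α) = G.linkAll (topRow α) * G.link (w a) (w b) :=
    (G.linkAll_mul_link (π := topRow α) hab).symm
  have hne' : w a ≠ w b := fun h => hne (w.injective h)
  have e3 : G.cutAll C * G.link (w a) (w b) = G.link (w a) (w b) * G.cutAll C :=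
    (G.link_comm_cutAll ha hb).eq.symm
  simp only [framed, normal]
  rw [mul_assoc _ (G.W w), mul_assoc _ (G.W w), e1, e2, cutAll_insert _ ha]
  generalize G.W w * G.linkAll (botRow α) = y
  calc G.linkAll (topRow α) * G.link (w a) (w b) * G.cutAll C * (G.link (w a) (w b) * y)
      = G.linkAll (topRow α) * (G.link (w a) (w b) * (G.cutAll C * G.link (w a) (w b))) * y := by
        simp only [mul_assoc]
    _ = G.linkAll (topRow α) * (G.link (w a) (w b) * G.link (w a) (w b)) * G.cutAll C * y := by
        rw [e3]; simp only [mul_assoc]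
    _ = G.linkAll (topRow α) * (G.link (w a) (w b) * G.pt (w a) * G.link (w a) (w b))
          * G.cutAll C * y := by
        rw [link_mul_self, G.link_pt_link hne']
    _ = G.linkAll (topRow α) * (G.link (w a) (w b) * G.pt (w a) *
          (G.link (w a) (w b) * G.cutAll C)) * y := by
        simp only [mul_assoc]
    _ = _ := by rw [← e3]; simp only [mul_assoc]

theorem framed_swap {α : Diagram k} (C : Finset (Fin k)) (w : Equiv.Perm (Fin k))
    {a b c d : Fin k} (hab : topRow α a b) (hcd : botRow α c d) :
    G.framed α C w = G.framed α (C.map (Equiv.swap a b).toEmbedding)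
      (Equiv.swap a b * w * Equiv.swap c d) := by
  rw [framed, G.normal_swap_top _ hab, G.normal_swap_bot _ hcd]
  rfl

/-- The uncut strands of `w'` occur among those of `w`. Each additional strand of `w` shares its
block with one of them and can be cut. When the cut sets agree, the permutations differ only on cut
points, where `cutAll_mul_W` absorbs the difference. -/
theorem framed_eq_of_agree {α : Diagram k} {C C' : Finset (Fin k)} {w w' : Equiv.Perm (Fin k)}
    (h : IsFrame α C w) (h' : IsFrame α C' w')
    (hag : ∀ b, w' b ∉ C' → w b = w' b ∧ w b ∉ C) :
    G.framed α C w = G.framed α C' w' := by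
  obtain ⟨n, hn⟩ : ∃ n, Cᶜ.card = n := ⟨_, rfl⟩
  induction n using Nat.strong_induction_on generalizing C with | _ n ih =>
  by_cases hc : ∃ b, w b ∉ C ∧ w b ∈ C'
  · obtain ⟨a, ha, ha'⟩ := hc
    obtain ⟨b, hb, hab⟩ := h'.cover _ _ (h.valid a ha)
    obtain ⟨e, hb'⟩ := hag b hb
    have hne : a ≠ b := by
      rintro rfl
      exact hb (e ▸ ha')
    rw [← e] at hab
    rw [G.framed_cut h ha hb' hne hab]
    refine ih _ ?_ (h.insert_cut hb' hne hab) (fun c hc => ⟨(hag c hc).1, ?_⟩) rfl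
    · rw [← hn]
      refine Finset.card_lt_card ⟨Finset.compl_subset_compl.2 (Finset.subset_insert _ _),
        fun hs => ?_⟩
      exact Finset.mem_compl.1 (hs (Finset.mem_compl.2 ha)) (Finset.mem_insert_self _ _)
    · rw [Finset.mem_insert, not_or]
      refine ⟨fun h => ?_, (hag c hc).2⟩
      rw [← (hag c hc).1, h] at hc
      exact hc ha'
  · push Not at hc
    have hCC : C = C' := by
      ext i
      obtain ⟨b, rfl⟩ := w.surjective i
      obtain ⟨b', hb'⟩ := w'.surjective (w b)
      constructor
      · intro hi
        by_contra hi'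
        obtain ⟨h1, h2⟩ := hag b' (hb' ▸ hi')
        rw [h1, hb'] at h2
        exact h2 hi
      · intro hi
        by_contra hi'
        exact hc b hi' hi
    subst hCC
    have e : G.cutAll C * G.W w = G.cutAll C * G.W w' := by
      have : w = (w * w'⁻¹) * w' := by rw [inv_mul_cancel_right]
      rw [this, map_mul, ← mul_assoc, cutAll_mul_W]
      intro a ha
      obtain ⟨b, rfl⟩ := w'.surjective a
      rw [Equiv.Perm.mul_apply, Equiv.Perm.inv_def, Equiv.symm_apply_apply]
      exact (hag b ha).1
    simp only [framed, normal]
    rw [mul_assoc (G.linkAll _), e, ← mul_assoc]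

/-- A strand of the reduced frame missing from `w` has a strand of `w` in its block; transpositions
inside the two rows of that block move the latter onto the former, so the number of missing strands
drops. -/
theorem framed_eq {α : Diagram k} {C C' : Finset (Fin k)} {w w' : Equiv.Perm (Fin k)}
    (h : IsFrame α C w) (h' : IsReducedFrame α C' w') :
    G.framed α C w = G.framed α C' w' := by
  classical
  obtain ⟨n, hn⟩ : ∃ n, (Finset.univ.filter fun b =>
    w' b ∉ C' ∧ ¬(w b = w' b ∧ w b ∉ C)).card = n := ⟨_, rfl⟩
  induction n using Nat.strong_induction_on generalizing C w with | _ n ih =>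
  by_cases hc : ∃ b, w' b ∉ C' ∧ ¬(w b = w' b ∧ w b ∉ C)
  · obtain ⟨b, hb, hbm⟩ := hc
    obtain ⟨c, hcC, hbc⟩ := h.cover _ _ (h'.1.valid b hb)
    have hbot : botRow α b c :=
      α.trans' (α.symm' (h'.1.valid b hb)) (α.trans' hbc (h.valid c hcC))
    rw [G.framed_swap C w (α := α) hbc hbot]
    have hmem : ∀ x, Equiv.swap (w' b) (w c) x ∈ C.map (Equiv.swap (w' b) (w c)).toEmbedding ↔
        x ∈ C := fun x => Finset.mem_map' _
    refine ih _ ?_ (IsFrame.swap h hbc hbot) rfl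
    rw [← hn]
    refine Finset.card_lt_card ((Finset.ssubset_iff_of_subset ?_).2 ⟨b, ?_, ?_⟩)
    · intro x hx
      rw [Finset.mem_filter] at hx ⊢
      refine ⟨hx.1, hx.2.1, fun hm => hx.2.2 ?_⟩
      have hxb : x ≠ b := by
        rintro rfl
        exact hbm hm
      -- Here reducedness enters: a strand already in place cannot be the one moved, since two
      -- strands of `w'` would then lie in one block.
      have hxc : x ≠ c := by
        rintro rfl
        exact hxb (h'.2 _ _ hx.2.1 hb (α.symm' (hm.1 ▸ hbc)))
      have e : Equiv.swap (w' b) (w c) (w x) = w x :=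
        Equiv.swap_apply_of_ne_of_ne (hm.1 ▸ fun h => hxb (w'.injective h))
          fun h => hxc (w.injective h)
      rw [Equiv.Perm.mul_apply, Equiv.Perm.mul_apply, Equiv.swap_apply_of_ne_of_ne hxb hxc]
      exact ⟨e.trans hm.1, fun h' => hm.2 ((hmem _).1 h')⟩
    · exact Finset.mem_filter.2 ⟨Finset.mem_univ _, hb, hbm⟩
    · rw [Finset.mem_filter]
      rintro ⟨-, -, hx⟩
      refine hx ?_
      rw [Equiv.Perm.mul_apply, Equiv.Perm.mul_apply, Equiv.swap_apply_left, Equiv.swap_apply_right]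
      refine ⟨rfl, fun h' => hcC ?_⟩
      rwa [← hmem, Equiv.swap_apply_right]
  · push Not at hc
    refine G.framed_eq_of_agree h h'.1 fun b hb => ?_
    by_contra hcon
    rw [not_and] at hcon
    obtain ⟨h1, h2⟩ := hc b hb
    exact hcon h1 h2

/-- The element of a diagram. -/
def ofDiagram (α : Diagram k) : B :=
  G.framed α (exists_isReducedFrame α).choose (exists_isReducedFrame α).choose_spec.choose

theorem normal_eq_ofDiagram (d : NormalData k) : G.normal d = G.ofDiagram d.diag := by
  rw [normal_eq_framed]
  exact G.framed_eq d.isFrame_diag (exists_isReducedFrame d.diag).choose_spec.choose_spec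

end PartitionGenerators

-- Products of generators reduce to normal forms

namespace PartitionGenerators

variable {k : ℕ} {B : Type} [Monoid B] (G : PartitionGenerators k B)

theorem normal_one : G.normal ⟨⊥, ∅, 1, ⊥⟩ = 1 := by
  have h : G.linkAll ⊥ = 1 := by
    have := G.mul_linkAll_of_forall (π := ⊥) (y := 1) fun a b hab => by
      rw [show a = b from hab, link_self, one_mul]
    rwa [one_mul] at this
  have e : G.cutAll ∅ = 1 := Finset.noncommProd_empty _ _
  simp only [normal, h, e, map_one, one_mul]

theorem W_mul_normal (g : Equiv.Perm (Fin k)) (d : NormalData k) :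
    G.W g * G.normal d = G.normal ⟨Setoid.comap g.symm d.top, d.cut.map g.toEmbedding,
      g * d.perm, d.bot⟩ := by
  simp only [normal, ← mul_assoc, W_mul_linkAll, map_mul]
  rw [mul_assoc _ (G.W g) (G.cutAll _), W_mul_cutAll]
  simp only [mul_assoc]

theorem link_mul_normal (a b : Fin k) (d : NormalData k) :
    ∃ d', G.link a b * G.normal d = G.normal d' := by
  refine ⟨⟨G.leftLinks (G.link a b * G.linkAll d.top), d.cut, d.perm, d.bot⟩, ?_⟩
  rw [normal, normal, ← link_mul_linkAll_eq, ← mul_assoc, ← mul_assoc, ← mul_assoc]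

/-- The cut at i commutes past the top links and meets the other cuts: it either joins them or
repeats one, which yields a factor z. -/
theorem pt_mul_normal_of_singleton (d : NormalData k) {i : Fin k}
    (h : ∀ a, d.top i a → a = i) : ∃ m d', G.pt i * G.normal d = G.z ^ m * G.normal d' := by
  have e : G.pt i * G.normal d
      = G.linkAll d.top * (G.pt i * G.cutAll d.cut) * G.W d.perm * G.linkAll d.bot := by
    rw [normal, ← mul_assoc, ← mul_assoc, ← mul_assoc, (G.pt_comm_linkAll h).eq]
    simp only [mul_assoc]
  by_cases hi : i ∈ d.cut
  · refine ⟨1, d, ?_⟩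
    have hz : Commute G.z (G.linkAll d.top) := G.commute_linkAll fun _ _ _ => G.z_comm_link _ _
    rw [e, G.pt_mul_cutAll hi, ← mul_assoc, ← hz.eq, pow_one, normal]
    simp only [mul_assoc]
  · refine ⟨0, ⟨d.top, insert i d.cut, d.perm, d.bot⟩, ?_⟩
    rw [e, pow_zero, one_mul, normal, cutAll_insert _ hi]

/-- Write the top links as one link from i to j times the links with i isolated. The new and the old
cut at i meet across that link, and cut, link, cut equals cut, so no factor z appears. -/
theorem pt_mul_normal_of_mem (d : NormalData k) {i j : Fin k} (hij : d.top i j) (hne : j ≠ i)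
    (hi : i ∈ d.cut) :
    G.pt i * G.normal d = G.normal ⟨isolate d.top i, d.cut, d.perm, d.bot⟩ := by
  rw [normal, normal]
  simp only [← mul_assoc]
  congr 2
  rw [← G.link_mul_linkAll_isolate hij hne, ← G.pt_mul_cutAll_erase hi, mul_assoc, mul_assoc,
    ← mul_assoc (G.linkAll _), ← (G.pt_comm_linkAll_isolate d.top i).eq]
  have h : ∀ y, G.pt i * (G.link i j * (G.pt i * y)) = G.pt i * y := fun y => by
    rw [← mul_assoc, ← mul_assoc, G.pt_link_pt hne.symm]
  rw [mul_assoc, h, ← mul_assoc, (G.pt_comm_linkAll_isolate d.top i).eq, mul_assoc]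

theorem pt_mul_normal (i : Fin k) (d : NormalData k) :
    ∃ m d', G.pt i * G.normal d = G.z ^ m * G.normal d' := by
  -- Passing to a frame first makes it possible to cut a redundant strand in the block of i.
  rw [normal_eq_framed]
  have hF := d.isFrame_diag
  generalize d.diag = α at hF
  generalize d.cut = C at hF
  generalize d.perm = w at hF
  -- If another point j of the top class of i is cut, interchanging i and j moves that cut to i.
  have step : ∀ (C : Finset (Fin k)) (j : Fin k), j ∈ C → topRow α i j → j ≠ i →
      ∃ m d', G.pt i * G.framed α C w = G.z ^ m * G.normal d' := by
    intro C j hj hij hne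
    have hm := Finset.mem_map_of_mem (Equiv.swap i j).toEmbedding hj
    rw [Equiv.toEmbedding_apply, Equiv.swap_apply_right] at hm
    rw [framed, G.normal_swap_top _ hij, G.pt_mul_normal_of_mem _ hij hne hm]
    exact ⟨0, _, by rw [pow_zero, one_mul]⟩
  by_cases hs : ∀ a, topRow α i a → a = i
  · exact G.pt_mul_normal_of_singleton ⟨topRow α, C, w, botRow α⟩ hs
  · push Not at hs
    obtain ⟨j, hij, hne⟩ := hs
    by_cases hi : i ∈ C
    · rw [framed, G.pt_mul_normal_of_mem _ hij hne hi]
      exact ⟨0, _, by rw [pow_zero, one_mul]⟩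
    by_cases hj : j ∈ C
    · exact step C j hj hij hne
    · obtain ⟨a, rfl⟩ := w.surjective j
      obtain ⟨b, rfl⟩ := w.surjective i
      have hab : a ≠ b := fun h => hne (congrArg w h)
      rw [G.framed_cut hF hj hi hab (α.symm' hij)]
      exact step _ _ (Finset.mem_insert_self _ _) hij hne

/-- The submonoid of the generators. -/
def span : Submonoid B :=
  Submonoid.closure ({G.z} ∪ {x | ∃ i, i + 1 < k ∧ x = G.s i} ∪ {x | ∃ i, i < k ∧ x = G.p i} ∪
    {x | ∃ i, i + 1 < k ∧ x = G.q i})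

/-- Normal forms up to powers of z contain 1 and are stable under left multiplication by every
generator. -/
theorem exists_eq_of_mem_span {x : B} (hx : x ∈ G.span) :
    ∃ m α, x = G.z ^ m * G.ofDiagram α := by
  suffices h : ∃ m d, x = G.z ^ m * G.normal d by
    obtain ⟨m, d, h⟩ := h
    exact ⟨m, _, h.trans (by rw [normal_eq_ofDiagram])⟩
  induction hx using Submonoid.closure_induction_left with
  | one => exact ⟨0, _, by rw [normal_one, pow_zero, one_mul]⟩
  | mul_left y hy x hx ih =>
    obtain ⟨m, d, rfl⟩ := ih
    have key : Commute G.z y → (∃ n d', y * G.normal d = G.z ^ n * G.normal d') →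
        ∃ n d', y * (G.z ^ m * G.normal d) = G.z ^ n * G.normal d' := by
      rintro hc ⟨n, d', h⟩
      refine ⟨m + n, d', ?_⟩
      rw [← mul_assoc, ← (hc.pow_left m).eq, mul_assoc, h, ← mul_assoc, pow_add]
    rcases hy with ((hy | ⟨i, hi, rfl⟩) | ⟨i, hi, rfl⟩) | ⟨i, hi, rfl⟩
    · obtain rfl : y = G.z := hy
      exact ⟨m + 1, d, by rw [← mul_assoc, pow_succ']⟩
    · refine key (G.z_comm_s i hi) ?_
      rw [← G.W_adjSwap hi, W_mul_normal]
      exact ⟨0, _, by rw [pow_zero, one_mul]⟩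
    · exact key (G.z_comm_p i hi) (G.pt_mul_normal ⟨i, hi⟩ d)
    · refine key (G.z_comm_q i hi) ?_
      obtain ⟨d', h⟩ := G.link_mul_normal ⟨i, by omega⟩ ⟨i + 1, hi⟩ d
      rw [G.link_adj hi] at h
      exact ⟨0, d', by rw [h, pow_zero, one_mul]⟩

end PartitionGenerators

-- The action of normal forms on tuples

namespace PartitionGenerators

variable {k : ℕ} {B : Type} [Monoid B] (G : PartitionGenerators k B)

/-- The homomorphism sends the generators to the standard operators on functions of tuples. -/
structure IsTupleRep {Ω : Type} [DecidableEq Ω] [Fintype Ω] (φ : B →* TupleOp Ω) : Prop where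
  s : ∀ i, i + 1 < k → φ (G.s i) = TupleOp.S i
  p : ∀ i, i < k → φ (G.p i) = TupleOp.P i
  q : ∀ i, i + 1 < k → φ (G.q i) = TupleOp.Q i

variable {G} {Ω : Type} [DecidableEq Ω] [Fintype Ω] {φ : B →* TupleOp Ω}

theorem IsTupleRep.W (h : G.IsTupleRep φ) (g : Equiv.Perm (Fin k)) (f : (ℕ → Ω) → ℂ)
    (a : ℕ → Ω) : φ (G.W g) f a = f (overwrite (fun j => a (g j)) a) := by
  induction g using W_induction generalizing a with
  | one =>
    rw [map_one, map_one]
    exact congrArg f (overwrite_self a).symm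
  | mul i g hi ih =>
    rw [map_mul, map_mul, G.W_adjSwap hi, h.s i hi, Module.End.mul_apply, TupleOp.S_apply, ih]
    congr 1
    funext j
    simp only [overwrite]
    split_ifs with hj
    · rw [Equiv.Perm.mul_apply, coe_adjSwap hi]
      split_ifs with h1 h2
      · rw [h1, TupleOp.flip_left]
      · rw [h2, TupleOp.flip_right]
      · rw [TupleOp.flip_of_ne ⟨h1, h2⟩]
    · rw [TupleOp.flip_of_ne ⟨by omega, by omega⟩]

theorem IsTupleRep.link (h : G.IsTupleRep φ) (i j : Fin k) (f : (ℕ → Ω) → ℂ) (a : ℕ → Ω) :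
    φ (G.link i j) f a = if a i = a j then f a else 0 := by
  by_cases hij : i = j
  · rw [hij, link_self, map_one, if_pos rfl]; rfl
  have hk := two_le_of_ne hij
  obtain ⟨g, rfl, rfl⟩ := exists_perm_zero_one hij hk
  rw [link_conj, G.link_adj hk, map_mul, map_mul, h.q 0 hk, Module.End.mul_apply,
    Module.End.mul_apply, h.W, TupleOp.Q_apply, h.W]
  have e0 := overwrite_apply (fun j => a (g j)) a ⟨0, by omega⟩
  have e1 := overwrite_apply (fun j => a (g j)) a ⟨0 + 1, hk⟩
  simp only at e0 e1
  rw [e0, e1, overwrite_overwrite]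
  simp only [overwrite_apply, Equiv.Perm.inv_def, Equiv.apply_symm_apply, overwrite_self]

theorem IsTupleRep.pt (h : G.IsTupleRep φ) (i : Fin k) (f : (ℕ → Ω) → ℂ) (a : ℕ → Ω) :
    φ (G.pt i) f a = ∑ v, f (Function.update a i v) := by
  rw [PartitionGenerators.pt, h.p i i.2, TupleOp.P_apply]

open Classical in
theorem IsTupleRep.linkAll (h : G.IsTupleRep φ) (π : Setoid (Fin k)) (f : (ℕ → Ω) → ℂ)
    (a : ℕ → Ω) :
    φ (G.linkAll π) f a = if π ≤ Setoid.ker (fun i : Fin k => a i) then f a else 0 := by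
  split_ifs with hπ
  · refine Finset.noncommProd_induction _ _ _ (fun x => ∀ f, φ x f a = f a) ?_ ?_ ?_ f
    · intro x y hx hy f
      rw [map_mul, Module.End.mul_apply, hx, hy]
    · intro f
      rw [map_one]; rfl
    · intro x hx f
      rw [h.link, if_pos]
      exact hπ (Finset.mem_filter.1 hx).2
  · have : ∃ c d, π c d ∧ a c ≠ a d := by
      by_contra hc
      push Not at hc
      exact hπ fun {c d} hcd => hc c d hcd
    obtain ⟨c, d, hcd, hne⟩ := this
    rw [← G.link_mul_linkAll hcd, map_mul, Module.End.mul_apply, h.link, if_neg hne]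

open Classical in
theorem IsTupleRep.cutAll (h : G.IsTupleRep φ) (C : Finset (Fin k)) (f : (ℕ → Ω) → ℂ)
    (a : ℕ → Ω) : φ (G.cutAll C) f a
      = ∑ c : Fin k → Ω, if ∀ i ∉ C, c i = a i then f (overwrite c a) else 0 := by
  induction C using Finset.induction_on generalizing a with
  | empty =>
    have e : G.cutAll ∅ = 1 := Finset.noncommProd_empty _ _
    rw [e, map_one, Finset.sum_eq_single (fun i : Fin k => a i)]
    · rw [if_pos fun _ _ => rfl, overwrite_self]; rfl
    · intro c _ hc
      rw [if_neg]
      intro h'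
      exact hc (funext fun i => h' i (Finset.notMem_empty i))
    · intro h'
      exact absurd (Finset.mem_univ _) h'
  | insert i C hi ih =>
    rw [G.cutAll_insert hi, map_mul, Module.End.mul_apply, h.pt]
    simp only [ih]
    rw [Finset.sum_comm]
    refine Finset.sum_congr rfl fun c _ => ?_
    have e : ∀ v, overwrite c (Function.update a i v) = overwrite c a := by
      intro v
      funext j
      simp only [overwrite]
      split_ifs with hj
      · rfl
      · exact Function.update_of_ne (by omega) _ _
    simp only [e]
    have e' : ∀ v, (∀ j ∉ C, c j = Function.update a i v j) ↔
        v = c i ∧ ∀ j ∉ insert i C, c j = a j := by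
      intro v
      constructor
      · intro hc
        refine ⟨by rw [hc i hi, Function.update_self], fun j hj => ?_⟩
        rw [Finset.mem_insert, not_or] at hj
        rw [hc j hj.2, Function.update_of_ne fun h => hj.1 (Fin.ext h)]
      · rintro ⟨rfl, hc⟩ j hj
        by_cases hji : j = i
        · rw [hji, Function.update_self]
        · rw [Function.update_of_ne fun h => hji (Fin.ext h)]
          exact hc j (by rw [Finset.mem_insert, not_or]; exact ⟨hji, hj⟩)
    simp only [e', ite_and]
    rw [Finset.sum_ite_eq' Finset.univ (c i), if_pos (Finset.mem_univ _)]

/-- A connection between the rows passes through an uncut strand, so equality of letters along the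
uncut strands, together with constancy on the blocks in each row, suffices. -/
theorem compatible_iff_of_isFrame {α : Diagram k} {C : Finset (Fin k)} {w : Equiv.Perm (Fin k)}
    (hF : IsFrame α C w) (a c : Fin k → Ω) : Compatible α a (fun j => c (w j)) ↔
      topRow α ≤ Setoid.ker a ∧ (∀ i ∉ C, c i = a i) ∧
        botRow α ≤ Setoid.ker (fun j => c (w j)) := by
  constructor
  · intro h
    refine ⟨fun {i j} hij => h hij, fun i hi => ?_, fun {i j} hij => h hij⟩
    obtain ⟨b, rfl⟩ := w.surjective i
    exact (h (hF.valid b hi)).symm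
  · rintro ⟨h1, h2, h3⟩
    have key : ∀ i j, α (Sum.inl i) (Sum.inr j) → a i = c (w j) := by
      intro i j hij
      obtain ⟨b, hb, hib⟩ := hF.cover i j hij
      have e1 : a i = a (w b) := h1 hib
      have e2 : c (w b) = c (w j) :=
        h3 (α.trans' (α.symm' (hF.valid b hb)) (α.trans' (α.symm' hib) hij))
      rw [e1, ← h2 _ hb, e2]
    rintro (i | i) (j | j) hij
    · exact h1 hij
    · exact key i j hij
    · exact (key j i (α.symm' hij)).symm
    · exact h3 hij

/-- The top links test the given row, the cuts sum over rows that agree with it at uncut points, the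
permutation reads such a row as the bottom row, and the bottom links test the result. Together these
are the compatibility conditions for α. -/
theorem IsTupleRep.framed (h : G.IsTupleRep φ) {α : Diagram k} {C : Finset (Fin k)}
    {w : Equiv.Perm (Fin k)} (hF : IsFrame α C w) : φ (G.framed α C w) = diagramOp Ω α := by
  classical
  refine LinearMap.ext fun f => funext fun a => ?_
  rw [PartitionGenerators.framed, normal, map_mul, map_mul, map_mul, Module.End.mul_apply,
    Module.End.mul_apply, Module.End.mul_apply, h.linkAll, h.cutAll, diagramOp_apply]
  simp only [h.W, h.linkAll]
  have hsum : (∑ b : Fin k → Ω, if Compatible α (fun i => a i) b then f (overwrite b a) else 0)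
      = ∑ c : Fin k → Ω, if Compatible α (fun i => a i) (fun j => c (w j)) then
          f (overwrite (fun j => c (w j)) a) else 0 :=
    -- Bottom rows are reindexed by `w`, so the summation runs over the row before the permutation.
    (Fintype.sum_equiv (Equiv.arrowCongr w.symm (Equiv.refl Ω)) _ _ fun c => rfl).symm
  refine Eq.trans ?_ (Eq.trans hsum.symm ?_)
  swap
  · rfl
  simp only [overwrite_overwrite, overwrite_apply, compatible_iff_of_isFrame hF, ite_and]
  split_ifs
  · rfl
  · rw [Finset.sum_const_zero]

theorem IsTupleRep.ofDiagram (h : G.IsTupleRep φ) (α : Diagram k) :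
    φ (G.ofDiagram α) = diagramOp Ω α :=
  h.framed (exists_isReducedFrame α).choose_spec.choose_spec.1

end PartitionGenerators

-- Recovering the relations of the transpositions

section Ring

variable {R : Type} [Ring R]

/-- The relations between two neighbouring generators of the affine partition algebra that are
used to recover those of the partition algebra: `a = τ_{2i}`, `b = τ_{2i+1}`, `q = e_{2i}`,
`p = e_{2i-1}`, `p' = e_{2i+1}`. -/
structure IsLocal (a b q p p' : R) : Prop where
  a_sq : a * a = 1 - q
  b_sq : b * b = 1 - q
  comm : a * b = b * a
  q_sq : q * q = q
  a_q : a * q = 0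
  q_a : q * a = 0
  b_q : b * q = 0
  q_b : q * b = 0
  q_p_q : q * p * q = q
  q_p'_q : q * p' * q = q
  a_p_a : a * p * a = b * p' * b
  q_p_a : q * p * a = q * p' * b
  a_p_q : a * p * q = b * p' * q
  a_p_p' : a * p * p' = b * p * p'

variable {a b q p p' : R}

theorem IsLocal.s_mul_q (h : IsLocal a b q p p') : (a * b + q) * q = q := by
  rw [add_mul, mul_assoc, h.b_q, mul_zero, zero_add, h.q_sq]

theorem IsLocal.q_mul_s (h : IsLocal a b q p p') : q * (a * b + q) = q := by
  rw [mul_add, ← mul_assoc, h.q_a, zero_mul, zero_add, h.q_sq]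

theorem IsLocal.s_mul_s (h : IsLocal a b q p p') : (a * b + q) * (a * b + q) = 1 := by
  have h1 : a * b * (a * b) = 1 - q := by
    calc a * b * (a * b) = a * b * (b * a) := by rw [h.comm]
      _ = a * (b * b) * a := by noncomm_ring
      _ = a * a - a * q * a := by rw [h.b_sq]; noncomm_ring
      _ = 1 - q := by rw [h.a_sq, h.a_q, zero_mul, sub_zero]
  have h2 : q * (a * b) = 0 := by rw [← mul_assoc, h.q_a, zero_mul]
  rw [mul_add, h.s_mul_q, add_mul, h1, h2, add_zero, sub_add_cancel]

/-- The four summands of the expansion are the corners of p' with respect to the idempotents q and 1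
- q: the pure corner comes from a p a = b p' b and the mixed ones from q p a = q p' b and a p q = b
p' q. -/
theorem IsLocal.s_p_s (h : IsLocal a b q p p') : (a * b + q) * p * (a * b + q) = p' := by
  have h1 : a * b * p * (a * b) = p' - q * p' - p' * q + q := by
    calc a * b * p * (a * b) = b * (a * p * a) * b := by
          nth_rw 1 [h.comm]; noncomm_ring
      _ = b * b * p' * (b * b) := by rw [h.a_p_a]; noncomm_ring
      _ = p' - q * p' - p' * q + q * p' * q := by rw [h.b_sq]; noncomm_ring
      _ = _ := by rw [h.q_p'_q]
  have h2 : a * b * p * q = p' * q - q := by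
    calc a * b * p * q = b * (a * p * q) := by rw [h.comm]; noncomm_ring
      _ = b * b * p' * q := by rw [h.a_p_q]; noncomm_ring
      _ = p' * q - q * p' * q := by rw [h.b_sq]; noncomm_ring
      _ = _ := by rw [h.q_p'_q]
  have h3 : q * p * (a * b) = q * p' - q := by
    calc q * p * (a * b) = q * p * a * b := by noncomm_ring
      _ = q * p' * (b * b) := by rw [h.q_p_a]; noncomm_ring
      _ = q * p' - q * p' * q := by rw [h.b_sq]; noncomm_ring
      _ = _ := by rw [h.q_p'_q]
  calc (a * b + q) * p * (a * b + q)
      = a * b * p * (a * b) + a * b * p * q + q * p * (a * b) + q * p * q := by noncomm_ring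
    _ = p' := by rw [h1, h2, h3, h.q_p_q]; abel

theorem IsLocal.s_mul_p (h : IsLocal a b q p p') : (a * b + q) * p = p' * (a * b + q) := by
  calc (a * b + q) * p = (a * b + q) * p * ((a * b + q) * (a * b + q)) := by
        rw [h.s_mul_s, mul_one]
    _ = p' * (a * b + q) := by rw [← mul_assoc, h.s_p_s]

theorem IsLocal.s_mul_p_mul_p' (h : IsLocal a b q p p') :
    (a * b + q) * (p * p') = p * p' := by
  calc (a * b + q) * (p * p') = b * (a * p * p') + q * p * p' := by rw [h.comm]; noncomm_ring
    _ = b * b * p * p' + q * p * p' := by rw [h.a_p_p']; noncomm_ring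
    _ = p * p' := by rw [h.b_sq]; noncomm_ring

/-- From `x = a x a + q p a + a p q`. -/
theorem q_mul_of_skein {x : R} (hq : q * q = q) (h1 : q * a = 0)
    (h : x = a * x * a + q * p * a + a * p * q) : q * x = q * p * a := by
  rw [h, mul_add, mul_add]
  simp only [← mul_assoc, h1, hq, zero_mul, zero_add, add_zero]

theorem mul_q_of_skein {x : R} (hq : q * q = q) (h1 : a * q = 0)
    (h : x = a * x * a + q * p * a + a * p * q) : x * q = a * p * q := by
  rw [h, add_mul, add_mul]
  simp only [mul_assoc, h1, hq, mul_zero, zero_add, add_zero]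

/-- The conjugate of `q` by the next transposition. -/
theorem s_q_s_aux {P a b q r : R} (hb : b * b = 1 - q) (hab : a * b = b * a)
    (haq : a * q = 0) (hqa : q * a = 0) (hbq : b * q = 0)
    (hqr : q * r = r * q) (hbr : b * r = r * b) (hP : a * r * a = P) :
    (a * b + q) * r * (a * b + q) = P + r * (q * q) := by
  have hbP : b * P = P * b := by
    rw [← hP, ← mul_assoc, ← mul_assoc, ← hab, mul_assoc a b r, hbr, ← mul_assoc,
      mul_assoc _ b a, ← hab, ← mul_assoc]
  have hPq : P * q = 0 := by rw [← hP, mul_assoc, haq, mul_zero]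
  have h1 : a * b * r * (a * b) = P := by
    calc a * b * r * (a * b) = b * (a * r * a) * b := by
          nth_rw 1 [hab]; noncomm_ring
      _ = P * (b * b) := by rw [hP, hbP, mul_assoc]
      _ = P - P * q := by rw [hb]; noncomm_ring
      _ = P := by rw [hPq, sub_zero]
  have h2 : a * b * r * q = 0 := by
    rw [mul_assoc, ← hqr, ← mul_assoc, mul_assoc a, hbq, mul_zero, zero_mul]
  have h3 : q * r * (a * b) = 0 := by
    rw [hqr, mul_assoc, ← mul_assoc q, hqa, zero_mul, mul_zero]
  calc (a * b + q) * r * (a * b + q)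
      = a * b * r * (a * b) + a * b * r * q + q * r * (a * b) + q * r * q := by noncomm_ring
    _ = _ := by rw [h1, h2, h3, add_zero, add_zero, hqr, mul_assoc]

end Ring

-- Partition generators inside the affine algebra

namespace AffinePartitionAlgebra

variable {k : ℕ}

theorem mk_eq {x y : FreeAlgebra ℂ (AffGen k)} (h : AffRel k x y) :
    RingQuot.mkAlgHom ℂ (AffRel k) x = RingQuot.mkAlgHom ℂ (AffRel k) y :=
  RingQuot.mkAlgHom_rel ℂ h

theorem isLocal {i : ℕ} (hi : i + 1 < k) :
    IsLocal (τ k (2 * i + 2)) (τ k (2 * i + 3)) (e k (2 * i + 2)) (e k (2 * i + 1))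
      (e k (2 * i + 3)) := by
  have hi' : 1 ≤ i + 1 ∧ i + 1 < k := ⟨by omega, hi⟩
  have hqq : e k (2 * i + 2) * e k (2 * i + 2) = e k (2 * i + 2) := by
    have h := mk_eq (AffRel.r3ii (i + 1) hi'); rw [map_pow, pow_two] at h; exact h
  have haq : τ k (2 * i + 2) * e k (2 * i + 2) = 0 := by
    have h := mk_eq (AffRel.r3iv (i + 1) hi'); rw [map_mul, map_zero] at h; exact h
  have hqa : e k (2 * i + 2) * τ k (2 * i + 2) = 0 := by
    have h := mk_eq (AffRel.r3iv' (i + 1) hi'); rw [map_mul, map_zero] at h; exact h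
  have hbq : τ k (2 * i + 3) * e k (2 * i + 2) = 0 := by
    have h := mk_eq (AffRel.r3iii (i + 1) hi'); rw [map_mul, map_zero] at h; exact h
  have hqb : e k (2 * i + 2) * τ k (2 * i + 3) = 0 := by
    have h := mk_eq (AffRel.r3iii' (i + 1) hi'); rw [map_mul, map_zero] at h; exact h
  have hx : x k (2 * i + 2) = τ k (2 * i + 2) * x k (2 * i + 2) * τ k (2 * i + 2)
      + e k (2 * i + 2) * e k (2 * i + 1) * τ k (2 * i + 2)
      + τ k (2 * i + 2) * e k (2 * i + 1) * e k (2 * i + 2) := by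
    have h := mk_eq (AffRel.r8iii (i + 1) hi')
    simp only [map_add, map_mul] at h; exact h
  have hy : x k (2 * i + 3) = τ k (2 * i + 3) * x k (2 * i + 3) * τ k (2 * i + 3)
      + e k (2 * i + 2) * e k (2 * i + 3) * τ k (2 * i + 3)
      + τ k (2 * i + 3) * e k (2 * i + 3) * e k (2 * i + 2) := by
    have h := mk_eq (AffRel.r8iv (i + 1) hi')
    simp only [map_add, map_mul] at h; exact h
  refine ⟨?_, ?_, ?_, hqq, haq, hqa, hbq, hqb, ?_, ?_, ?_, ?_, ?_, ?_⟩
  · have h := mk_eq (AffRel.r1i (i + 1) hi'); rw [map_pow, pow_two, map_sub, map_one] at h; exact h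
  · have h := mk_eq (AffRel.r1ii (i + 1) hi'); rw [map_pow, pow_two, map_sub, map_one] at h; exact h
  · have h := mk_eq (AffRel.r2i (i + 1) (i + 1) hi' hi' (by omega)); rw [map_mul, map_mul] at h
    exact h.symm
  · have h := mk_eq (AffRel.r5i' (k := k) (2 * i + 1) (by omega)); rw [map_mul, map_mul] at h
    exact h
  · have h := mk_eq (AffRel.r5i (k := k) (2 * i + 2) (by omega)); rw [map_mul, map_mul] at h
    exact h
  · have h := mk_eq (AffRel.r5ii (i + 1) hi'); simp only [map_mul] at h; exact h
  -- Multiplying the skein relations by e_{2i+2} evaluates its products with x_{2i+2} and x_{2i+3},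
  -- which anti-symmetry equates. The next relation is the mirror image.
  · have h := mk_eq (AffRel.r9i (k := k) (2 * i + 2) (by omega))
    rw [map_mul, map_sub, map_zero, mul_sub, sub_eq_zero] at h
    rw [← q_mul_of_skein hqq hqa hx, ← q_mul_of_skein hqq hqb hy]
    exact h
  · have h := mk_eq (AffRel.r9ii (k := k) (2 * i + 2) (by omega))
    rw [map_mul, map_sub, map_zero, sub_mul, sub_eq_zero] at h
    rw [← mul_q_of_skein hqq haq hx, ← mul_q_of_skein hqq hbq hy]
    exact h
  · have h := mk_eq (AffRel.r3v (i + 1) hi'); simp only [map_mul] at h; exact h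

/-- The transposition of `i + 1` and `i + 2`. -/
def sGen (k i : ℕ) : AffinePartitionAlgebra k :=
  τ k (2 * i + 2) * τ k (2 * i + 3) + e k (2 * i + 2)

theorem sGen_eq (i : ℕ) : sGen k i = RingQuot.mkAlgHom ℂ (AffRel k) (Free.s k (i + 1)) := by
  rw [Free.s, map_add, map_mul]; rfl

theorem e_commute {i j : ℕ} (hi : 1 ≤ i ∧ i < 2 * k) (hj : 1 ≤ j ∧ j < 2 * k)
    (h : i + 2 ≤ j ∨ j + 2 ≤ i) : Commute (e k i) (e k j) := by
  have h := mk_eq (AffRel.r4i i j hi hj h)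
  rw [map_mul, map_mul] at h; exact h

theorem τ_odd_commute_e_odd {i j : ℕ} (hi : i + 1 < k) (hj : j < k) (h : j ≠ i ∧ j ≠ i + 1) :
    Commute (τ k (2 * i + 3)) (e k (2 * j + 1)) := by
  have h := mk_eq (AffRel.r4ii (k := k) (i + 2) (j + 1) (by omega) (by omega) (by omega))
  rw [map_mul, map_mul] at h; exact h

theorem τ_odd_commute_e_even {i j : ℕ} (hi : i + 1 < k) (hj : j + 1 < k) (h : j ≠ i + 1) :
    Commute (τ k (2 * i + 3)) (e k (2 * j + 2)) := by
  have h := mk_eq (AffRel.r4iii (k := k) (i + 2) (j + 1) (by omega) (by omega) (by omega))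
  rw [map_mul, map_mul] at h; exact h

theorem τ_even_commute_e_odd {i j : ℕ} (hi : i + 1 < k) (hj : j < k) (h : j ≠ i ∧ j ≠ i + 1) :
    Commute (τ k (2 * i + 2)) (e k (2 * j + 1)) := by
  have h := mk_eq (AffRel.r4iv (k := k) (i + 1) (j + 1) (by omega) (by omega) (by omega))
  rw [map_mul, map_mul] at h; exact h

theorem τ_even_commute_e_even {i j : ℕ} (hi : i + 1 < k) (hj : j + 1 < k) (h : j + 1 ≠ i) :
    Commute (τ k (2 * i + 2)) (e k (2 * j + 2)) := by
  have h := mk_eq (AffRel.r4v (k := k) (i + 1) (j + 1) (by omega) (by omega) (by omega))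
  rw [map_mul, map_mul] at h; exact h

theorem τ_odd_commute_τ_even {i j : ℕ} (hi : i + 1 < k) (hj : j + 1 < k) (h : j ≠ i + 1) :
    Commute (τ k (2 * i + 3)) (τ k (2 * j + 2)) := by
  have h := mk_eq (AffRel.r2i (k := k) (i + 1) (j + 1) (by omega) (by omega) (by omega))
  rw [map_mul, map_mul] at h; exact h

theorem τ_odd_commute_τ_odd {i j : ℕ} (hi : i + 1 < k) (hj : j + 1 < k)
    (h : j ≠ i + 1 ∧ i ≠ j + 1) : Commute (τ k (2 * i + 3)) (τ k (2 * j + 3)) := by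
  have h := mk_eq (AffRel.r2ii (k := k) (i + 1) (j + 1) (by omega) (by omega) (by omega))
  rw [map_mul, map_mul] at h; exact h

theorem τ_even_commute_τ_even {i j : ℕ} (hi : i + 1 < k) (hj : j + 1 < k)
    (h : j ≠ i + 1 ∧ i ≠ j + 1) : Commute (τ k (2 * i + 2)) (τ k (2 * j + 2)) := by
  have h := mk_eq (AffRel.r2iii (k := k) (i + 1) (j + 1) (by omega) (by omega) (by omega))
  rw [map_mul, map_mul] at h; exact h

theorem sGen_commute_e_even {i j : ℕ} (hi : i + 1 < k) (hj : j + 1 < k)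
    (h : i + 2 ≤ j ∨ j + 2 ≤ i) : Commute (sGen k i) (e k (2 * j + 2)) :=
  ((τ_even_commute_e_even hi hj (by omega)).mul_left
    (τ_odd_commute_e_even hi hj (by omega))).add_left
      (e_commute (by omega) (by omega) (by omega))

theorem sGen_commute_e_odd {i j : ℕ} (hi : i + 1 < k) (hj : j < k)
    (h : j ≠ i ∧ j ≠ i + 1) : Commute (sGen k i) (e k (2 * j + 1)) :=
  ((τ_even_commute_e_odd hi hj h).mul_left (τ_odd_commute_e_odd hi hj h)).add_left
    (e_commute (by omega) (by omega) (by omega))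

theorem sGen_commute_sGen {i j : ℕ} (h : i + 2 ≤ j) (hj : j + 1 < k) :
    Commute (sGen k i) (sGen k j) := by
  have hi : i + 1 < k := by omega
  refine Commute.add_right (Commute.mul_right ?_ ?_) (sGen_commute_e_even hi hj (Or.inl h))
  · exact ((τ_even_commute_τ_even hi hj (by omega)).mul_left
      (τ_odd_commute_τ_even hi hj (by omega))).add_left
        (τ_even_commute_e_even hj hi (by omega)).symm
  · exact ((τ_odd_commute_τ_even hj hi (by omega)).symm.mul_left
      (τ_odd_commute_τ_odd hi hj (by omega))).add_left
        (τ_odd_commute_e_even hj hi (by omega)).symm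

/-- Both conjugates equal τ_{2i+4} e_{2i+2} τ_{2i+4} + e_{2i+2} e_{2i+4}. The first summand is
shared by relation 5, and for the right-hand side the two τ exchange roles in `s_q_s_aux`. -/
theorem sGen_e_sGen {i : ℕ} (hi : i + 2 < k) :
    sGen k (i + 1) * e k (2 * i + 2) * sGen k (i + 1)
      = sGen k i * e k (2 * (i + 1) + 2) * sGen k i := by
  have h := isLocal (k := k) (i := i) (by omega)
  have h' := isLocal (k := k) (i := i + 1) (by omega)
  have hP : τ k (2 * (i + 1) + 2) * e k (2 * i + 2) * τ k (2 * (i + 1) + 2)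
      = τ k (2 * i + 3) * e k (2 * (i + 1) + 2) * τ k (2 * i + 3) := by
    have h := mk_eq (AffRel.r5iii (k := k) (i + 2) (by omega))
    simp only [map_mul] at h; exact h
  have hq := (e_commute (k := k) (i := 2 * (i + 1) + 2) (j := 2 * i + 2) (by omega) (by omega)
    (by omega)).eq
  rw [sGen, sGen, s_q_s_aux h'.b_sq h'.comm h'.a_q h'.q_a h'.b_q hq
    (τ_odd_commute_e_even (by omega) (by omega) (by omega)).eq hP, h.comm,
    s_q_s_aux h.a_sq h.comm.symm h.b_q h.q_b h.a_q hq.symm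
      (τ_even_commute_e_even (by omega) (by omega) (by omega)).eq rfl, h.q_sq, h'.q_sq, hq]

theorem z_commute (y : AffinePartitionAlgebra k) : Commute (z k 0) y := by
  obtain ⟨y, rfl⟩ := RingQuot.mkAlgHom_surjective ℂ (AffRel k) y
  induction y using FreeAlgebra.induction with
  | grade0 r =>
    rw [AlgHom.commutes]
    exact (Algebra.commutes r _).symm
  | grade1 g =>
    have h := mk_eq (AffRel.r10ii 0 g)
    rw [map_mul, map_mul] at h; exact h
  | mul a b ha hb => rw [map_mul]; exact ha.mul_right hb
  | add a b ha hb => rw [map_add]; exact ha.add_right hb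

/-- The generators of the partition algebra inside the affine partition algebra. -/
def generators (k : ℕ) : PartitionGenerators k (AffinePartitionAlgebra k) where
  z := z k 0
  s := sGen k
  p i := e k (2 * i + 1)
  q i := e k (2 * i + 2)
  z_comm_s _ _ := z_commute _
  z_comm_p _ _ := z_commute _
  z_comm_q _ _ := z_commute _
  s_mul_s i hi := (isLocal hi).s_mul_s
  s_braid i hi := by
    have h := mk_eq (AffRel.r2iv (k := k) (i + 1) (by omega))
    rw [map_mul, map_mul, map_mul, map_mul, ← sGen_eq, ← sGen_eq] at h
    exact h
  s_comm i j h hj := sGen_commute_sGen h hj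
  p_mul_p i hi := by
    have h := mk_eq (AffRel.r3i (k := k) (i + 1) (by omega))
    rw [map_pow, map_mul, pow_two] at h
    exact h
  q_mul_q i hi := (isLocal hi).q_sq
  p_q_p i hi := by
    have h := mk_eq (AffRel.r5i (k := k) (2 * i + 1) (by omega))
    rw [map_mul, map_mul] at h
    exact h
  q_p_q i hi := (isLocal hi).q_p_q
  p_comm i j hi hj := by
    by_cases h : i = j
    · rw [h]
      exact Commute.refl _
    · exact e_commute (by omega) (by omega) (by omega)
  q_comm i j hi hj := by
    by_cases h : i = j
    · rw [h]
      exact Commute.refl _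
    · exact e_commute (by omega) (by omega) (by omega)
  p_comm_q i j hi hj h h' := e_commute (by omega) (by omega) (by omega)
  s_mul_q i hi := (isLocal hi).s_mul_q
  q_mul_s i hi := (isLocal hi).q_mul_s
  s_mul_p_mul_p i hi := (isLocal hi).s_mul_p_mul_p'
  s_mul_p i hi := (isLocal hi).s_mul_p
  s_comm_p i j hi hj h h' := sGen_commute_e_odd hi hj ⟨h, h'⟩
  s_comm_q i j hi hj h := sGen_commute_e_even hi hj h
  s_q_s i hi := sGen_e_sGen hi

end AffinePartitionAlgebra

-- Normal forms lie in the submonoid of the generators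

namespace PartitionGenerators

variable {k : ℕ} {B : Type} [Monoid B] (G : PartitionGenerators k B)

theorem z_mem_span : G.z ∈ G.span :=
  Submonoid.subset_closure (Or.inl (Or.inl (Or.inl rfl)))

theorem s_mem_span {i : ℕ} (hi : i + 1 < k) : G.s i ∈ G.span :=
  Submonoid.subset_closure (Or.inl (Or.inl (Or.inr ⟨i, hi, rfl⟩)))

theorem p_mem_span {i : ℕ} (hi : i < k) : G.p i ∈ G.span :=
  Submonoid.subset_closure (Or.inl (Or.inr ⟨i, hi, rfl⟩))

theorem q_mem_span {i : ℕ} (hi : i + 1 < k) : G.q i ∈ G.span :=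
  Submonoid.subset_closure (Or.inr ⟨i, hi, rfl⟩)

theorem W_mem_span (g : Equiv.Perm (Fin k)) : G.W g ∈ G.span := by
  induction g using W_induction with
  | one => rw [map_one]; exact one_mem _
  | mul i g hi ih =>
    rw [map_mul, G.W_adjSwap hi]
    exact mul_mem (G.s_mem_span hi) ih

theorem link_mem_span (i j : Fin k) : G.link i j ∈ G.span := by
  by_cases hij : i = j
  · rw [hij, link_self]; exact one_mem _
  have hk := two_le_of_ne hij
  obtain ⟨g, rfl, rfl⟩ := exists_perm_zero_one hij hk
  rw [link_conj, G.link_adj hk]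
  exact mul_mem (mul_mem (G.W_mem_span g) (G.q_mem_span hk)) (G.W_mem_span _)

theorem normal_mem_span (d : NormalData k) : G.normal d ∈ G.span := by
  have h : ∀ π, G.linkAll π ∈ G.span := fun π =>
    Submonoid.noncommProd_mem _ _ _ _ fun _ _ => G.link_mem_span _ _
  exact mul_mem (mul_mem (mul_mem (h _)
    (Submonoid.noncommProd_mem _ _ _ _ fun i _ => G.p_mem_span i.2)) (G.W_mem_span _)) (h _)

end PartitionGenerators

-- The inclusion and its splitting

open AffinePartitionAlgebra

variable {k : ℕ}

theorem proj_z : proj k (z k 0) = PartitionAlgebra.z k := by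
  rw [(proj_isProjection k).map_z, pow_zero, mul_one]

theorem proj_sGen {i : ℕ} (hi : i + 1 < k) : proj k (sGen k i) = PartitionAlgebra.s k (i + 1) := by
  have hp := proj_isProjection k
  refine ext_tupleRep fun n => ?_
  rw [sGen, map_add, map_mul, hp.map_τ _ (by omega) (by omega), hp.map_τ _ (by omega) (by omega),
    hp.map_e _ (by omega) (by omega), map_add, map_mul, tupleRep_t_even hi, tupleRep_t_odd hi,
    tupleRep_e_even hi, tupleRep_s hi, TupleOp.T_mul_T'_add_Q]

theorem isTupleRep_proj (Ω : Type) [Fintype Ω] [DecidableEq Ω] :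
    (generators k).IsTupleRep (((tupleRep Ω k).comp (proj k) : AffinePartitionAlgebra k →ₐ[ℂ]
      TupleOp Ω) : AffinePartitionAlgebra k →* TupleOp Ω) where
  s i hi := by
    change tupleRep Ω k (proj k (sGen k i)) = _
    rw [proj_sGen hi, tupleRep_s hi]
  p i hi := by
    change tupleRep Ω k (proj k (e k (2 * i + 1))) = _
    rw [(proj_isProjection k).map_e _ (by omega) (by omega), tupleRep_e_odd hi]
  q i hi := by
    change tupleRep Ω k (proj k (e k (2 * i + 2))) = _
    rw [(proj_isProjection k).map_e _ (by omega) (by omega), tupleRep_e_even hi]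

/-- Under every alphabet both sides act by the operator of α, and the alphabets are jointly
faithful. -/
theorem proj_ofDiagram (α : Diagram k) :
    proj k ((generators k).ofDiagram α) = PartitionAlgebra.ofDiagram α :=
  ext_tupleRep fun n => by
    rw [tupleRep_ofDiagram]
    exact (isTupleRep_proj (Fin n)).ofDiagram α

/-- The element of a scaled diagram. -/
def scaledElem (x : ScaledDiagram k) : AffinePartitionAlgebra k :=
  z k 0 ^ x.power * (generators k).ofDiagram x.diagram

theorem proj_scaledElem (x : ScaledDiagram k) :
    proj k (scaledElem x) = MonoidAlgebra.of ℂ (ScaledDiagram k) x := by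
  rw [scaledElem, map_mul, map_pow, proj_z, proj_ofDiagram, PartitionAlgebra.z_pow_mul_ofDiagram]

theorem scaledElem_mem_span (x : ScaledDiagram k) : scaledElem x ∈ (generators k).span :=
  mul_mem (pow_mem (generators k).z_mem_span _) ((generators k).normal_mem_span _)

/-- The projection is injective on the submonoid of generators: each of its elements is z_0^m times
the element of some α, and the image z^m α determines both m and α. Multiplicativity of `scaledHom`
and the values of `incl` on generators both follow. -/
theorem eq_scaledElem_of_mem_span {y : AffinePartitionAlgebra k} (hy : y ∈ (generators k).span)
    {x : ScaledDiagram k} (h : proj k y = MonoidAlgebra.of ℂ (ScaledDiagram k) x) :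
    y = scaledElem x := by
  obtain ⟨m, α, rfl⟩ := (generators k).exists_eq_of_mem_span hy
  have h' := proj_scaledElem (k := k) ⟨m, α⟩
  rw [show x = ⟨m, α⟩ from MonoidAlgebra.of_injective (h.symm.trans h')]
  rfl

variable (k) in
/-- The embedding of the scaled diagrams. -/
def scaledHom : ScaledDiagram k →* AffinePartitionAlgebra k where
  toFun := scaledElem
  map_one' := (eq_scaledElem_of_mem_span (one_mem _) (by rw [map_one, map_one])).symm
  map_mul' x y := (eq_scaledElem_of_mem_span
    (mul_mem (scaledElem_mem_span x) (scaledElem_mem_span y))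
    (by rw [map_mul, map_mul, proj_scaledElem, proj_scaledElem])).symm

variable (k) in
/-- The inclusion of the partition algebra into the affine partition algebra. -/
def incl : PartitionAlgebra k →ₐ[ℂ] AffinePartitionAlgebra k :=
  MonoidAlgebra.lift ℂ _ _ (scaledHom k)

theorem incl_of (x : ScaledDiagram k) :
    incl k (MonoidAlgebra.of ℂ (ScaledDiagram k) x) = scaledElem x :=
  MonoidAlgebra.lift_of _ _

theorem incl_eq_of_mem_span {y : AffinePartitionAlgebra k} (hy : y ∈ (generators k).span)
    {x : ScaledDiagram k} (h : proj k y = MonoidAlgebra.of ℂ (ScaledDiagram k) x) :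
    incl k (MonoidAlgebra.of ℂ (ScaledDiagram k) x) = y := by
  rw [incl_of, eq_scaledElem_of_mem_span hy h]

theorem proj_comp_incl : (proj k).comp (incl k) = AlgHom.id ℂ (PartitionAlgebra k) := by
  refine MonoidAlgebra.algHom_ext (fun x => ?_) (Subsingleton.elim _ _)
  exact (congrArg (proj k) (incl_of x)).trans (proj_scaledElem x)

theorem incl_isInclusion (k : ℕ) : IsInclusion (incl k) where
  map_z := incl_eq_of_mem_span (generators k).z_mem_span proj_z
  map_s i h1 h2 := by
    obtain ⟨i, rfl⟩ : ∃ i', i = i' + 1 := ⟨i - 1, by omega⟩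
    exact incl_eq_of_mem_span ((generators k).s_mem_span h2) (proj_sGen h2)
  map_e j h1 h2 := by
    have hp := (proj_isProjection k).map_e j h1 h2
    rcases even_or_odd_index j h1 with ⟨i, rfl⟩ | ⟨i, rfl⟩
    · rw [e_odd] at hp ⊢
      exact incl_eq_of_mem_span ((generators k).p_mem_span (show i < k by omega)) hp
    · rw [e_even] at hp ⊢
      exact incl_eq_of_mem_span ((generators k).q_mem_span (show i + 1 < k by omega)) hp

/-- Agreement with `incl` on the images of the generators spreads to the image of their submonoid,
and that image contains every basis element z^n α. So the generators of the partition algebra do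
generate it. -/
theorem isInclusion_unique {f : PartitionAlgebra k →ₐ[ℂ] AffinePartitionAlgebra k}
    (hf : IsInclusion f) : f = incl k := by
  have hp := proj_isProjection k
  have hi := incl_isInclusion k
  have key : ∀ y ∈ (generators k).span, f (proj k y) = incl k (proj k y) := by
    intro y hy
    induction hy using Submonoid.closure_induction with
    | one => simp only [map_one]
    | mul x y _ _ hx hy => simp only [map_mul, hx, hy]
    | mem y hy =>
      rcases hy with ((hy | ⟨i, h, rfl⟩) | ⟨i, h, rfl⟩) | ⟨i, h, rfl⟩
      · obtain rfl : y = z k 0 := hy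
        rw [proj_z, hf.map_z, hi.map_z]
      · change f (proj k (sGen k i)) = incl k (proj k (sGen k i))
        rw [proj_sGen h, hf.map_s _ (by omega) h, hi.map_s _ (by omega) h]
      · change f (proj k (e k (2 * i + 1))) = incl k (proj k (e k (2 * i + 1)))
        rw [hp.map_e _ (by omega) (by omega), hf.map_e _ (by omega) (by omega),
          hi.map_e _ (by omega) (by omega)]
      · change f (proj k (e k (2 * i + 2))) = incl k (proj k (e k (2 * i + 2)))
        rw [hp.map_e _ (by omega) (by omega), hf.map_e _ (by omega) (by omega),
          hi.map_e _ (by omega) (by omega)]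
  refine MonoidAlgebra.algHom_ext (fun x => ?_) (Subsingleton.elim _ _)
  have h := key _ (scaledElem_mem_span x)
  rwa [proj_scaledElem] at h

end AffinePartition

end

theorem mainTheorem6 (k : ℕ) :
    ∃ (ι : AffinePartition.PartitionAlgebra k →ₐ[ℂ] AffinePartition.AffinePartitionAlgebra k)
      (pr : AffinePartition.AffinePartitionAlgebra k →ₐ[ℂ] AffinePartition.PartitionAlgebra k),
      (AffinePartition.IsInclusion ι ∧ ∀ f, AffinePartition.IsInclusion f → f = ι) ∧
      (AffinePartition.IsProjection pr ∧ ∀ f, AffinePartition.IsProjection f → f = pr) ∧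
      pr.comp ι = AlgHom.id ℂ (AffinePartition.PartitionAlgebra k) ∧
      Function.Injective ι ∧ Function.Surjective pr := by
  have h : ∀ x, AffinePartition.proj k (AffinePartition.incl k x) = x := fun x =>
    AlgHom.congr_fun AffinePartition.proj_comp_incl x
  exact ⟨AffinePartition.incl k, AffinePartition.proj k,
    ⟨AffinePartition.incl_isInclusion k, fun _ => AffinePartition.isInclusion_unique⟩,
    ⟨AffinePartition.proj_isProjection k, fun _ => AffinePartition.isProjection_unique⟩,
    AffinePartition.proj_comp_incl, Function.LeftInverse.injective h,
    Function.RightInverse.surjective h⟩
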